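/- Let $\mathcal H$ be a separable complex Hilbert space and let $A$ be a (possibly unbounded) self-adjoint operator on $\mathcal H$. For $1\le p<\infty$ let $\mathcal I_p$ be the space of self-adjoint operators $C$ in the Schatten class, i.e. with $\|C\|_p=(\operatorname{Tr}|C|^p)^{1/p}<\infty$, with the topology of the norm $\|\cdot\|_p$; $\mathcal I_2$ is the space of self-adjoint Hilbert–Schmidt operators with the Hilbert–Schmidt norm. For a self-adjoint operator $D$ and $\psi\in\mathcal H$, let $\mu_D^\psi$ be the spectral measure, i.e. the finite Borel measure on $\mathbb R$ with $(\psi,e^{isD}\psi)=\int e^{isE}\,d\mu_D^\psi(E)$ for all $s\in\mathbb R$. It is called purely singular continuous if it is singular with respect to Lebesgue measure and has no atoms. Let $\operatorname{spec}_{\mathrm{disc}}(D)$ be the set of isolated points of $\operatorname{spec}(D)$ that are eigenvalues of finite multiplicity. Then there is a dense $G_\delta$ set of $C$'s in $\mathcal I_2$ for which the set of vectors $$\{\psi\mid \mu^\psi_{A+C}\text{ is purely singular continuous}\}\cup\{\psi\mid (A+C)\psi=E\psi\text{ for some }E\in\operatorname{spec}_{\mathrm{disc}}(A+C)\}$$ spans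 $\mathcal H$, in the sense that its finite linear combinations are dense in $\mathcal H$. The same holds with $\mathcal I_2$ replaced by $\mathcal I_p$ for any real $p>1$. If $A$ has no absolutely continuous spectrum (no nonzero $\psi$ has $\mu_A^\psi$ absolutely continuous with respect to Lebesgue measure), it also holds with $\mathcal I_2$ replaced by $\mathcal I_1$. -/

import Mathlib

open MeasureTheory
open scoped ENNReal

namespace SingCont

variable {H : Type*} [NormedAddCommGroup H] [InnerProductSpace ℂ H] [CompleteSpace H]

/-! ### Schatten classes -/

/-- The trace `∑ ⟪e i, T e i⟫` of a positive bounded operator, with values in `[0, ∞]`.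
The sum does not depend on the orthonormal basis; all bases are treated alike by taking the
supremum over them. -/
noncomputable def posTrace (T : H →L[ℂ] H) : ℝ≥0∞ :=
  ⨆ (w : Set H) (e : HilbertBasis w ℂ H), ∑' i, ENNReal.ofReal (inner ℂ (e i) (T (e i))).re

/-- `|C| ^ p = (C* C) ^ (p / 2)`, by the continuous functional calculus (used for `p > 0`). -/
noncomputable def absPow (p : ℝ) (C : H →L[ℂ] H) : H →L[ℂ] H :=
  cfc (fun x : ℝ => x ^ (p / 2)) (ContinuousLinearMap.adjoint C * C)

/-- The Schatten norm `‖C‖_p = (Tr |C| ^ p) ^ (1 / p)`, with value `∞` off the Schatten class.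
For `p = 2` this is the Hilbert-Schmidt norm, for `p = 1` the trace norm. -/
noncomputable def schattenNorm (p : ℝ) (C : H →L[ℂ] H) : ℝ≥0∞ :=
  posTrace (absPow p C) ^ (1 / p)

variable (H) in
/-- The space of self-adjoint operators in the Schatten class `I_p`. -/
def SASchatten (p : ℝ) : Type _ :=
  {C : H →L[ℂ] H // IsSelfAdjoint C ∧ schattenNorm p C < ∞}

/-- The topology of the Schatten norm: `G` is open if with each of its points it contains a
ball `{D | ‖D - C‖_p < ε}`. -/
instance schattenTopology (p : ℝ) : TopologicalSpace (SASchatten H p) where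
  IsOpen G := ∀ C ∈ G, ∃ ε : ℝ≥0∞, 0 < ε ∧
    ∀ D : SASchatten H p, schattenNorm p (D.1 - C.1) < ε → D ∈ G
  isOpen_univ := fun _ _ => ⟨1, one_pos, fun _ _ => trivial⟩
  isOpen_inter := by
    intro s t hs ht C hC
    obtain ⟨a, ha, ha'⟩ := hs C hC.1
    obtain ⟨b, hb, hb'⟩ := ht C hC.2
    exact ⟨min a b, lt_min ha hb, fun D hD =>
      ⟨ha' D (lt_of_lt_of_le hD (min_le_left _ _)), hb' D (lt_of_lt_of_le hD (min_le_right _ _))⟩⟩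
  isOpen_sUnion := by
    intro S hS C hC
    obtain ⟨t, ht, hCt⟩ := hC
    obtain ⟨a, ha, ha'⟩ := hS t ht C hCt
    exact ⟨a, ha, fun D hD => ⟨t, ht, ha' D hD⟩⟩

/-! ### Spectral theory of (possibly unbounded) self-adjoint operators -/

/-- `U s = exp (i s D)` for all real `s`: `U` is the strongly continuous one-parameter unitary
group whose infinitesimal generator is `i D`, domains included. -/
structure IsExpGroup (D : H →ₗ.[ℂ] H) (U : ℝ → H →L[ℂ] H) : Prop where
  zero : U 0 = 1
  add : ∀ s t : ℝ, U (s + t) = U s * U t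
  unitary : ∀ s : ℝ, U s ∈ unitary (H →L[ℂ] H)
  continuous : ∀ ψ : H, Continuous fun s => U s ψ
  generator : ∀ ψ φ : H,
    (ψ, φ) ∈ D.graph ↔ HasDerivAt (fun s : ℝ => U s ψ) (Complex.I • φ) 0

/-- `μ` is the spectral measure of `D` at `ψ`: the finite Borel measure on the real line with
`⟪ψ, exp (i s D) ψ⟫ = ∫ exp (i s E) dμ(E)` for all real `s`. -/
def IsSpectralMeasure (D : H →ₗ.[ℂ] H) (ψ : H) (μ : Measure ℝ) : Prop :=
  IsFiniteMeasure μ ∧ ∃ U : ℝ → H →L[ℂ] H, IsExpGroup D U ∧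
    ∀ s : ℝ, inner ℂ ψ (U s ψ) = ∫ E : ℝ, Complex.exp (Complex.I * s * E) ∂μ

/-- A measure on the real line is purely singular continuous if it is singular with respect to
Lebesgue measure and has no atoms. -/
def IsPurelySingCont (μ : Measure ℝ) : Prop :=
  μ.MutuallySingular volume ∧ ∀ x : ℝ, μ {x} = 0

/-- The vectors whose spectral measure for `D` is purely singular continuous. -/
def singContVectors (D : H →ₗ.[ℂ] H) : Set H :=
  {ψ | ∃ μ : Measure ℝ, IsSpectralMeasure D ψ μ ∧ IsPurelySingCont μ}

/-- `D` has no absolutely continuous spectrum: only the zero vector has an absolutely continuous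
spectral measure, i.e. the absolutely continuous subspace of `D` is trivial. -/
def NoACSpectrum (D : H →ₗ.[ℂ] H) : Prop :=
  ∀ (ψ : H) (μ : Measure ℝ), IsSpectralMeasure D ψ μ → μ.AbsolutelyContinuous volume → ψ = 0

/-- The spectrum of `D`: the complex `z` such that `D - z`, from the domain of `D` to the whole
space, has no bounded two-sided inverse `R`. -/
def spec (D : H →ₗ.[ℂ] H) : Set ℂ :=
  {z | ¬ ∃ R : H →L[ℂ] H, (∀ ψ : H, (R ψ, ψ + z • R ψ) ∈ D.graph) ∧
    ∀ φ : D.domain, R (D φ - z • (φ : H)) = φ}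

/-- The eigenspace `{ψ | D ψ = E ψ}`. -/
def eigenspace (D : H →ₗ.[ℂ] H) (E : ℂ) : Submodule ℂ H where
  carrier := {ψ | (ψ, E • ψ) ∈ D.graph}
  add_mem' := fun {a b} ha hb => by
    simpa only [Set.mem_ofPred_eq, Prod.mk_add_mk, smul_add] using D.graph.add_mem ha hb
  zero_mem' := by
    simpa only [Set.mem_ofPred_eq, smul_zero, Prod.mk_zero_zero] using D.graph.zero_mem
  smul_mem' := fun c ψ hψ => by
    simpa only [Set.mem_ofPred_eq, Prod.smul_mk, smul_comm c E ψ] using D.graph.smul_mem c hψ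

/-- The discrete spectrum: the isolated points of the spectrum that are eigenvalues of finite
multiplicity. -/
def discreteSpec (D : H →ₗ.[ℂ] H) : Set ℂ :=
  {E | E ∈ spec D ∧ (∃ ε > 0, ∀ z ∈ spec D, ‖z - E‖ < ε → z = E) ∧
    eigenspace D E ≠ ⊥ ∧ FiniteDimensional ℂ (eigenspace D E)}

/-- The solutions `ψ` of `D ψ = E ψ` with `E` in the discrete spectrum of `D`. -/
def discreteEigenvectors (D : H →ₗ.[ℂ] H) : Set H :=
  {ψ | ∃ E ∈ discreteSpec D, ψ ∈ eigenspace D E}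

/-- The operator sum `A + C`, with `C` bounded, on the domain of `A`. -/
def perturb (A : H →ₗ.[ℂ] H) (C : H →L[ℂ] H) : H →ₗ.[ℂ] H :=
  (C : H →ₗ[ℂ] H) +ᵥ A

/-- For a dense `G_δ` of self-adjoint `C` in `I_p`, the vectors with purely singular continuous
spectral measure for `A + C` and the discrete eigenvectors of `A + C` together span the whole
space (finite linear combinations are dense). -/
def GenericSingCont (A : H →ₗ.[ℂ] H) (p : ℝ) : Prop :=
  ∃ G : Set (SASchatten H p), IsGδ G ∧ Dense G ∧ ∀ C ∈ G,
    (Submodule.span ℂ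
      (singContVectors (perturb A C.1) ∪ discreteEigenvectors (perturb A C.1))).topologicalClosure
      = ⊤

end SingCont

namespace SingCont

set_option linter.unusedSectionVars false

open Filter Topology ComplexConjugate

variable {H : Type*} [NormedAddCommGroup H] [InnerProductSpace ℂ H] [CompleteSpace H]

/-! ### Graphs of self-adjoint operators -/

/-! The theorem is Baire's theorem (`SASchatten.baireSpace`) applied to two countable families of
sets of perturbations C. A set of the first kind, `nearlySingular`, requires that a bump function
with values in [0, 1] and Lebesgue integral below ε carry the spectral measure of A + C at ψ up to
mass ε. A set of the second kind, the complement of `hasEssEigenvalue`, forbids eigenvalues of A + C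
that lie in the essential spectrum and in [-M, M] and have an eigenvector in the unit ball with
overlap at least c with ψ. Since C is compact, the essential spectrum is that of A throughout.

Let C lie in all these sets, with ψ running through a countable dense set. Then every spectral
measure of A + C is singular (`mutuallySingular_specMeasure_of_dense`) and every eigenvalue lies off
the essential spectrum, hence in the discrete spectrum (`mem_discreteSpec_of_notMem_essSpec`). A
vector orthogonal to the span in question is orthogonal to all eigenvectors, so its spectral measure
has no atoms; it is then itself one of the spanning vectors and must vanish
(`topologicalClosure_span_eq_top`).

The first sets are open because f(A + C) depends norm-continuously on C for f vanishing at infinity;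
the second are open by weak compactness of the unit ball (`exists_limit_eigenvector`).

Density of the first sets is a Weyl-von Neumann argument (`exists_perturb_invariant_near`). Cutting
ψ spectrally into pieces of width about h gives mutually orthogonal approximate eigenvectors, and a
finite-rank perturbation turns them into exact ones (`exists_perturb_eigenvectors`). Then ψ is close
to a finite-dimensional invariant subspace, whose spectral measures have finite support. The
perturbation has operator norm of order h, while its trace norm is controlled by the length of a
neighbourhood of a compact set carrying most of the spectral measure. For p > 1 a bounded trace norm
and h → 0 suffice. For p = 1 that length must itself be small, which is possible when the spectral
measures of A are singular; the step is then applied to A and to the eigenvectors of a finite-rank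
approximation of C.

Density of the second sets comes from spreading (`exists_perturb_spread`). Because E lies in the
essential spectrum, an eigenvector at E can be joined by N approximate eigenvectors orthogonal to
it; rotating them by a unitary matrix with a flat row and making the rotated vectors eigenvectors
with distinct eigenvalues leaves no eigenvector with overlap above 1/√(N+1) with the old one. A
compactness argument excludes new offending eigenvalues.

All this rests on a functional calculus for unbounded D. It is transported from the continuous
functional calculus of the Cayley transform for functions vanishing at infinity (`c0fc`), extended
to bounded continuous functions through the resolvent (`bcfc`), and represented by measures through
the Riesz theorem (`specMeasure`). -/

theorem mem_graph_iff_inner {D : H →ₗ.[ℂ] H} (hD : IsSelfAdjoint D) {ψ φ : H} :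
    (ψ, φ) ∈ D.graph ↔ ∀ a b : H, (a, b) ∈ D.graph → inner ℂ b ψ = inner ℂ a φ := by
  conv_lhs => rw [← LinearPMap.isSelfAdjoint_def.mp hD,
    LinearPMap.adjoint_graph_eq_graph_adjoint hD.dense_domain, Submodule.mem_adjoint_iff]
  simp only [sub_eq_zero]

theorem inner_graph_comm {D : H →ₗ.[ℂ] H} (hD : IsSelfAdjoint D) {a b ψ φ : H}
    (h : (a, b) ∈ D.graph) (h' : (ψ, φ) ∈ D.graph) : inner ℂ b ψ = inner ℂ a φ :=
  (mem_graph_iff_inner hD).1 h' a b h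

theorem isSelfAdjoint_of_graph {D : H →ₗ.[ℂ] H} (hd : Dense (D.domain : Set H))
    (h : ∀ ψ φ : H, (ψ, φ) ∈ D.graph ↔
      ∀ a b : H, (a, b) ∈ D.graph → inner ℂ b ψ = inner ℂ a φ) : IsSelfAdjoint D := by
  rw [LinearPMap.isSelfAdjoint_def]
  apply LinearPMap.eq_of_eq_graph
  rw [LinearPMap.adjoint_graph_eq_graph_adjoint hd]
  ext ⟨x, y⟩
  rw [Submodule.mem_adjoint_iff, h]
  simp only [sub_eq_zero]

/-! ### Bounded perturbations -/

theorem mem_graph_perturb {A : H →ₗ.[ℂ] H} {C : H →L[ℂ] H} {x y : H} :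
    (x, y) ∈ (perturb A C).graph ↔ (x, y - C x) ∈ A.graph := by
  simp only [LinearPMap.mem_graph_iff, perturb]
  constructor
  · rintro ⟨z, hz, hz'⟩
    refine ⟨z, hz, ?_⟩
    rw [← hz', LinearPMap.vadd_apply, ← hz]
    simp
  · rintro ⟨z, hz, hz'⟩
    refine ⟨z, hz, ?_⟩
    rw [LinearPMap.vadd_apply, hz']
    simp [hz]

theorem perturb_perturb (A : H →ₗ.[ℂ] H) (C C' : H →L[ℂ] H) :
    perturb (perturb A C) C' = perturb A (C + C') := by
  apply LinearPMap.eq_of_eq_graph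
  ext ⟨x, y⟩
  simp only [mem_graph_perturb, add_apply]
  rw [show y - C' x - C x = y - (C x + C' x) by abel]

theorem perturb_zero (A : H →ₗ.[ℂ] H) : perturb A 0 = A := by
  apply LinearPMap.eq_of_eq_graph
  ext ⟨x, y⟩
  rw [mem_graph_perturb, zero_apply, sub_zero]

theorem isSelfAdjoint_perturb {A : H →ₗ.[ℂ] H} (hA : IsSelfAdjoint A) {C : H →L[ℂ] H}
    (hC : IsSelfAdjoint C) : IsSelfAdjoint (perturb A C) := by
  have hs : ∀ x y : H, inner ℂ (C x) y = inner ℂ x (C y) := fun x y =>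
    (ContinuousLinearMap.isSelfAdjoint_iff_isSymmetric.1 hC) x y
  refine isSelfAdjoint_of_graph hA.dense_domain fun ψ φ => ?_
  rw [mem_graph_perturb, mem_graph_iff_inner hA]
  constructor
  · intro h a b hab
    have := h a (b - C a) (mem_graph_perturb.1 hab)
    rw [inner_sub_left, inner_sub_right, hs] at this
    exact sub_left_injective this
  · intro h a b hab
    have := h a (b + C a) (mem_graph_perturb.2 (by simpa using hab))
    rw [inner_add_left, hs] at this
    rw [inner_sub_right, ← this]
    ring

theorem graph_add {D : H →ₗ.[ℂ] H} {a b c d : H} (h : (a, b) ∈ D.graph) (h' : (c, d) ∈ D.graph) :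
    (a + c, b + d) ∈ D.graph := D.graph.add_mem h h'

theorem graph_smul {D : H →ₗ.[ℂ] H} {a b : H} (z : ℂ) (h : (a, b) ∈ D.graph) :
    (z • a, z • b) ∈ D.graph := D.graph.smul_mem z h

theorem graph_sum {D : H →ₗ.[ℂ] H} {ι : Type*} (s : Finset ι) {a b : ι → H}
    (h : ∀ i ∈ s, (a i, b i) ∈ D.graph) : (∑ i ∈ s, a i, ∑ i ∈ s, b i) ∈ D.graph := by
  have := D.graph.sum_mem h
  convert this
  · rw [Prod.fst_sum]
  · rw [Prod.snd_sum]

theorem graph_snd_eq {D : H →ₗ.[ℂ] H} {a b c : H} (h : (a, b) ∈ D.graph) (h' : (a, c) ∈ D.graph) :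
    b = c := D.mem_graph_snd_inj h h' rfl

theorem exists_mem_graph {D : H →ₗ.[ℂ] H} {a : H} (h : a ∈ D.domain) : ∃ b, (a, b) ∈ D.graph :=
  LinearPMap.mem_domain_iff.1 h

theorem isClosed_graph {D : H →ₗ.[ℂ] H} (hD : IsSelfAdjoint D) :
    IsClosed (D.graph : Set (H × H)) := hD.isClosed

/-! ### Lower bounds for `D - z` and the spectrum -/

theorem im_inner_graph {D : H →ₗ.[ℂ] H} (hD : IsSelfAdjoint D) {a b : H}
    (h : (a, b) ∈ D.graph) : (inner ℂ a b).im = 0 := by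
  have h1 := inner_graph_comm hD h h
  rw [← inner_conj_symm] at h1
  exact Complex.conj_eq_iff_im.1 h1

/-- The cross term pairs (D - Re z) a with an imaginary multiple of a, and ⟨(D - Re z) a, a⟩ is
real. The resolvent bounds and the isometry of the Cayley transform both come from this identity. -/
theorem norm_sub_smul_sq {D : H →ₗ.[ℂ] H} (hD : IsSelfAdjoint D) {a b : H}
    (h : (a, b) ∈ D.graph) (z : ℂ) :
    ‖b - z • a‖ ^ 2 = ‖b - (z.re : ℂ) • a‖ ^ 2 + z.im ^ 2 * ‖a‖ ^ 2 := by
  have h1 : b - z • a = (b - (z.re : ℂ) • a) - (z.im * Complex.I) • a := by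
    conv_lhs => rw [← Complex.re_add_im z]
    rw [add_smul]; abel
  have h2 : (inner ℂ (b - (z.re : ℂ) • a) a).im = 0 := by
    have h3 := im_inner_graph hD h
    rw [← inner_conj_symm, Complex.conj_im, neg_eq_zero] at h3
    rw [inner_sub_left, Complex.sub_im, h3, inner_smul_left, Complex.conj_ofReal,
      Complex.im_ofReal_mul, show (inner ℂ a a).im = 0 from inner_self_im (𝕜 := ℂ) a]
    simp
  rw [h1, @norm_sub_sq ℂ, inner_smul_right]
  have h4 : RCLike.re ((z.im * Complex.I) * inner ℂ (b - (z.re : ℂ) • a) a) = 0 := by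
    rw [RCLike.re_eq_complex_re, mul_assoc, Complex.re_ofReal_mul, Complex.I_mul_re, h2]
    simp
  rw [h4, norm_smul]
  simp [mul_pow]

/-- If `D - z` and `D - z̄` are bounded below then `z` is in the resolvent set. -/
theorem notMem_spec_of_bounded_below {D : H →ₗ.[ℂ] H} (hD : IsSelfAdjoint D) {z : ℂ} {c : ℝ}
    (hc : 0 < c) (h : ∀ a b : H, (a, b) ∈ D.graph → c * ‖a‖ ≤ ‖b - z • a‖)
    (h' : ∀ a b : H, (a, b) ∈ D.graph → c * ‖a‖ ≤ ‖b - conj z • a‖) : z ∉ spec D := by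
  -- D - z becomes a bounded operator on the graph, which is complete because D is closed; being
  -- bounded below, it is injective with closed range.
  let T : D.graph →L[ℂ] H :=
    (ContinuousLinearMap.snd ℂ H H - z • ContinuousLinearMap.fst ℂ H H).comp D.graph.subtypeL
  have hT : ∀ x : D.graph, T x = x.1.2 - z • x.1.1 := fun x => rfl
  have hfst : ∀ x : D.graph, ‖x.1.1‖ ≤ c⁻¹ * ‖T x‖ := fun x => by
    rw [inv_mul_eq_div, le_div_iff₀ hc, mul_comm, hT]
    exact h _ _ x.2
  have hcomp : CompleteSpace D.graph := (isClosed_graph hD).completeSpace_coe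
  have hbd : ∀ x : D.graph, ‖x‖ ≤ (c⁻¹ + (1 + ‖z‖ * c⁻¹)) * ‖T x‖ := fun x => by
    have h1 := hfst x
    have h2 : ‖x.1.2‖ ≤ (1 + ‖z‖ * c⁻¹) * ‖T x‖ := by
      calc ‖x.1.2‖ = ‖T x + z • x.1.1‖ := by rw [hT]; simp
        _ ≤ ‖T x‖ + ‖z‖ * ‖x.1.1‖ := (norm_add_le _ _).trans (by rw [norm_smul])
        _ ≤ ‖T x‖ + ‖z‖ * (c⁻¹ * ‖T x‖) := by gcongr
        _ = _ := by ring
    have h3 : 0 ≤ c⁻¹ * ‖T x‖ := by positivity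
    have h4 : 0 ≤ (1 + ‖z‖ * c⁻¹) * ‖T x‖ := by positivity
    change ‖(x : H × H)‖ ≤ _
    rw [Prod.norm_def, add_mul]
    exact max_le (by linarith) (by linarith)
  have hanti : AntilipschitzWith (Real.toNNReal (c⁻¹ + (1 + ‖z‖ * c⁻¹))) T :=
    AddMonoidHomClass.antilipschitz_of_bound T fun x => by
      rw [Real.coe_toNNReal _ (by positivity)]
      exact hbd x
  have hclosed : IsClosed (T.range : Set H) := by
    have := hanti.isClosed_range T.uniformContinuous
    convert this
    ext y
    simp
  have hcr : CompleteSpace T.range := hclosed.completeSpace_coe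
  have hrange : T.range = ⊤ := by
    rw [← Submodule.orthogonal_eq_bot_iff, Submodule.eq_bot_iff]
    intro η hη
    rw [Submodule.mem_orthogonal] at hη
    -- A vector orthogonal to the range of D - z is, by self-adjointness, an eigenvector at conj z,
    -- which the second lower bound excludes.
    have hg : (η, conj z • η) ∈ D.graph := by
      rw [mem_graph_iff_inner hD]
      intro a b hab
      have := hη (T ⟨(a, b), hab⟩) ⟨_, rfl⟩
      rw [hT, inner_sub_left, inner_smul_left, sub_eq_zero] at this
      rw [this, inner_smul_right]
    have := h' _ _ hg
    rw [sub_self, norm_zero] at this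
    have h0 : ‖η‖ ≤ 0 := by
      by_contra hh
      push Not at hh
      nlinarith [mul_pos hc hh]
    exact norm_le_zero_iff.1 h0
  have hbij : Function.Bijective T := ⟨hanti.injective, LinearMap.range_eq_top.1 hrange⟩
  let e := LinearEquiv.ofBijective (T : D.graph →ₗ[ℂ] H) hbij
  have he : ∀ y, T (e.symm y) = y := fun y => e.apply_symm_apply y
  let R : H →L[ℂ] H := LinearMap.mkContinuous
    ((LinearMap.fst ℂ H H).comp (D.graph.subtype.comp e.symm.toLinearMap)) c⁻¹ fun y => by
      have := hfst (e.symm y)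
      rw [he] at this
      exact this
  have hR : ∀ y, R y = (e.symm y).1.1 := fun y => rfl
  rw [spec]
  simp only [Set.mem_ofPred_eq, not_not]
  refine ⟨R, fun ψ => ?_, fun φ => ?_⟩
  · have h1 := he ψ
    rw [hT] at h1
    rw [hR]
    have h2 : ψ + z • (e.symm ψ).1.1 = (e.symm ψ).1.2 := sub_eq_iff_eq_add.1 h1 |>.symm
    rw [h2]
    exact (e.symm ψ).2
  · have : e.symm (D φ - z • (φ : H)) = ⟨((φ : H), D φ), D.mem_graph φ⟩ := by
      rw [LinearEquiv.symm_apply_eq]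
      rfl
    rw [hR, this]

theorem norm_im_le_of_graph {D : H →ₗ.[ℂ] H} (hD : IsSelfAdjoint D) {a b : H}
    (h : (a, b) ∈ D.graph) (z : ℂ) : |z.im| * ‖a‖ ≤ ‖b - z • a‖ := by
  have := norm_sub_smul_sq hD h z
  apply abs_le_of_sq_le_sq' _ (norm_nonneg _) |>.2
  rw [mul_pow, sq_abs, this]
  have := sq_nonneg ‖b - (z.re : ℂ) • a‖
  linarith

theorem notMem_spec_of_im_ne_zero {D : H →ₗ.[ℂ] H} (hD : IsSelfAdjoint D) {z : ℂ}
    (hz : z.im ≠ 0) : z ∉ spec D :=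
  notMem_spec_of_bounded_below hD (abs_pos.2 hz) (fun _ _ h => norm_im_le_of_graph hD h z)
    fun _ _ h => by simpa using norm_im_le_of_graph hD h (conj z)

theorem im_eq_zero_of_mem_spec {D : H →ₗ.[ℂ] H} (hD : IsSelfAdjoint D) {z : ℂ}
    (hz : z ∈ spec D) : z.im = 0 := by
  by_contra h
  exact notMem_spec_of_im_ne_zero hD h hz

theorem notMem_spec_of_real {D : H →ₗ.[ℂ] H} (hD : IsSelfAdjoint D) {x c : ℝ}
    (hc : 0 < c) (h : ∀ a b : H, (a, b) ∈ D.graph → c * ‖a‖ ≤ ‖b - (x : ℂ) • a‖) :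
    (x : ℂ) ∉ spec D :=
  notMem_spec_of_bounded_below hD hc h (by simpa using h)

theorem mem_spec_of_eigenvector {D : H →ₗ.[ℂ] H} {z : ℂ} {u : H}
    (hu : u ≠ 0) (h : (u, z • u) ∈ D.graph) : z ∈ spec D := by
  rintro ⟨R, -, hR⟩
  obtain ⟨v, hv, hv'⟩ := D.mem_graph_iff.1 h
  simp only at hv hv'
  have := hR v
  rw [hv', hv, sub_self, map_zero] at this
  exact hu this.symm

theorem inner_eq_zero_of_eigenvectors {D : H →ₗ.[ℂ] H} (hD : IsSelfAdjoint D) {x y : ℝ} {u v : H}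
    (hxy : x ≠ y) (hu : (u, (x : ℂ) • u) ∈ D.graph) (hv : (v, (y : ℂ) • v) ∈ D.graph) :
    inner ℂ u v = 0 := by
  have := inner_graph_comm hD hu hv
  rw [inner_smul_left, inner_smul_right, Complex.conj_ofReal, ← sub_eq_zero, ← sub_mul] at this
  rcases mul_eq_zero.1 this with h | h
  · exact absurd (by exact_mod_cast sub_eq_zero.1 h) hxy
  · exact h

section

/-! ### The resolvent at `-i` and the Cayley transform -/

theorem exists_resolvent {D : H →ₗ.[ℂ] H} {z : ℂ} (hz : z ∉ spec D) :
    ∃ R : H →L[ℂ] H, (∀ ψ : H, (R ψ, ψ + z • R ψ) ∈ D.graph) ∧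
      ∀ a b : H, (a, b) ∈ D.graph → R (b - z • a) = a := by
  rw [spec, Set.mem_ofPred_eq, not_not] at hz
  obtain ⟨R, h1, h2⟩ := hz
  refine ⟨R, h1, fun a b hab => ?_⟩
  obtain ⟨v, hv, hv'⟩ := D.mem_graph_iff.1 hab
  simpa only [hv, hv'] using h2 v

open Classical in
/-- The resolvent `(D + i)⁻¹`. -/
noncomputable def res (D : H →ₗ.[ℂ] H) : H →L[ℂ] H :=
  if h : -Complex.I ∉ spec D then (exists_resolvent h).choose else 0

theorem notMem_spec_neg_I {D : H →ₗ.[ℂ] H} (hD : IsSelfAdjoint D) : -Complex.I ∉ spec D :=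
  notMem_spec_of_im_ne_zero hD (by simp)

theorem res_mem_graph {D : H →ₗ.[ℂ] H} (hD : IsSelfAdjoint D) (ψ : H) :
    (res D ψ, ψ - Complex.I • res D ψ) ∈ D.graph := by
  have h := notMem_spec_neg_I hD
  have := (exists_resolvent h).choose_spec.1 ψ
  rw [neg_smul, ← sub_eq_add_neg] at this
  rwa [res, dif_pos h]

theorem res_apply {D : H →ₗ.[ℂ] H} (hD : IsSelfAdjoint D) {a b : H} (hab : (a, b) ∈ D.graph) :
    res D (b + Complex.I • a) = a := by
  have h := notMem_spec_neg_I hD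
  have := (exists_resolvent h).choose_spec.2 a b hab
  rw [neg_smul, sub_neg_eq_add] at this
  rwa [res, dif_pos h]

theorem norm_res_apply_le {D : H →ₗ.[ℂ] H} (hD : IsSelfAdjoint D) (ψ : H) : ‖res D ψ‖ ≤ ‖ψ‖ := by
  have := norm_im_le_of_graph hD (res_mem_graph hD ψ) (-Complex.I)
  simpa using this

theorem mem_domain_iff_res {D : H →ₗ.[ℂ] H} (hD : IsSelfAdjoint D) {a : H} :
    a ∈ D.domain ↔ ∃ ψ, res D ψ = a := by
  constructor
  · intro h
    obtain ⟨b, hb⟩ := exists_mem_graph h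
    exact ⟨_, res_apply hD hb⟩
  · rintro ⟨ψ, rfl⟩
    exact LinearPMap.mem_domain_iff.2 ⟨_, res_mem_graph hD ψ⟩

theorem denseRange_res {D : H →ₗ.[ℂ] H} (hD : IsSelfAdjoint D) : DenseRange (res D) := by
  have := hD.dense_domain
  rw [DenseRange]
  convert this
  ext a
  simpa using (mem_domain_iff_res hD).symm

/-- The second resolvent identity writes the difference as minus the product of `res D`, C and the
perturbed resolvent, and both resolvents at -i are contractions. -/
theorem norm_res_perturb_sub_le {D : H →ₗ.[ℂ] H} (hD : IsSelfAdjoint D) {C : H →L[ℂ] H}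
    (hC : IsSelfAdjoint C) : ‖res (perturb D C) - res D‖ ≤ ‖C‖ := by
  refine ContinuousLinearMap.opNorm_le_bound _ (norm_nonneg _) fun ψ => ?_
  have hDC := isSelfAdjoint_perturb hD hC
  have h1 := mem_graph_perturb.1 (res_mem_graph hDC ψ)
  have h2 := res_apply hD h1
  have h3 : ψ - Complex.I • res (perturb D C) ψ - C (res (perturb D C) ψ) +
      Complex.I • res (perturb D C) ψ = ψ - C (res (perturb D C) ψ) := by abel
  rw [h3, map_sub] at h2
  have h4 : (res (perturb D C) - res D) ψ = - res D (C (res (perturb D C) ψ)) := by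
    rw [sub_apply, ← h2, h2]
    nth_rw 1 [← h2]
    abel
  rw [h4, norm_neg]
  calc ‖res D (C (res (perturb D C) ψ))‖ ≤ ‖C (res (perturb D C) ψ)‖ := norm_res_apply_le hD _
    _ ≤ ‖C‖ * ‖res (perturb D C) ψ‖ := C.le_opNorm _
    _ ≤ ‖C‖ * ‖ψ‖ := by gcongr; exact norm_res_apply_le hDC _

/-- The Cayley transform `(D - i)(D + i)⁻¹`. -/
noncomputable def cayley (D : H →ₗ.[ℂ] H) : H →L[ℂ] H := 1 - (2 * Complex.I) • res D

theorem cayley_apply_graph {D : H →ₗ.[ℂ] H} (hD : IsSelfAdjoint D) {a b : H}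
    (hab : (a, b) ∈ D.graph) : cayley D (b + Complex.I • a) = b - Complex.I • a := by
  simp only [cayley, sub_apply, smul_apply, res_apply hD hab]
  rw [mul_smul, two_smul, ContinuousLinearMap.one_def, ContinuousLinearMap.id_apply]
  abel

theorem norm_cayley_apply {D : H →ₗ.[ℂ] H} (hD : IsSelfAdjoint D) (ψ : H) :
    ‖cayley D ψ‖ = ‖ψ‖ := by
  have h := res_mem_graph hD ψ
  have h1 := cayley_apply_graph hD h
  rw [sub_add_cancel] at h1
  have h2 := norm_sub_smul_sq hD h Complex.I
  have h3 := norm_sub_smul_sq hD h (-Complex.I)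
  rw [neg_smul, sub_neg_eq_add, sub_add_cancel] at h3
  rw [h1]
  have : ‖ψ - Complex.I • res D ψ - Complex.I • res D ψ‖ ^ 2 = ‖ψ‖ ^ 2 := by
    rw [h2, h3]; simp
  exact (sq_eq_sq₀ (norm_nonneg _) (norm_nonneg _)).1 this

theorem cayley_mem_unitary {D : H →ₗ.[ℂ] H} (hD : IsSelfAdjoint D) :
    cayley D ∈ unitary (H →L[ℂ] H) := by
  have h1 : star (cayley D) * cayley D = 1 :=
    (ContinuousLinearMap.norm_map_iff_adjoint_comp_self _).1 (norm_cayley_apply hD)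
  refine ⟨h1, ?_⟩
  ext η
  -- Surjectivity uses the other half-plane: with R the resolvent at i, η = (D - i) R η is the image
  -- of (D + i) R η.
  obtain ⟨R, hR, -⟩ := exists_resolvent
    (notMem_spec_of_im_ne_zero hD (z := Complex.I) (by simp))
  have h2 := cayley_apply_graph hD (hR η)
  rw [add_sub_cancel_right] at h2
  set ζ := η + Complex.I • R η + Complex.I • R η
  have h3 : star (cayley D) (cayley D ζ) = ζ := congrArg (fun T : H →L[ℂ] H => T ζ) h1
  rw [← h2]
  exact congrArg (cayley D) h3

theorem norm_cayley_perturb_sub_le {D : H →ₗ.[ℂ] H} (hD : IsSelfAdjoint D) {C : H →L[ℂ] H}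
    (hC : IsSelfAdjoint C) : ‖cayley (perturb D C) - cayley D‖ ≤ 2 * ‖C‖ := by
  have : cayley (perturb D C) - cayley D =
      -((2 * Complex.I) • (res (perturb D C) - res D)) := by
    simp only [cayley, smul_sub]; abel
  rw [this, norm_neg, norm_smul]
  have h2 : ‖(2 * Complex.I)‖ = 2 := by simp
  rw [h2]
  gcongr
  exact norm_res_perturb_sub_le hD hC

/-! ### Functions on the line and on the circle -/

/-- The continuous functions on the line which vanish at infinity. -/
structure IsC0 (f : ℝ → ℂ) : Prop where
  cont : Continuous f
  vanish : Tendsto f (cocompact ℝ) (𝓝 0)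

theorem IsC0.bdd_mul {f g : ℝ → ℂ} (hf : Continuous f) {c : ℝ} (hc : ∀ x, ‖f x‖ ≤ c)
    (hg : IsC0 g) : IsC0 fun x => f x * g x :=
  ⟨hf.mul hg.cont, by
    have := hg.vanish.norm.const_mul c
    rw [norm_zero, mul_zero] at this
    refine squeeze_zero_norm (fun x => ?_) this
    rw [norm_mul]
    gcongr
    exact hc x⟩

theorem IsC0.exists_bound {f : ℝ → ℂ} (hf : IsC0 f) : ∃ c, ∀ x, ‖f x‖ ≤ c := by
  let F : ZeroAtInftyContinuousMap ℝ ℂ := ⟨⟨f, hf.cont⟩, hf.vanish⟩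
  exact ⟨‖F.toBCF‖, fun x => F.toBCF.norm_coe_le_norm x⟩

theorem IsC0.mul {f g : ℝ → ℂ} (hf : IsC0 f) (hg : IsC0 g) : IsC0 fun x => f x * g x := by
  obtain ⟨c, hc⟩ := hf.exists_bound
  exact IsC0.bdd_mul hf.cont hc hg

theorem IsC0.conj {f : ℝ → ℂ} (hf : IsC0 f) : IsC0 fun x => conj (f x) :=
  ⟨Complex.continuous_conj.comp hf.cont, by
    have := (Complex.continuous_conj.tendsto 0).comp hf.vanish
    rw [map_zero] at this
    exact this⟩

theorem add_I_ne_zero (x : ℝ) : (x : ℂ) + Complex.I ≠ 0 := by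
  intro h
  have := congrArg Complex.im h
  simp at this

/-- The function `1 / (x + i)`. -/
noncomputable def resFun (x : ℝ) : ℂ := ((x : ℂ) + Complex.I)⁻¹

theorem isC0_resFun : IsC0 resFun := by
  refine ⟨Continuous.inv₀ (by fun_prop) add_I_ne_zero, ?_⟩
  refine tendsto_inv₀_cobounded.comp ?_
  rw [← tendsto_norm_atTop_iff_cobounded]
  refine tendsto_atTop_mono (f := fun x : ℝ => ‖x‖) (fun x => ?_) tendsto_norm_cocompact_atTop
  have := Complex.abs_re_le_norm ((x : ℂ) + Complex.I)
  simpa using this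

/-- The inverse of the Cayley transform of the line. -/
noncomputable def invCay (z : ℂ) : ℝ := (Complex.I * (1 + z) / (1 - z)).re

/-- On the unit circle conj z = 1/z, so i(1 + z)/(1 - z) is already real and nothing is lost by the
real part in `invCay`. -/
theorem invCay_add_I {z : ℂ} (hz : ‖z‖ = 1) (hz1 : z ≠ 1) :
    (invCay z : ℂ) + Complex.I = 2 * Complex.I / (1 - z) := by
  have h1 : 1 - z ≠ 0 := sub_ne_zero.2 (Ne.symm hz1)
  have h0 : z ≠ 0 := by rintro rfl; simp at hz
  have h2 : conj (Complex.I * (1 + z) / (1 - z)) = Complex.I * (1 + z) / (1 - z) := by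
    have h3 : conj z = z⁻¹ := by
      rw [Complex.inv_def, Complex.normSq_eq_norm_sq, hz]; simp
    have h4 : 1 - z⁻¹ ≠ 0 := by
      rw [sub_ne_zero]
      intro h
      exact hz1 (by simpa using h.symm)
    simp only [map_div₀, map_mul, map_add, map_sub, map_one, Complex.conj_I, h3]
    rw [div_eq_div_iff h4 h1]
    field_simp
    ring
  rw [invCay, Complex.conj_eq_iff_re.1 h2]
  field_simp
  ring

theorem continuousAt_invCay {z : ℂ} (hz1 : z ≠ 1) : ContinuousAt invCay z := by
  have h1 : 1 - z ≠ 0 := sub_ne_zero.2 (Ne.symm hz1)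
  unfold invCay
  refine Complex.continuous_re.continuousAt.comp ?_
  exact ContinuousAt.div (by fun_prop) (by fun_prop) h1

open Classical in
/-- The function on the circle which corresponds to `f` under the Cayley transform. -/
noncomputable def circ (f : ℝ → ℂ) (z : ℂ) : ℂ := if z = 1 then 0 else f (invCay z)

theorem tendsto_invCay : Tendsto invCay (𝓝[Metric.sphere 0 1 \ {1}] (1 : ℂ)) (cocompact ℝ) := by
  rw [← Metric.cobounded_eq_cocompact, ← tendsto_norm_atTop_iff_cobounded]
  have h1 : Tendsto (fun z : ℂ => ‖2 * Complex.I / (1 - z)‖ - 1)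
      (𝓝[Metric.sphere 0 1 \ {1}] (1 : ℂ)) atTop := by
    refine tendsto_atTop_add_const_right _ _ ?_
    have h2 : Tendsto (fun z : ℂ => ‖(1 - z)‖⁻¹) (𝓝[Metric.sphere 0 1 \ {1}] (1 : ℂ)) atTop := by
      refine tendsto_inv_nhdsGT_zero.comp ?_
      rw [tendsto_nhdsWithin_iff]
      constructor
      · have : ContinuousAt (fun z : ℂ => ‖1 - z‖) 1 := by fun_prop
        have := this.tendsto.mono_left
          (nhdsWithin_le_nhds (s := Metric.sphere (0 : ℂ) 1 \ {1}))
        simpa using this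
      · filter_upwards [self_mem_nhdsWithin] with z hz
        exact norm_pos_iff.2 (sub_ne_zero.2 (Ne.symm hz.2))
    have := h2.const_mul_atTop (show (0 : ℝ) < 2 by norm_num)
    refine this.congr fun z => ?_
    simp [div_eq_mul_inv]
  refine tendsto_atTop_mono' _ ?_ h1
  filter_upwards [self_mem_nhdsWithin] with z hz
  rw [← invCay_add_I (by simpa using hz.1) hz.2]
  have := norm_add_le (invCay z : ℂ) Complex.I
  simp only [Complex.norm_real, Complex.norm_I] at this
  linarith

/-- The point 1 of the circle plays the role of infinity; the value 0 given to `circ f` there is the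
right one exactly because f vanishes at infinity. -/
theorem continuousOn_circ {f : ℝ → ℂ} (hf : IsC0 f) :
    ContinuousOn (circ f) (Metric.sphere 0 1) := by
  intro z hz
  by_cases hz1 : z = 1
  · subst hz1
    have h0 : circ f 1 = 0 := by simp [circ]
    rw [ContinuousWithinAt, h0]
    have : Metric.sphere (0 : ℂ) 1 = insert 1 (Metric.sphere (0 : ℂ) 1 \ {1}) := by
      rw [Set.insert_sdiff_singleton, Set.insert_eq_of_mem hz]
    rw [this, nhdsWithin_insert, tendsto_sup]
    refine ⟨by rw [← h0]; exact tendsto_pure_nhds _ _, ?_⟩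
    refine (hf.vanish.comp tendsto_invCay).congr' ?_
    filter_upwards [self_mem_nhdsWithin] with w hw
    rw [circ, if_neg (by simpa using hw.2)]
    rfl
  · refine ContinuousAt.continuousWithinAt ?_
    have : (fun w => f (invCay w)) =ᶠ[𝓝 z] circ f := by
      filter_upwards [isOpen_ne.mem_nhds hz1] with w hw
      rw [circ, if_neg hw]
    exact ContinuousAt.congr (hf.cont.continuousAt.comp (continuousAt_invCay hz1)) this

/-! ### The functional calculus for functions vanishing at infinity -/

/-- `f(D)` for `f` vanishing at infinity. -/
noncomputable def c0fc (D : H →ₗ.[ℂ] H) (f : ℝ → ℂ) : H →L[ℂ] H := cfc (circ f) (cayley D)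

theorem spectrum_cayley {D : H →ₗ.[ℂ] H} (hD : IsSelfAdjoint D) :
    spectrum ℂ (cayley D) ⊆ Metric.sphere 0 1 :=
  spectrum.subset_circle_of_unitary (cayley_mem_unitary hD)

theorem continuousOn_circ_spectrum {D : H →ₗ.[ℂ] H} (hD : IsSelfAdjoint D) {f : ℝ → ℂ}
    (hf : IsC0 f) : ContinuousOn (circ f) (spectrum ℂ (cayley D)) :=
  (continuousOn_circ hf).mono (spectrum_cayley hD)

theorem isStarNormal_cayley {D : H →ₗ.[ℂ] H} (hD : IsSelfAdjoint D) : IsStarNormal (cayley D) := by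
  have := cayley_mem_unitary hD
  exact ⟨by rw [Commute, SemiconjBy, this.1, this.2]⟩

theorem c0fc_add {D : H →ₗ.[ℂ] H} (hD : IsSelfAdjoint D) {f g : ℝ → ℂ} (hf : IsC0 f)
    (hg : IsC0 g) : c0fc D (fun x => f x + g x) = c0fc D f + c0fc D g := by
  rw [c0fc, c0fc, c0fc, ← cfc_add (a := cayley D) _ _ (continuousOn_circ_spectrum hD hf)
    (continuousOn_circ_spectrum hD hg)]
  congr 1
  ext z
  by_cases h : z = 1 <;> simp [circ, h]

theorem c0fc_mul {D : H →ₗ.[ℂ] H} (hD : IsSelfAdjoint D) {f g : ℝ → ℂ} (hf : IsC0 f)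
    (hg : IsC0 g) : c0fc D (fun x => f x * g x) = c0fc D f * c0fc D g := by
  rw [c0fc, c0fc, c0fc, ← cfc_mul _ _ _ (continuousOn_circ_spectrum hD hf)
    (continuousOn_circ_spectrum hD hg)]
  congr 1
  ext z
  by_cases h : z = 1 <;> simp [circ, h]

theorem c0fc_const_mul {D : H →ₗ.[ℂ] H} (hD : IsSelfAdjoint D) {f : ℝ → ℂ} (hf : IsC0 f) (z : ℂ) :
    c0fc D (fun x => z * f x) = z • c0fc D f := by
  rw [c0fc, c0fc, ← cfc_const_mul _ _ _ (continuousOn_circ_spectrum hD hf)]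
  congr 1
  ext z
  by_cases h : z = 1 <;> simp [circ, h]

theorem c0fc_conj {D : H →ₗ.[ℂ] H} {f : ℝ → ℂ} :
    c0fc D (fun x => conj (f x)) = star (c0fc D f) := by
  rw [c0fc, c0fc, ← cfc_star]
  congr 1
  ext z
  by_cases h : z = 1 <;> simp [circ, h]

theorem c0fc_resFun {D : H →ₗ.[ℂ] H} (hD : IsSelfAdjoint D) : c0fc D resFun = res D := by
  have hn := isStarNormal_cayley hD
  have h1 : Set.EqOn (circ resFun) (fun z => (2 * Complex.I)⁻¹ * (1 - z))
      (spectrum ℂ (cayley D)) := by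
    intro z hz
    have hz' : ‖z‖ = 1 := by simpa using spectrum_cayley hD hz
    by_cases h : z = 1
    · simp [circ, h]
    · simp only [circ, if_neg h, resFun]
      rw [invCay_add_I hz' h, inv_div]
      ring
  rw [c0fc, cfc_congr h1, cfc_const_mul _ _ _ (by fun_prop),
    cfc_sub (fun _ => 1) (fun z => z) _ (by fun_prop) (by fun_prop),
    cfc_const_one ℂ (cayley D), cfc_id' ℂ (cayley D), cayley, sub_sub_cancel, smul_smul,
    inv_mul_cancel₀ (by simp), one_smul]

/-- The Cayley transform is Lipschitz in the perturbation, and all its spectra lie in one compact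
set, the circle, on which the continuous functional calculus is norm-continuous in the operator.
Openness of `nearlySingular` rests on this. -/
theorem continuousAt_c0fc {X : Type*} [TopologicalSpace X] {D : H →ₗ.[ℂ] H}
    (hD : IsSelfAdjoint D) {f : ℝ → ℂ} (hf : IsC0 f) {C : X → H →L[ℂ] H}
    (hsa : ∀ x, IsSelfAdjoint (C x)) {x₀ : X} (h : ContinuousAt C x₀) :
    ContinuousAt (fun x => c0fc (perturb D (C x)) f) x₀ := by
  have hsp : ∀ x, IsSelfAdjoint (perturb D (C x)) := fun x => isSelfAdjoint_perturb hD (hsa x)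
  refine ContinuousAt.cfc (isCompact_sphere (0 : ℂ) 1) _ ?_
    (Eventually.of_forall fun x => spectrum_cayley (hsp x))
    (Eventually.of_forall fun x => isStarNormal_cayley (hsp x)) (continuousOn_circ hf)
  have h0 : Tendsto (fun x => 2 * ‖C x - C x₀‖) (𝓝 x₀) (𝓝 0) := by
    have := ((h.sub continuousAt_const).norm.const_mul 2).tendsto (x := x₀) (f := fun x => 2 * ‖C x - C x₀‖)
    simpa using this
  rw [ContinuousAt, tendsto_iff_norm_sub_tendsto_zero]
  refine squeeze_zero (fun _ => norm_nonneg _) (fun x => ?_) h0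
  have := norm_cayley_perturb_sub_le (hsp x₀) ((hsa x).sub (hsa x₀))
  rwa [perturb_perturb, add_sub_cancel] at this

end

section

/-! ### The functional calculus for bounded continuous functions -/

/-- The bounded continuous functions on the line. -/
structure IsCb (f : ℝ → ℂ) : Prop where
  cont : Continuous f
  bdd : ∃ c, ∀ x, ‖f x‖ ≤ c

theorem IsC0.isCb {f : ℝ → ℂ} (hf : IsC0 f) : IsCb f := ⟨hf.cont, hf.exists_bound⟩

theorem IsCb.mul_isC0 {f g : ℝ → ℂ} (hf : IsCb f) (hg : IsC0 g) : IsC0 fun x => f x * g x :=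
  IsC0.bdd_mul hf.cont hf.bdd.choose_spec hg

theorem IsCb.add {f g : ℝ → ℂ} (hf : IsCb f) (hg : IsCb g) : IsCb fun x => f x + g x := by
  obtain ⟨c, hc⟩ := hf.bdd
  obtain ⟨d, hd⟩ := hg.bdd
  exact ⟨hf.cont.add hg.cont, c + d, fun x => (norm_add_le _ _).trans (add_le_add (hc x) (hd x))⟩

theorem IsCb.mul {f g : ℝ → ℂ} (hf : IsCb f) (hg : IsCb g) : IsCb fun x => f x * g x := by
  obtain ⟨c, hc⟩ := hf.bdd
  obtain ⟨d, hd⟩ := hg.bdd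
  refine ⟨hf.cont.mul hg.cont, c * d, fun x => ?_⟩
  rw [norm_mul]
  exact mul_le_mul (hc x) (hd x) (norm_nonneg _) ((norm_nonneg _).trans (hc x))

theorem isCb_const (z : ℂ) : IsCb fun _ => z := ⟨continuous_const, ‖z‖, fun _ => le_rfl⟩

theorem IsCb.const_mul {f : ℝ → ℂ} (hf : IsCb f) (z : ℂ) : IsCb fun x => z * f x :=
  (isCb_const z).mul hf

theorem IsCb.neg {f : ℝ → ℂ} (hf : IsCb f) : IsCb fun x => -f x := by
  simpa using hf.const_mul (-1)

theorem IsCb.sub {f g : ℝ → ℂ} (hf : IsCb f) (hg : IsCb g) : IsCb fun x => f x - g x := by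
  simpa only [sub_eq_add_neg] using hf.add hg.neg

theorem IsCb.conj {f : ℝ → ℂ} (hf : IsCb f) : IsCb fun x => conj (f x) :=
  ⟨Complex.continuous_conj.comp hf.cont, by simpa using hf.bdd⟩

theorem IsCb.sum {ι : Type*} (s : Finset ι) {f : ι → ℝ → ℂ} (h : ∀ i ∈ s, IsCb (f i)) :
    IsCb fun x => ∑ i ∈ s, f i x := by
  classical
  induction s using Finset.induction_on with
  | empty => simpa using isCb_const 0
  | insert a s ha ih =>
    simp only [Finset.sum_insert ha]
    exact (h a (by simp)).add (ih fun i hi => h i (by simp [hi]))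

theorem isCb_ofReal {f : ℝ → ℝ} (hf : Continuous f) {c : ℝ} (hc : ∀ x, |f x| ≤ c) :
    IsCb fun x => (f x : ℂ) :=
  ⟨Complex.continuous_ofReal.comp hf, c, by simpa using hc⟩

theorem isC0_of_hasCompactSupport {f : ℝ → ℂ} (hf : Continuous f) (h : HasCompactSupport f) :
    IsC0 f :=
  ⟨hf, h.is_zero_at_infty⟩

/-- With r = √(c² - |f|²) one has |fg|² + |rg|² = c²|g|², so the squared norms of (fg)(D)ψ and
(rg)(D)ψ add up to c²‖g(D)ψ‖². This needs no spectral measure, and it is the bound that permits the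
extension to bounded functions. -/
theorem norm_c0fc_mul_le {D : H →ₗ.[ℂ] H} (hD : IsSelfAdjoint D) {f g : ℝ → ℂ}
    (hf : Continuous f) {c : ℝ} (hc : ∀ x, ‖f x‖ ≤ c) (hg : IsC0 g) (ψ : H) :
    ‖c0fc D (fun x => f x * g x) ψ‖ ≤ c * ‖c0fc D g ψ‖ := by
  have hc0 : 0 ≤ c := (norm_nonneg _).trans (hc 0)
  let r : ℝ → ℂ := fun x => ((√(c ^ 2 - ‖f x‖ ^ 2) : ℝ) : ℂ)
  have hr : Continuous r := by fun_prop
  have hrb : ∀ x, ‖r x‖ ≤ c := fun x => by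
    simp only [r, Complex.norm_real, Real.norm_eq_abs, abs_of_nonneg (Real.sqrt_nonneg _)]
    rw [Real.sqrt_le_left hc0]
    have := sq_nonneg ‖f x‖
    linarith
  have hfg := IsC0.bdd_mul hf hc hg
  have hrg := IsC0.bdd_mul hr hrb hg
  have key : ∀ {h : ℝ → ℂ}, IsC0 h →
      ((‖c0fc D h ψ‖ ^ 2 : ℝ) : ℂ) = inner ℂ ψ (c0fc D (fun x => conj (h x) * h x) ψ) := by
    intro h hh
    rw [c0fc_mul hD hh.conj hh, c0fc_conj, mul_apply_eq_comp,
      ContinuousLinearMap.star_eq_adjoint, ContinuousLinearMap.adjoint_inner_right,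
      inner_self_eq_norm_sq_to_K]
    simp
  have h1 : c0fc D (fun x => conj (f x * g x) * (f x * g x)) +
      c0fc D (fun x => conj (r x * g x) * (r x * g x)) =
      (c ^ 2 : ℂ) • c0fc D (fun x => conj (g x) * g x) := by
    rw [← c0fc_add hD (hfg.conj.mul hfg) (hrg.conj.mul hrg),
      ← c0fc_const_mul hD (hg.conj.mul hg)]
    congr 1
    ext x
    have h2 : conj (f x) * f x = ((‖f x‖ ^ 2 : ℝ) : ℂ) := by
      rw [← Complex.normSq_eq_conj_mul_self, Complex.normSq_eq_norm_sq]
    have h3 : conj (r x) * r x = ((c ^ 2 - ‖f x‖ ^ 2 : ℝ) : ℂ) := by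
      simp only [r, Complex.conj_ofReal]
      rw [← Complex.ofReal_mul, Real.mul_self_sqrt]
      have := pow_le_pow_left₀ (norm_nonneg _) (hc x) 2
      linarith
    simp only [map_mul]
    calc _ = (conj (f x) * f x + conj (r x) * r x) * (conj (g x) * g x) := by ring
      _ = _ := by rw [h2, h3]; push_cast; ring
  have h4 : ‖c0fc D (fun x => f x * g x) ψ‖ ^ 2 + ‖c0fc D (fun x => r x * g x) ψ‖ ^ 2 =
      c ^ 2 * ‖c0fc D g ψ‖ ^ 2 := by
    have := congrArg (fun T : H →L[ℂ] H => inner ℂ ψ (T ψ)) h1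
    simp only [add_apply, smul_apply, inner_add_right, inner_smul_right,
      ← key hfg, ← key hrg, ← key hg] at this
    exact_mod_cast this
  have h5 := sq_nonneg ‖c0fc D (fun x => r x * g x) ψ‖
  refine abs_le_of_sq_le_sq' ?_ (by positivity) |>.2
  rw [mul_pow]
  linarith

/-- `f(D)` for bounded continuous `f`. -/
noncomputable def bcfc (D : H →ₗ.[ℂ] H) (f : ℝ → ℂ) : H →L[ℂ] H :=
  LinearMap.extendOfNorm (c0fc D (fun x => f x * resFun x) : H →ₗ[ℂ] H) (res D : H →ₗ[ℂ] H)

section Calculus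

variable {D : H →ₗ.[ℂ] H} (hD : IsSelfAdjoint D)

include hD

theorem norm_bcfc_aux {f : ℝ → ℂ} (hf : Continuous f) {c : ℝ} (hc : ∀ x, ‖f x‖ ≤ c) (ψ : H) :
    ‖c0fc D (fun x => f x * resFun x) ψ‖ ≤ c * ‖res D ψ‖ := by
  rw [← c0fc_resFun hD]
  exact norm_c0fc_mul_le hD hf hc isC0_resFun ψ

/-- This is the defining relation f(D)(D + i)⁻¹ = (f · `resFun`)(D), consistent by the preceding
bound. Identities for `bcfc` are checked on the dense range of the resolvent, where they become
identities for functions vanishing at infinity. -/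
theorem bcfc_res {f : ℝ → ℂ} (hf : IsCb f) (ψ : H) :
    bcfc D f (res D ψ) = c0fc D (fun x => f x * resFun x) ψ := by
  obtain ⟨c, hc⟩ := hf.bdd
  exact LinearMap.extendOfNorm_eq (f := (c0fc D (fun x => f x * resFun x) : H →ₗ[ℂ] H))
    (e := (res D : H →ₗ[ℂ] H)) (denseRange_res hD) ⟨c, norm_bcfc_aux hD hf.cont hc⟩ ψ

theorem norm_bcfc_apply_le {f : ℝ → ℂ} (hf : Continuous f) {c : ℝ} (hc : ∀ x, ‖f x‖ ≤ c) (ψ : H) :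
    ‖bcfc D f ψ‖ ≤ c * ‖ψ‖ :=
  LinearMap.norm_extendOfNorm_apply_le (f := (c0fc D (fun x => f x * resFun x) : H →ₗ[ℂ] H))
    (e := (res D : H →ₗ[ℂ] H)) (denseRange_res hD) c (norm_bcfc_aux hD hf hc) ψ

theorem ext_of_res {S T : H →L[ℂ] H} (h : ∀ ψ, S (res D ψ) = T (res D ψ)) : S = T := by
  have := (denseRange_res hD).equalizer S.continuous T.continuous (funext h)
  ext x
  exact congrFun this x

theorem bcfc_eq_c0fc {f : ℝ → ℂ} (hf : IsC0 f) : bcfc D f = c0fc D f := by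
  refine ext_of_res hD fun ψ => ?_
  rw [bcfc_res hD hf.isCb, c0fc_mul hD hf isC0_resFun, c0fc_resFun hD]
  rfl

/-- Since g(D) commutes with the resolvent, it can be moved past it, after which f(D) acts on a
vector in the range of the resolvent. -/
theorem bcfc_mul_c0fc {f g : ℝ → ℂ} (hf : IsCb f) (hg : IsC0 g) :
    bcfc D f * c0fc D g = c0fc D (fun x => f x * g x) := by
  have comm : ∀ {h : ℝ → ℂ}, IsC0 h → ∀ ψ, c0fc D h (res D ψ) = res D (c0fc D h ψ) := by
    intro h hh ψ
    rw [← c0fc_resFun hD, ← mul_apply_eq_comp, ← mul_apply_eq_comp, ← c0fc_mul hD hh isC0_resFun,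
      ← c0fc_mul hD isC0_resFun hh]
    simp only [mul_comm]
  refine ext_of_res hD fun ψ => ?_
  rw [mul_apply_eq_comp, comm hg, bcfc_res hD hf, comm (hf.mul_isC0 hg), ← c0fc_resFun hD,
    ← mul_apply_eq_comp, ← mul_apply_eq_comp, ← c0fc_mul hD (hf.mul_isC0 isC0_resFun) hg,
    ← c0fc_mul hD isC0_resFun (hf.mul_isC0 hg)]
  congr 2
  ext x
  ring

theorem bcfc_mul {f g : ℝ → ℂ} (hf : IsCb f) (hg : IsCb g) :
    bcfc D (fun x => f x * g x) = bcfc D f * bcfc D g := by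
  refine ext_of_res hD fun ψ => ?_
  rw [mul_apply_eq_comp, bcfc_res hD hg, bcfc_res hD (hf.mul hg), ← mul_apply_eq_comp,
    bcfc_mul_c0fc hD hf (hg.mul_isC0 isC0_resFun)]
  simp only [mul_assoc]

theorem bcfc_add {f g : ℝ → ℂ} (hf : IsCb f) (hg : IsCb g) :
    bcfc D (fun x => f x + g x) = bcfc D f + bcfc D g := by
  refine ext_of_res hD fun ψ => ?_
  rw [add_apply, bcfc_res hD hg, bcfc_res hD hf, bcfc_res hD (hf.add hg), ← add_apply,
    ← c0fc_add hD (hf.mul_isC0 isC0_resFun) (hg.mul_isC0 isC0_resFun)]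
  simp only [add_mul]

theorem bcfc_const_mul {f : ℝ → ℂ} (hf : IsCb f) (z : ℂ) :
    bcfc D (fun x => z * f x) = z • bcfc D f := by
  refine ext_of_res hD fun ψ => ?_
  rw [smul_apply, bcfc_res hD hf, bcfc_res hD (hf.const_mul z), ← smul_apply,
    ← c0fc_const_mul hD (hf.mul_isC0 isC0_resFun)]
  simp only [mul_assoc]

theorem bcfc_one : bcfc D (fun _ => 1) = 1 := by
  refine ext_of_res hD fun ψ => ?_
  rw [bcfc_res hD (isCb_const 1)]
  simp only [one_mul, c0fc_resFun hD]
  rfl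

theorem bcfc_const (z : ℂ) : bcfc D (fun _ => z) = z • 1 := by
  have := bcfc_const_mul hD (isCb_const 1) z
  rw [bcfc_one hD] at this
  simpa using this

theorem bcfc_sub {f g : ℝ → ℂ} (hf : IsCb f) (hg : IsCb g) :
    bcfc D (fun x => f x - g x) = bcfc D f - bcfc D g := by
  have := bcfc_add hD hf (hg.const_mul (-1))
  rw [bcfc_const_mul hD hg] at this
  simpa [sub_eq_add_neg] using this

theorem bcfc_sum {ι : Type*} (s : Finset ι) {f : ι → ℝ → ℂ} (h : ∀ i ∈ s, IsCb (f i)) :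
    bcfc D (fun x => ∑ i ∈ s, f i x) = ∑ i ∈ s, bcfc D (f i) := by
  classical
  induction s using Finset.induction_on with
  | empty => simp [bcfc_const hD]
  | insert a s ha ih =>
    simp only [Finset.sum_insert ha]
    rw [bcfc_add hD (h a (by simp)) (IsCb.sum s fun i hi => h i (by simp [hi])),
      ih fun i hi => h i (by simp [hi])]

theorem bcfc_resFun : bcfc D resFun = res D := by
  rw [bcfc_eq_c0fc hD isC0_resFun, c0fc_resFun hD]

theorem bcfc_conj {f : ℝ → ℂ} (hf : IsCb f) :
    bcfc D (fun x => conj (f x)) = star (bcfc D f) := by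
  have h1 : ∀ η ζ : H, inner ℂ (bcfc D (fun x => conj (f x)) (res D η)) (res D ζ) =
      inner ℂ (res D η) (bcfc D f (res D ζ)) := by
    intro η ζ
    have key : ∀ {g h : ℝ → ℂ}, IsC0 g → IsC0 h → inner ℂ (c0fc D g η) (c0fc D h ζ) =
        inner ℂ η (c0fc D (fun x => conj (g x) * h x) ζ) := by
      intro g h hg hh
      rw [c0fc_mul hD hg.conj hh, c0fc_conj, mul_apply_eq_comp,
        ContinuousLinearMap.star_eq_adjoint, ContinuousLinearMap.adjoint_inner_right]
    rw [bcfc_res hD hf.conj, bcfc_res hD hf, ← c0fc_resFun hD,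
      key (hf.conj.mul_isC0 isC0_resFun) isC0_resFun,
      key isC0_resFun (hf.mul_isC0 isC0_resFun)]
    congr 3
    ext x
    simp only [map_mul, Complex.conj_conj]
    ring
  refine ext_of_res hD fun η => ?_
  refine ext_inner_right ℂ fun ζ => ?_
  rw [ContinuousLinearMap.star_eq_adjoint, ContinuousLinearMap.adjoint_inner_left]
  have := DenseRange.equalizer (denseRange_res hD)
    (g := fun ζ : H => inner ℂ (bcfc D (fun x => conj (f x)) (res D η)) ζ)
    (h := fun ζ : H => inner ℂ (res D η) (bcfc D f ζ)) 
    (by fun_prop) (by fun_prop) (funext (h1 η))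
  exact congrFun this ζ

theorem inner_bcfc_left {f : ℝ → ℂ} (hf : IsCb f) (η ζ : H) :
    inner ℂ (bcfc D f η) ζ = inner ℂ η (bcfc D (fun x => conj (f x)) ζ) := by
  rw [bcfc_conj hD hf, ContinuousLinearMap.star_eq_adjoint,
    ContinuousLinearMap.adjoint_inner_right]

theorem inner_bcfc_bcfc {f g : ℝ → ℂ} (hf : IsCb f) (hg : IsCb g) (η ζ : H) :
    inner ℂ (bcfc D f η) (bcfc D g ζ) = inner ℂ η (bcfc D (fun x => conj (f x) * g x) ζ) := by
  rw [inner_bcfc_left hD hf, bcfc_mul hD hf.conj hg, mul_apply_eq_comp]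

/-- `f(D)` maps to the domain of `D` if `x f(x)` is bounded, and `D f(D) = (x f)(D)`. -/
theorem bcfc_mem_graph {f g : ℝ → ℂ} (hf : IsCb f) (hg : IsCb g)
    (hfg : ∀ x, g x = (x : ℂ) * f x) (ψ : H) : (bcfc D f ψ, bcfc D g ψ) ∈ D.graph := by
  have hh : IsCb fun x => g x + Complex.I * f x := hg.add (hf.const_mul _)
  -- Because g + i f = (x + i) f, dividing by x + i exhibits f(D) as the resolvent applied to a
  -- bounded operator.
  have h1 : bcfc D f = res D * bcfc D (fun x => g x + Complex.I * f x) := by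
    rw [← bcfc_resFun hD, ← bcfc_mul hD isC0_resFun.isCb hh]
    congr 1
    ext x
    rw [hfg, resFun, ← add_mul, ← mul_assoc, inv_mul_cancel₀ (add_I_ne_zero x), one_mul]
  have h2 := res_mem_graph hD (bcfc D (fun x => g x + Complex.I * f x) ψ)
  have h3 : res D (bcfc D (fun x => g x + Complex.I * f x) ψ) = bcfc D f ψ := by rw [h1]; rfl
  rw [h3, bcfc_add hD hg (hf.const_mul _), bcfc_const_mul hD hf] at h2
  simpa using h2

/-- The resolvent at `-i` gives access to `(D - z) ψ` through bounded functions. -/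
theorem bcfc_sub_const_mul_mem_graph {f : ℝ → ℂ} (hf : IsCb f)
    (hxf : IsCb fun x => (x : ℂ) * f x) (ψ : H) (E : ℂ) :
    (bcfc D f ψ, E • bcfc D f ψ + bcfc D (fun x => ((x : ℂ) - E) * f x) ψ) ∈ D.graph := by
  have h := bcfc_mem_graph hD hf hxf (fun _ => rfl) ψ
  convert h using 2
  have : (fun x : ℝ => ((x : ℂ) - E) * f x) = fun x : ℝ => (x : ℂ) * f x - E * f x := by
    ext x; ring
  rw [this, bcfc_sub hD hxf (hf.const_mul E), bcfc_const_mul hD hf]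
  simp

end Calculus

/-! ### Cutoff functions -/

/-- A continuous cutoff function, equal to `1` on `[-n, n]` and to `0` off `[-n-1, n+1]`. -/
noncomputable def cut (n : ℕ) (x : ℝ) : ℝ := max 0 (min 1 (n + 1 - |x|))

theorem continuous_cut (n : ℕ) : Continuous (cut n) := by unfold cut; fun_prop

theorem cut_nonneg (n : ℕ) (x : ℝ) : 0 ≤ cut n x := le_max_left _ _

theorem cut_le_one (n : ℕ) (x : ℝ) : cut n x ≤ 1 := max_le zero_le_one (min_le_left _ _)

theorem cut_eq_one {n : ℕ} {x : ℝ} (h : |x| ≤ n) : cut n x = 1 := by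
  unfold cut
  rw [min_eq_left (by linarith), max_eq_right zero_le_one]

theorem hasCompactSupport_cut (n : ℕ) : HasCompactSupport (cut n) := by
  refine HasCompactSupport.intro (isCompact_closedBall (0 : ℝ) (n + 1)) fun x hx => ?_
  have : (n : ℝ) + 1 < |x| := by simpa using hx
  unfold cut
  exact max_eq_left ((min_le_right _ _).trans (by linarith))

theorem tendsto_cut (x : ℝ) : Tendsto (fun n => cut n x) atTop (𝓝 1) := by
  obtain ⟨N, hN⟩ := exists_nat_ge |x|
  refine tendsto_const_nhds.congr' ?_
  filter_upwards [eventually_ge_atTop N] with n hn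
  exact (cut_eq_one (hN.trans (by exact_mod_cast hn))).symm

theorem isCb_cut (n : ℕ) : IsCb fun x => (cut n x : ℂ) :=
  isCb_ofReal (continuous_cut n) (c := 1) fun x => by
    rw [abs_of_nonneg (cut_nonneg n x)]; exact cut_le_one n x

theorem norm_cut_le (n : ℕ) (x : ℝ) : ‖(cut n x : ℂ)‖ ≤ 1 := by
  rw [Complex.norm_real, Real.norm_eq_abs, abs_of_nonneg (cut_nonneg n x)]
  exact cut_le_one n x

theorem norm_resFun_le (x : ℝ) : ‖resFun x‖ ≤ 2 / (|x| + 1) := by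
  have h1 := Complex.abs_re_le_norm ((x : ℂ) + Complex.I)
  have h2 := Complex.abs_im_le_norm ((x : ℂ) + Complex.I)
  simp only [Complex.add_re, Complex.ofReal_re, Complex.I_re, add_zero] at h1
  simp only [Complex.add_im, Complex.ofReal_im, Complex.I_im, zero_add, abs_one] at h2
  rw [resFun, norm_inv, inv_eq_one_div, div_le_div_iff₀ (by linarith) (by positivity)]
  linarith

/-- On the range of the resolvent the error has the symbol (`cut n` - 1) · `resFun`, which is at
most 2/(n + 1) since it vanishes on [-n, n]. The operators are contractions, so density of that
range does the rest. -/
theorem tendsto_bcfc_cut {D : H →ₗ.[ℂ] H} (hD : IsSelfAdjoint D) (ψ : H) :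
    Tendsto (fun n => bcfc D (fun x => (cut n x : ℂ)) ψ) atTop (𝓝 ψ) := by
  have hb : ∀ n φ, ‖bcfc D (fun x => (cut n x : ℂ)) φ‖ ≤ ‖φ‖ := fun n φ => by
    simpa using norm_bcfc_apply_le hD (isCb_cut n).cont (norm_cut_le n) φ
  have hr : ∀ φ, Tendsto (fun n => bcfc D (fun x => (cut n x : ℂ)) (res D φ)) atTop
      (𝓝 (res D φ)) := by
    intro φ
    rw [tendsto_iff_norm_sub_tendsto_zero]
    have h0 : Tendsto (fun n : ℕ => 2 * (1 / ((n : ℝ) + 1)) * ‖φ‖) atTop (𝓝 0) := by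
      simpa using (tendsto_one_div_add_atTop_nhds_zero_nat.const_mul 2).mul_const ‖φ‖
    refine squeeze_zero (fun _ => norm_nonneg _) (fun n => ?_) h0
    have hc := ((isCb_cut n).sub (isCb_const 1)).mul isC0_resFun.isCb
    have h1 : bcfc D (fun x => (cut n x : ℂ)) (res D φ) - res D φ =
        bcfc D (fun x => ((cut n x : ℂ) - 1) * resFun x) φ := by
      rw [bcfc_mul hD ((isCb_cut n).sub (isCb_const 1)) isC0_resFun.isCb,
        bcfc_sub hD (isCb_cut n) (isCb_const 1), bcfc_one hD, bcfc_resFun hD]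
      simp
    rw [h1]
    refine norm_bcfc_apply_le hD hc.cont (fun x => ?_) φ
    by_cases hx : |x| ≤ n
    · rw [cut_eq_one hx]
      simp
      positivity
    · push Not at hx
      rw [norm_mul]
      have h2 : ‖(cut n x : ℂ) - 1‖ ≤ 1 := by
        rw [← Complex.ofReal_one, ← Complex.ofReal_sub, Complex.norm_real, Real.norm_eq_abs,
          abs_le]
        have := cut_nonneg n x
        have := cut_le_one n x
        constructor <;> linarith
      calc ‖(cut n x : ℂ) - 1‖ * ‖resFun x‖ ≤ 1 * (2 / (|x| + 1)) :=
            mul_le_mul h2 (norm_resFun_le x) (norm_nonneg _) zero_le_one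
        _ ≤ 1 * (2 / (n + 1)) := by gcongr
        _ = _ := by ring
  rw [Metric.tendsto_atTop]
  intro ε hε
  obtain ⟨φ, hφ⟩ := Metric.denseRange_iff.1 (denseRange_res hD) ψ (ε / 3) (by positivity)
  obtain ⟨N, hN⟩ := Metric.tendsto_atTop.1 (hr φ) (ε / 3) (by positivity)
  refine ⟨N, fun n hn => ?_⟩
  have h1 := hN n hn
  have h2 := hb n (ψ - res D φ)
  rw [dist_eq_norm] at hφ h1 ⊢
  have h3 : bcfc D (fun x => (cut n x : ℂ)) ψ - ψ =
      bcfc D (fun x => (cut n x : ℂ)) (ψ - res D φ) +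
      (bcfc D (fun x => (cut n x : ℂ)) (res D φ) - res D φ) - (ψ - res D φ) := by
    rw [map_sub]; abel
  rw [h3]
  calc _ ≤ ‖bcfc D (fun x => (cut n x : ℂ)) (ψ - res D φ)‖ +
      ‖bcfc D (fun x => (cut n x : ℂ)) (res D φ) - res D φ‖ + ‖ψ - res D φ‖ :=
        (norm_sub_le _ _).trans (add_le_add_left (norm_add_le _ _) _)
    _ < ε := by linarith

/-! ### Spectral measures -/

section Measure

variable {D : H →ₗ.[ℂ] H} (hD : IsSelfAdjoint D)

include hD

theorem inner_bcfc_self_nonneg {f : ℝ → ℝ} (hf : Continuous f) {c : ℝ} (hc : ∀ x, |f x| ≤ c)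
    (h0 : ∀ x, 0 ≤ f x) (ψ : H) : 0 ≤ (inner ℂ ψ (bcfc D (fun x => (f x : ℂ)) ψ)).re := by
  have hs : IsCb fun x => ((√(f x) : ℝ) : ℂ) :=
    isCb_ofReal (by fun_prop) (c := √c) fun x => by
      rw [abs_of_nonneg (Real.sqrt_nonneg _)]
      exact Real.sqrt_le_sqrt ((le_abs_self _).trans (hc x))
  have h1 := inner_bcfc_bcfc hD hs hs ψ ψ
  have h2 : (fun x => conj ((√(f x) : ℝ) : ℂ) * ((√(f x) : ℝ) : ℂ)) = fun x => (f x : ℂ) := by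
    ext x
    rw [Complex.conj_ofReal, ← Complex.ofReal_mul, Real.mul_self_sqrt (h0 x)]
  rw [h2] at h1
  rw [← h1]
  exact inner_self_nonneg (𝕜 := ℂ)

open scoped CompactlySupported in
omit hD in
theorem isCb_of_compactlySupported (f : C_c(ℝ, ℝ)) : IsCb fun x => (f x : ℂ) :=
  (isC0_of_hasCompactSupport (Complex.continuous_ofReal.comp f.continuous)
    (f.hasCompactSupport.comp_left (g := fun x : ℝ => (x : ℂ)) Complex.ofReal_zero)).isCb

open scoped CompactlySupported in
/-- The positive functional `f ↦ ⟪ψ, f(D) ψ⟫`. -/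
noncomputable def specFunctional (ψ : H) : C_c(ℝ, ℝ) →ₚ[ℝ] ℝ :=
  PositiveLinearMap.mk₀
    { toFun := fun f => (inner ℂ ψ (bcfc D (fun x => (f x : ℂ)) ψ)).re
      map_add' := fun f g => by
        have := bcfc_add hD (isCb_of_compactlySupported f) (isCb_of_compactlySupported g)
        simp only [CompactlySupportedContinuousMap.coe_add, Pi.add_apply, Complex.ofReal_add, this,
          add_apply, inner_add_right, Complex.add_re]
      map_smul' := fun c f => by
        have := bcfc_const_mul hD (isCb_of_compactlySupported f) c
        simp only [CompactlySupportedContinuousMap.coe_smul, Pi.smul_apply, smul_eq_mul,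
          Complex.ofReal_mul, this, smul_apply, inner_smul_right, Complex.re_ofReal_mul,
          RingHom.id_apply] }
    fun f hf => by
      obtain ⟨c, hc⟩ := (isCb_of_compactlySupported f).bdd
      exact inner_bcfc_self_nonneg hD f.continuous (by simpa using hc) hf ψ

/-- The spectral measure of `D` at `ψ`. -/
noncomputable def specMeasure (ψ : H) : Measure ℝ := RealRMK.rieszMeasure (specFunctional hD ψ)

theorem integral_specMeasure_real (ψ : H) {f : ℝ → ℝ} (hf : Continuous f)
    (h : HasCompactSupport f) :
    ∫ x, f x ∂(specMeasure hD ψ) = (inner ℂ ψ (bcfc D (fun x => (f x : ℂ)) ψ)).re :=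
  RealRMK.integral_rieszMeasure (specFunctional hD ψ) ⟨⟨f, hf⟩, h⟩

instance isFiniteMeasureOnCompacts_specMeasure (ψ : H) :
    IsFiniteMeasureOnCompacts (specMeasure hD ψ) := by
  unfold specMeasure
  infer_instance

instance isFiniteMeasure_specMeasure (ψ : H) : IsFiniteMeasure (specMeasure hD ψ) := by
  constructor
  -- The Riesz measure is a priori only locally finite. Cutoffs dominate indicators of balls, and
  -- their integrals are bounded by ‖ψ‖² uniformly in n.
  have h1 : ∀ n : ℕ, specMeasure hD ψ (Metric.closedBall 0 n) ≤ ENNReal.ofReal (‖ψ‖ ^ 2) := by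
    intro n
    have hint : Integrable (cut n) (specMeasure hD ψ) :=
      (continuous_cut n).integrable_of_hasCompactSupport (hasCompactSupport_cut n)
    calc specMeasure hD ψ (Metric.closedBall 0 n)
        = ∫⁻ x in Metric.closedBall 0 n, 1 ∂(specMeasure hD ψ) := by simp
      _ ≤ ∫⁻ x in Metric.closedBall 0 n, ENNReal.ofReal (cut n x) ∂(specMeasure hD ψ) := by
          refine setLIntegral_mono' measurableSet_closedBall fun x hx => ?_
          rw [cut_eq_one (by simpa using hx)]
          simp
      _ ≤ ∫⁻ x, ENNReal.ofReal (cut n x) ∂(specMeasure hD ψ) := setLIntegral_le_lintegral _ _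
      _ = ENNReal.ofReal (∫ x, cut n x ∂(specMeasure hD ψ)) :=
          (ofReal_integral_eq_lintegral_ofReal hint
            (Eventually.of_forall (cut_nonneg n))).symm
      _ ≤ ENNReal.ofReal (‖ψ‖ ^ 2) := by
          gcongr
          rw [integral_specMeasure_real hD ψ (continuous_cut n) (hasCompactSupport_cut n)]
          refine (Complex.re_le_norm _).trans ((norm_inner_le_norm _ _).trans ?_)
          rw [sq]
          gcongr
          simpa using norm_bcfc_apply_le hD (isCb_cut n).cont (norm_cut_le n) ψ
  have h2 : (⋃ n : ℕ, Metric.closedBall (0 : ℝ) n) = Set.univ := Metric.iUnion_closedBall_nat 0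
  rw [← h2, Monotone.measure_iUnion fun m n hmn => Metric.closedBall_subset_closedBall (by exact_mod_cast hmn)]
  exact (iSup_le h1).trans_lt ENNReal.ofReal_lt_top

omit hD in
theorem IsCb.integrable {f : ℝ → ℂ} (hf : IsCb f) (μ : Measure ℝ) [IsFiniteMeasure μ] :
    Integrable f μ := by
  obtain ⟨c, hc⟩ := hf.bdd
  exact Integrable.of_bound hf.cont.aestronglyMeasurable c (Eventually.of_forall hc)

theorem im_inner_bcfc_ofReal {f : ℝ → ℝ} (hf : IsCb fun x => (f x : ℂ)) (ψ : H) :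
    (inner ℂ ψ (bcfc D (fun x => (f x : ℂ)) ψ)).im = 0 := by
  have h := inner_bcfc_left hD hf ψ ψ
  simp only [Complex.conj_ofReal] at h
  rw [← inner_conj_symm] at h
  exact Complex.conj_eq_iff_im.1 h

theorem integral_specMeasure_of_hasCompactSupport (ψ : H) {f : ℝ → ℂ} (hf : Continuous f)
    (h : HasCompactSupport f) :
    ∫ x, f x ∂(specMeasure hD ψ) = inner ℂ ψ (bcfc D f ψ) := by
  have hre : ∀ {g : ℝ → ℝ}, Continuous g → HasCompactSupport g →
      ∫ x, (g x : ℂ) ∂(specMeasure hD ψ) = inner ℂ ψ (bcfc D (fun x => (g x : ℂ)) ψ) := by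
    intro g hg hgs
    rw [integral_complex_ofReal, integral_specMeasure_real hD ψ hg hgs]
    refine Complex.ext (by simp) ?_
    exact (im_inner_bcfc_ofReal hD (isCb_of_compactlySupported ⟨⟨g, hg⟩, hgs⟩) ψ).symm
  have hr : Continuous fun x => (f x).re := Complex.continuous_re.comp hf
  have hi : Continuous fun x => (f x).im := Complex.continuous_im.comp hf
  have hrs : HasCompactSupport fun x => (f x).re := h.comp_left (g := Complex.re) Complex.zero_re
  have his : HasCompactSupport fun x => (f x).im := h.comp_left (g := Complex.im) Complex.zero_im
  have hrb : IsCb fun x => ((f x).re : ℂ) := isCb_of_compactlySupported ⟨⟨_, hr⟩, hrs⟩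
  have hib : IsCb fun x => ((f x).im : ℂ) := isCb_of_compactlySupported ⟨⟨_, hi⟩, his⟩
  have hf' : f = fun x => ((f x).re : ℂ) + Complex.I * ((f x).im : ℂ) := by
    ext x
    rw [mul_comm, Complex.re_add_im]
  have h1 : ∫ x, f x ∂(specMeasure hD ψ) = ∫ x, (((f x).re : ℂ) + Complex.I * ((f x).im : ℂ))
      ∂(specMeasure hD ψ) := congrArg (fun g => ∫ x, g x ∂(specMeasure hD ψ)) hf'
  have h2 := congrArg (bcfc D) hf'
  rw [h1, h2, integral_add (hrb.integrable _) ((hib.const_mul _).integrable _), integral_const_mul,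
    hre hr hrs, hre hi his, bcfc_add hD hrb (hib.const_mul _), bcfc_const_mul hD hib]
  simp

/-- The Riesz theorem gives compactly supported functions only. For f · `cut n` the left side
converges by dominated convergence and the right side by strong convergence of the cutoffs to the
identity. -/
theorem integral_specMeasure (ψ : H) {f : ℝ → ℂ} (hf : IsCb f) :
    ∫ x, f x ∂(specMeasure hD ψ) = inner ℂ ψ (bcfc D f ψ) := by
  obtain ⟨c, hc⟩ := hf.bdd
  have h1 : ∀ n, ∫ x, f x * (cut n x : ℂ) ∂(specMeasure hD ψ) =
      inner ℂ ψ (bcfc D f (bcfc D (fun x => (cut n x : ℂ)) ψ)) := by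
    intro n
    have hs : HasCompactSupport fun x => f x * (cut n x : ℂ) :=
      ((hasCompactSupport_cut n).comp_left (g := fun x : ℝ => (x : ℂ)) Complex.ofReal_zero).mul_left
    rw [integral_specMeasure_of_hasCompactSupport hD ψ
      (f := fun x => f x * (cut n x : ℂ)) (hf.cont.mul (isCb_cut n).cont) hs,
      bcfc_mul hD hf (isCb_cut n)]
    rfl
  have h2 : Tendsto (fun n => ∫ x, f x * (cut n x : ℂ) ∂(specMeasure hD ψ)) atTop
      (𝓝 (∫ x, f x ∂(specMeasure hD ψ))) := by
    refine tendsto_integral_of_dominated_convergence (fun _ => c) (fun n => ?_)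
      (integrable_const c) (fun n => Eventually.of_forall fun x => ?_)
      (Eventually.of_forall fun x => ?_)
    · exact (hf.cont.mul (isCb_cut n).cont).aestronglyMeasurable
    · rw [norm_mul]
      calc _ ≤ c * 1 := mul_le_mul (hc x) (norm_cut_le n x) (norm_nonneg _)
            ((norm_nonneg _).trans (hc x))
        _ = c := mul_one c
    · have := ((Complex.continuous_ofReal.tendsto 1).comp (tendsto_cut x)).const_mul (f x)
      simpa using this
  simp only [h1] at h2
  refine tendsto_nhds_unique h2 ?_
  have := ((bcfc D f).continuous.tendsto ψ).comp (tendsto_bcfc_cut hD ψ)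
  exact (Continuous.tendsto (by fun_prop : Continuous fun φ : H => inner ℂ ψ φ) _).comp this

/-- The map f ↦ f(D)ψ is an isometry for the L² norm of the spectral measure. Norm estimates for
functions of D thereby reduce to pointwise estimates of functions. -/
theorem norm_bcfc_sq (ψ : H) {f : ℝ → ℂ} (hf : IsCb f) :
    ‖bcfc D f ψ‖ ^ 2 = ∫ x, ‖f x‖ ^ 2 ∂(specMeasure hD ψ) := by
  have h1 := integral_specMeasure hD ψ (hf.conj.mul hf)
  rw [← inner_bcfc_bcfc hD hf hf, inner_self_eq_norm_sq_to_K] at h1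
  have h2 : (fun x => conj (f x) * f x) = fun x => ((‖f x‖ ^ 2 : ℝ) : ℂ) := by
    ext x
    rw [← Complex.normSq_eq_conj_mul_self, Complex.normSq_eq_norm_sq]
  rw [h2, integral_complex_ofReal] at h1
  have h3 : ((‖bcfc D f ψ‖ ^ 2 : ℝ) : ℂ) =
      ((∫ x, ‖f x‖ ^ 2 ∂(specMeasure hD ψ) : ℝ) : ℂ) := by
    rw [Complex.ofReal_pow]
    exact h1.symm
  exact Complex.ofReal_injective h3

theorem integral_specMeasure_ofReal (ψ : H) {f : ℝ → ℝ} (hf : IsCb fun x => (f x : ℂ)) :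
    ((∫ x, f x ∂(specMeasure hD ψ) : ℝ) : ℂ) = inner ℂ ψ (bcfc D (fun x => (f x : ℂ)) ψ) := by
  rw [← integral_specMeasure hD ψ hf, integral_complex_ofReal]

theorem measureReal_specMeasure_univ (ψ : H) :
    (specMeasure hD ψ).real Set.univ = ‖ψ‖ ^ 2 := by
  have := norm_bcfc_sq hD ψ (isCb_const 1)
  rw [bcfc_one hD] at this
  simpa using this.symm

end Measure

end

section

/-! ### The unitary group of a self-adjoint operator -/

/-- Dominated convergence in L² of the spectral measure. General countably generated filters are
allowed so that it also serves derivatives and continuity in a real parameter. -/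
theorem tendsto_bcfc {D : H →ₗ.[ℂ] H} (hD : IsSelfAdjoint D) {ι : Type*} {l : Filter ι}
    [l.IsCountablyGenerated] {F : ι → ℝ → ℂ} {f : ℝ → ℂ} (hF : ∀ i, Continuous (F i))
    (hf : IsCb f) {c : ℝ} (hc : ∀ i x, ‖F i x‖ ≤ c)
    (h : ∀ x, Tendsto (fun i => F i x) l (𝓝 (f x))) (ψ : H) :
    Tendsto (fun i => bcfc D (F i) ψ) l (𝓝 (bcfc D f ψ)) := by
  obtain ⟨d, hd⟩ := hf.bdd
  have hFb : ∀ i, IsCb (F i) := fun i => ⟨hF i, c, hc i⟩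
  have h1 : ∀ i, ‖bcfc D (F i) ψ - bcfc D f ψ‖ ^ 2 =
      ∫ x, ‖F i x - f x‖ ^ 2 ∂(specMeasure hD ψ) := fun i => by
    rw [← norm_bcfc_sq hD ψ ((hFb i).sub hf), bcfc_sub hD (hFb i) hf]
    rfl
  have h2 : Tendsto (fun i => ∫ x, ‖F i x - f x‖ ^ 2 ∂(specMeasure hD ψ)) l
      (𝓝 (∫ _, (0 : ℝ) ∂(specMeasure hD ψ))) := by
    refine tendsto_integral_filter_of_dominated_convergence (fun _ => (c + d) ^ 2)
      (Eventually.of_forall fun i => ?_) (Eventually.of_forall fun i => Eventually.of_forall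
      fun x => ?_) (integrable_const _) (Eventually.of_forall fun x => ?_)
    · exact (((hF i).sub hf.cont).norm.pow 2).aestronglyMeasurable
    · rw [Real.norm_eq_abs, abs_of_nonneg (by positivity)]
      gcongr
      exact (norm_sub_le _ _).trans (add_le_add (hc i x) (hd x))
    · have := ((h x).sub_const (f x)).norm.pow 2
      simpa using this
  rw [integral_zero] at h2
  rw [tendsto_iff_norm_sub_tendsto_zero]
  have h3 := (Real.continuous_sqrt.tendsto 0).comp h2
  rw [Real.sqrt_zero] at h3
  refine h3.congr fun i => ?_
  simp only [Function.comp_apply]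
  rw [← h1, Real.sqrt_sq (norm_nonneg _)]

/-- The function `x ↦ exp (i s x)`. -/
noncomputable def expFun (s x : ℝ) : ℂ := Complex.exp (Complex.I * s * x)

theorem norm_expFun (s x : ℝ) : ‖expFun s x‖ = 1 := by
  have : Complex.I * s * x = ((s * x : ℝ) : ℂ) * Complex.I := by push_cast; ring
  rw [expFun, this, Complex.norm_exp_ofReal_mul_I]

theorem continuous_expFun (s : ℝ) : Continuous (expFun s) := by unfold expFun; fun_prop

theorem isCb_expFun (s : ℝ) : IsCb (expFun s) :=
  ⟨continuous_expFun s, 1, fun x => (norm_expFun s x).le⟩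

theorem conj_expFun (s x : ℝ) : conj (expFun s x) = expFun (-s) x := by
  rw [expFun, expFun, ← Complex.exp_conj]
  simp

theorem expFun_add (s t x : ℝ) : expFun (s + t) x = expFun s x * expFun t x := by
  rw [expFun, expFun, expFun, ← Complex.exp_add]
  push_cast
  ring_nf

theorem expFun_zero (x : ℝ) : expFun 0 x = 1 := by simp [expFun]

theorem isCb_mul_resFun : IsCb fun x => (x : ℂ) * resFun x := by
  refine ⟨by have := isC0_resFun.cont; fun_prop, 1, fun x => ?_⟩
  have h1 := Complex.abs_re_le_norm ((x : ℂ) + Complex.I)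
  simp only [Complex.add_re, Complex.ofReal_re, Complex.I_re, add_zero] at h1
  rw [norm_mul, resFun, norm_inv, ← div_eq_mul_inv, Complex.norm_real, Real.norm_eq_abs]
  exact div_le_one_of_le₀ h1 (norm_nonneg _)

theorem hasDerivAt_expFun (x : ℝ) :
    HasDerivAt (fun s => expFun s x) (Complex.I * x) 0 := by
  have h1 : HasDerivAt (fun s : ℝ => Complex.I * (s : ℂ) * (x : ℂ)) (Complex.I * 1 * x) 0 :=
    ((Complex.ofRealCLM.hasDerivAt (x := (0 : ℝ))).const_mul Complex.I).mul_const _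
  have h2 := h1.cexp
  simpa [expFun] using h2

/-- The unitary group `exp (i s D)`. -/
noncomputable def expGroup (D : H →ₗ.[ℂ] H) (s : ℝ) : H →L[ℂ] H := bcfc D (expFun s)

section Group

variable {D : H →ₗ.[ℂ] H} (hD : IsSelfAdjoint D)

include hD

theorem expGroup_zero : expGroup D 0 = 1 := by
  rw [expGroup, ← bcfc_one hD]
  congr 1
  ext x
  exact expFun_zero x

theorem expGroup_add (s t : ℝ) : expGroup D (s + t) = expGroup D s * expGroup D t := by
  rw [expGroup, expGroup, expGroup, ← bcfc_mul hD (isCb_expFun s) (isCb_expFun t)]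
  congr 1
  ext x
  exact expFun_add s t x

theorem star_expGroup (s : ℝ) : star (expGroup D s) = expGroup D (-s) := by
  rw [expGroup, ← bcfc_conj hD (isCb_expFun s)]
  simp only [conj_expFun]
  rfl

/-- A vector of the domain is (D + i)⁻¹η, so the difference quotient is a function of D applied to
η; the factor `resFun` absorbs the growth of (exp(isx) - 1)/s, which is at most |x|. -/
theorem hasDerivAt_expGroup {ψ φ : H} (h : (ψ, φ) ∈ D.graph) :
    HasDerivAt (fun s : ℝ => expGroup D s ψ) (Complex.I • φ) 0 := by
  set η := φ + Complex.I • ψ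
  have hψ : bcfc D resFun η = ψ := by rw [bcfc_resFun hD]; exact res_apply hD h
  have hφ : bcfc D (fun x => (x : ℂ) * resFun x) η = φ := by
    have := bcfc_mem_graph hD isC0_resFun.isCb isCb_mul_resFun (fun _ => rfl) η
    rw [hψ] at this
    exact graph_snd_eq this h
  rw [hasDerivAt_iff_tendsto_slope]
  have hF : ∀ s : ℝ, IsCb fun x => ((s⁻¹ : ℝ) : ℂ) * ((expFun s x - 1) * resFun x) := fun s =>
    (((isCb_expFun s).sub (isCb_const 1)).mul isC0_resFun.isCb).const_mul _
  have h1 : ∀ s : ℝ, slope (fun s : ℝ => expGroup D s ψ) 0 s =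
      bcfc D (fun x => ((s⁻¹ : ℝ) : ℂ) * ((expFun s x - 1) * resFun x)) η := by
    intro s
    rw [slope_def_module, expGroup_zero hD, bcfc_const_mul hD
      (((isCb_expFun s).sub (isCb_const 1)).mul isC0_resFun.isCb),
      bcfc_mul hD ((isCb_expFun s).sub (isCb_const 1)) isC0_resFun.isCb,
      bcfc_sub hD (isCb_expFun s) (isCb_const 1), bcfc_one hD, smul_apply, mul_apply_eq_comp, hψ,
      sub_apply, sub_zero, Complex.coe_smul]
    rfl
  refine Tendsto.congr (fun s => (h1 s).symm) ?_
  have h2 : Complex.I • φ = bcfc D (fun x => Complex.I * ((x : ℂ) * resFun x)) η := by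
    rw [bcfc_const_mul hD isCb_mul_resFun, smul_apply, hφ]
  rw [h2]
  obtain ⟨c, hc⟩ := isCb_mul_resFun.bdd
  refine tendsto_bcfc hD (fun s => (hF s).cont) (isCb_mul_resFun.const_mul _) (c := c)
    (fun s x => ?_) (fun x => ?_) η
  · have h3 : ‖expFun s x - 1‖ ≤ |s| * |x| := by
      have := Real.norm_exp_I_mul_ofReal_sub_one_le (x := s * x)
      rw [Real.norm_eq_abs, abs_mul] at this
      rw [expFun]
      convert this using 4
      push_cast
      ring
    rw [norm_mul, norm_mul, Complex.norm_real, norm_inv, Real.norm_eq_abs]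
    calc |s|⁻¹ * (‖expFun s x - 1‖ * ‖resFun x‖) ≤ |s|⁻¹ * (|s| * |x| * ‖resFun x‖) := by gcongr
      _ = (|s|⁻¹ * |s|) * (|x| * ‖resFun x‖) := by ring
      -- Only an inequality holds: at s = 0 the product |s|⁻¹|s| is 0.
      _ ≤ 1 * (|x| * ‖resFun x‖) := by
          gcongr
          exact inv_mul_le_one
      _ = ‖(x : ℂ) * resFun x‖ := by rw [one_mul, norm_mul, Complex.norm_real, Real.norm_eq_abs]
      _ ≤ c := hc x
  · have h4 := (hasDerivAt_expFun x)
    rw [hasDerivAt_iff_tendsto_slope] at h4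
    have h5 := h4.mul_const (resFun x)
    rw [mul_assoc] at h5
    refine h5.congr fun s => ?_
    rw [slope_def_module, expFun_zero, sub_zero, ← Complex.coe_smul, smul_eq_mul, mul_assoc]

theorem isExpGroup_expGroup : IsExpGroup D (expGroup D) where
  zero := expGroup_zero hD
  add := expGroup_add hD
  unitary s := by
    rw [Unitary.mem_iff, star_expGroup hD, ← expGroup_add hD, ← expGroup_add hD]
    simp [expGroup_zero hD]
  continuous ψ := by
    rw [continuous_iff_continuousAt]
    intro t
    refine tendsto_bcfc hD (fun s => continuous_expFun s) (isCb_expFun t) (c := 1)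
      (fun s x => (norm_expFun s x).le) (fun x => ?_) ψ
    have : Continuous fun s => expFun s x := by unfold expFun; fun_prop
    exact this.tendsto t
  generator ψ φ := by
    refine ⟨hasDerivAt_expGroup hD, fun h => ?_⟩
    -- Conversely, differentiating ⟨a, U(s)ψ⟩ = ⟨U(-s)a, ψ⟩ at 0 for a in the domain shows that (ψ,
    -- φ) lies in the graph of the adjoint.
    rw [mem_graph_iff_inner hD]
    intro a b hab
    have h1 : HasDerivAt (fun s : ℝ => inner ℂ a (expGroup D s ψ)) (inner ℂ a (Complex.I • φ)) 0 := by
      have := (hasDerivAt_const (0 : ℝ) a).inner ℂ h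
      simpa only [inner_zero_left, add_zero] using this
    have h2 : HasDerivAt (fun s : ℝ => expGroup D (-s) a) (-(Complex.I • b)) 0 := by
      have h3 := hasDerivAt_expGroup hD hab
      rw [← neg_zero] at h3
      have := h3.scomp (0 : ℝ) (hasDerivAt_neg (0 : ℝ))
      rw [neg_one_smul] at this
      exact this
    have h3 : HasDerivAt (fun s : ℝ => inner ℂ (expGroup D (-s) a) ψ)
        (inner ℂ (-(Complex.I • b)) ψ) 0 := by
      have := h2.inner ℂ (hasDerivAt_const (0 : ℝ) ψ)
      simpa using this
    have h4 : (fun s : ℝ => inner ℂ (expGroup D (-s) a) ψ) =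
        fun s : ℝ => inner ℂ a (expGroup D s ψ) := by
      ext s
      rw [← star_expGroup hD, ContinuousLinearMap.star_eq_adjoint,
        ContinuousLinearMap.adjoint_inner_left]
    rw [h4] at h3
    have h5 := h1.unique h3
    rw [inner_smul_right, inner_neg_left, inner_smul_left, Complex.conj_I, neg_mul, neg_neg] at h5
    exact (mul_left_cancel₀ Complex.I_ne_zero h5).symm

theorem isSpectralMeasure_of_forall_bcfc {ψ : H} {μ : Measure ℝ} [hμ : IsFiniteMeasure μ]
    (h : ∀ f : ℝ → ℂ, IsCb f → inner ℂ ψ (bcfc D f ψ) = ∫ x, f x ∂μ) :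
    IsSpectralMeasure D ψ μ :=
  ⟨hμ, expGroup D, isExpGroup_expGroup hD, fun s => h _ (isCb_expFun s)⟩

theorem isSpectralMeasure_specMeasure (ψ : H) : IsSpectralMeasure D ψ (specMeasure hD ψ) :=
  isSpectralMeasure_of_forall_bcfc hD fun _ hf => (integral_specMeasure hD ψ hf).symm

end Group

end

/-! ### Restricting spectral measures to Borel sets -/

/-- Bounded continuous functions are dense in L¹(μ), and an L¹-convergent sequence has an almost
everywhere convergent subsequence. Truncation to [0, 1] leaves the limit unchanged. -/
theorem exists_continuous_tendsto_indicator (μ : Measure ℝ) [IsFiniteMeasure μ] {Z : Set ℝ}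
    (hZ : MeasurableSet Z) : ∃ g : ℕ → ℝ → ℝ, (∀ n, Continuous (g n)) ∧
      (∀ n x, 0 ≤ g n x) ∧ (∀ n x, g n x ≤ 1) ∧
      ∀ᵐ x ∂μ, Tendsto (fun n => g n x) atTop (𝓝 (Z.indicator (fun _ => (1 : ℝ)) x)) := by
  have hmem : MemLp (Z.indicator fun _ => (1 : ℝ)) 1 μ :=
    memLp_indicator_const 1 hZ 1 (Or.inr (measure_ne_top _ _))
  have h1 : ∀ n : ℕ, ∃ g : BoundedContinuousFunction ℝ ℝ,
      eLpNorm ((Z.indicator fun _ => (1 : ℝ)) - (g : ℝ → ℝ)) 1 μ ≤ ENNReal.ofReal (1 / (n + 1)) :=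
    fun n => by
      obtain ⟨g, hg, -⟩ := hmem.exists_boundedContinuous_eLpNorm_sub_le ENNReal.one_ne_top
        (ε := ENNReal.ofReal (1 / (n + 1))) (by simp; positivity)
      exact ⟨g, hg⟩
  choose g hg using h1
  have h2 : Tendsto (fun n => eLpNorm ((g n : ℝ → ℝ) - Z.indicator fun _ => (1 : ℝ)) 1 μ) atTop
      (𝓝 0) := by
    have h3 : Tendsto (fun n : ℕ => ENNReal.ofReal (1 / ((n : ℝ) + 1))) atTop (𝓝 0) := by
      have := ENNReal.tendsto_ofReal tendsto_one_div_add_atTop_nhds_zero_nat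
      simpa using this
    refine tendsto_of_tendsto_of_tendsto_of_le_of_le tendsto_const_nhds h3 (fun _ => zero_le)
      fun n => ?_
    simp only
    rw [eLpNorm_sub_comm]
    exact hg n
  have h4 := tendstoInMeasure_of_tendsto_eLpNorm one_ne_zero
    (fun n => (g n).continuous.aestronglyMeasurable) hmem.aestronglyMeasurable h2
  obtain ⟨ns, -, hns⟩ := h4.exists_seq_tendsto_ae
  refine ⟨fun n x => max 0 (min 1 (g (ns n) x)), fun n => by fun_prop,
    fun n x => le_max_left _ _, fun n x => max_le zero_le_one (min_le_left _ _), ?_⟩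
  filter_upwards [hns] with x hx
  have hc : Continuous fun t : ℝ => max 0 (min 1 t) := by fun_prop
  have := (hc.tendsto _).comp hx
  have h5 : max 0 (min 1 (Z.indicator (fun _ => (1 : ℝ)) x)) = Z.indicator (fun _ => (1 : ℝ)) x := by
    by_cases h : x ∈ Z <;> simp [h]
  rw [h5] at this
  exact this

/-- The spectral projection of `Z`, applied to `ψ`. -/
theorem exists_spectral_restrict {D : H →ₗ.[ℂ] H} (hD : IsSelfAdjoint D) (ψ : H) {Z : Set ℝ}
    (hZ : MeasurableSet Z) : ∃ v : H,
      (∀ f : ℝ → ℂ, IsCb f → inner ℂ v (bcfc D f v) = ∫ x in Z, f x ∂(specMeasure hD ψ)) ∧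
      inner ℂ ψ v = (specMeasure hD ψ).real Z := by
  set μ := specMeasure hD ψ
  obtain ⟨g, hgc, hg0, hg1, hg⟩ := exists_continuous_tendsto_indicator μ hZ
  have habs : ∀ n x, |g n x| ≤ 1 := fun n x => by rw [abs_of_nonneg (hg0 n x)]; exact hg1 n x
  have hcb : ∀ n, IsCb fun x => (g n x : ℂ) := fun n => isCb_ofReal (hgc n) (habs n)
  -- The projected vector is the limit of gₙ(D)ψ; by `norm_bcfc_sq` the mutual distances are L²
  -- distances of the gₙ.
  have hcau : CauchySeq fun n => bcfc D (fun x => (g n x : ℂ)) ψ := by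
    rw [cauchySeq_iff_tendsto_dist_atTop_0]
    have h1 : ∀ p : ℕ × ℕ, dist (bcfc D (fun x => (g p.1 x : ℂ)) ψ)
        (bcfc D (fun x => (g p.2 x : ℂ)) ψ) = √(∫ x, (g p.1 x - g p.2 x) ^ 2 ∂μ) := by
      intro p
      have := norm_bcfc_sq hD ψ ((hcb p.1).sub (hcb p.2))
      rw [bcfc_sub hD (hcb _) (hcb _)] at this
      rw [dist_eq_norm, ← sub_apply, ← Real.sqrt_sq (norm_nonneg _), this]
      congr 2
      ext x
      rw [← Complex.ofReal_sub, Complex.norm_real, Real.norm_eq_abs, sq_abs]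
    simp only [h1]
    have h2 : Tendsto (fun p : ℕ × ℕ => ∫ x, (g p.1 x - g p.2 x) ^ 2 ∂μ) atTop
        (𝓝 (∫ _, (0 : ℝ) ∂μ)) := by
      refine tendsto_integral_filter_of_dominated_convergence (fun _ => 1)
        (Eventually.of_forall fun p => ?_) (Eventually.of_forall fun p => Eventually.of_forall
        fun x => ?_) (integrable_const _) ?_
      · exact (((hgc _).sub (hgc _)).pow 2).aestronglyMeasurable
      · rw [Real.norm_eq_abs, abs_of_nonneg (sq_nonneg _), sq_le_one_iff_abs_le_one, abs_le]
        have := hg0 p.1 x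
        have := hg0 p.2 x
        have := hg1 p.1 x
        have := hg1 p.2 x
        constructor <;> linarith
      · filter_upwards [hg] with x hx
        rw [← prod_atTop_atTop_eq]
        have := ((hx.comp tendsto_fst).sub (hx.comp tendsto_snd)).pow 2
        simpa using this
    rw [integral_zero] at h2
    have := (Real.continuous_sqrt.tendsto 0).comp h2
    rw [Real.sqrt_zero] at this
    exact this
  obtain ⟨v, hv⟩ := cauchySeq_tendsto_of_complete hcau
  refine ⟨v, fun f hf => ?_, ?_⟩
  · obtain ⟨c, hc⟩ := hf.bdd
    have h1 : Tendsto (fun n => inner ℂ (bcfc D (fun x => (g n x : ℂ)) ψ)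
        (bcfc D f (bcfc D (fun x => (g n x : ℂ)) ψ))) atTop (𝓝 (inner ℂ v (bcfc D f v))) :=
      hv.inner (((bcfc D f).continuous.tendsto v).comp hv)
    have h2 : ∀ n, inner ℂ (bcfc D (fun x => (g n x : ℂ)) ψ)
        (bcfc D f (bcfc D (fun x => (g n x : ℂ)) ψ)) =
        ∫ x, conj (g n x : ℂ) * (f x * (g n x : ℂ)) ∂μ := by
      intro n
      rw [integral_specMeasure hD ψ ((hcb n).conj.mul (hf.mul (hcb n))),
        ← inner_bcfc_bcfc hD (hcb n) (hf.mul (hcb n)), bcfc_mul hD hf (hcb n)]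
      rfl
    simp only [h2] at h1
    refine tendsto_nhds_unique h1 ?_
    rw [← integral_indicator hZ]
    refine tendsto_integral_of_dominated_convergence (fun _ => c) (fun n => ?_)
      (integrable_const c) (fun n => Eventually.of_forall fun x => ?_) ?_
    · exact ((hcb n).conj.mul (hf.mul (hcb n))).cont.aestronglyMeasurable
    · rw [norm_mul, norm_mul, RCLike.norm_conj, Complex.norm_real, Real.norm_eq_abs]
      have hc0 : 0 ≤ c := (norm_nonneg _).trans (hc x)
      calc |g n x| * (‖f x‖ * |g n x|) ≤ 1 * (c * 1) := by
            gcongr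
            · exact habs n x
            · exact hc x
            · exact habs n x
        _ = c := by ring
    · filter_upwards [hg] with x hx
      have h3 := (Complex.continuous_ofReal.tendsto _).comp hx
      have h4 := ((Complex.continuous_conj.tendsto _).comp h3).mul (h3.const_mul (f x))
      have h5 : conj ((Z.indicator (fun _ => (1 : ℝ)) x : ℝ) : ℂ) *
          (f x * ((Z.indicator (fun _ => (1 : ℝ)) x : ℝ) : ℂ)) = Z.indicator f x := by
        by_cases h : x ∈ Z <;> simp [h]
      rw [h5] at h4
      exact h4
  · have h1 : Tendsto (fun n => inner ℂ ψ (bcfc D (fun x => (g n x : ℂ)) ψ)) atTop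
        (𝓝 (inner ℂ ψ v)) := tendsto_const_nhds.inner hv
    simp only [← integral_specMeasure hD ψ (hcb _)] at h1
    refine tendsto_nhds_unique h1 ?_
    have h2 : ((μ.real Z : ℝ) : ℂ) = ∫ x, ((Z.indicator (fun _ => (1 : ℝ)) x : ℝ) : ℂ) ∂μ := by
      rw [integral_complex_ofReal, integral_indicator hZ]
      simp
    rw [h2]
    refine tendsto_integral_of_dominated_convergence (fun _ => 1) (fun n => ?_)
      (integrable_const 1) (fun n => Eventually.of_forall fun x => ?_) ?_
    · exact (hcb n).cont.aestronglyMeasurable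
    · rw [Complex.norm_real, Real.norm_eq_abs]
      exact habs n x
    · filter_upwards [hg] with x hx
      exact (Complex.continuous_ofReal.tendsto _).comp hx

/-- Take v to be the spectral projection of {E} applied to ψ. Its spectral measure sits on {E},
where `resFun - resFun E` vanishes, so v is an eigenvector of the resolvent. It follows that a
vector orthogonal to all eigenvectors has no atoms in its spectral measure. -/
theorem exists_eigenvector_inner_eq {D : H →ₗ.[ℂ] H} (hD : IsSelfAdjoint D) (ψ : H) (E : ℝ) :
    ∃ v : H, (v, (E : ℂ) • v) ∈ D.graph ∧ inner ℂ ψ v = (specMeasure hD ψ).real {E} := by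
  obtain ⟨v, hv, hψv⟩ := exists_spectral_restrict hD ψ (measurableSet_singleton E)
  refine ⟨v, ?_, hψv⟩
  have hcb : IsCb fun x => resFun x - resFun E := isC0_resFun.isCb.sub (isCb_const _)
  have h1 : res D v = resFun E • v := by
    have h2 := hv _ (hcb.conj.mul hcb)
    rw [← inner_bcfc_bcfc hD hcb hcb] at h2
    have h3 : ∫ x in {E}, conj (resFun x - resFun E) * (resFun x - resFun E) ∂(specMeasure hD ψ)
        = 0 := by
      simp
    rw [h3, inner_self_eq_zero, bcfc_sub hD isC0_resFun.isCb (isCb_const _), bcfc_resFun hD,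
      bcfc_const hD, sub_apply, sub_eq_zero] at h2
    exact h2
  have h4 := graph_smul ((E : ℂ) + Complex.I) (res_mem_graph hD v)
  have h5 : ((E : ℂ) + Complex.I) • res D v = v := by
    rw [h1, smul_smul, resFun, mul_inv_cancel₀ (add_I_ne_zero E), one_smul]
  rw [smul_sub, smul_comm, h5, add_smul, add_sub_cancel_right] at h4
  exact h4

/-- Let N have Lebesgue-null complement and carry none of the singular part of the spectral measure.
Projecting ψ to N leaves an absolutely continuous spectral measure, so the projected vector is 0 and
N has measure 0 for the spectral measure. -/
theorem mutuallySingular_specMeasure_of_noACSpectrum {D : H →ₗ.[ℂ] H} (hD : IsSelfAdjoint D)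
    (h : NoACSpectrum D) (ψ : H) : (specMeasure hD ψ).MutuallySingular volume := by
  set μ := specMeasure hD ψ
  obtain ⟨N, hN, hN1, hN2⟩ := Measure.mutuallySingular_singularPart μ volume
  obtain ⟨v, hv, -⟩ := exists_spectral_restrict hD ψ hN
  have hac : (μ.restrict N).AbsolutelyContinuous volume := by
    have h1 := Measure.rnDeriv_add_singularPart μ volume
    rw [← h1, Measure.restrict_add, Measure.restrict_eq_zero.2 hN1, add_zero]
    exact Measure.restrict_le_self.absolutelyContinuous.trans
      (withDensity_absolutelyContinuous _ _)
  have hv0 := h v _ (isSpectralMeasure_of_forall_bcfc hD hv) hac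
  refine ⟨N, hN, ?_, hN2⟩
  have h2 := hv _ (isCb_const 1)
  rw [hv0, inner_zero_left] at h2
  have h3 : μ.real N = 0 := by
    have : ((μ.real N : ℝ) : ℂ) = 0 := by simpa using h2.symm
    exact_mod_cast this
  exact (measureReal_eq_zero_iff (measure_ne_top _ _)).1 h3

/-! ### A criterion for singular spectral measures -/

/-- `f` is a continuous bump function of small integral. -/
structure IsSmallBump (f : ℝ → ℝ) (ε : ℝ) : Prop where
  cont : Continuous f
  hasCompactSupport : HasCompactSupport f
  nonneg : ∀ x, 0 ≤ f x
  le_one : ∀ x, f x ≤ 1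
  integral_lt : ∫ x, f x < ε

theorem IsSmallBump.isC0 {f : ℝ → ℝ} {ε : ℝ} (hf : IsSmallBump f ε) : IsC0 fun x => (f x : ℂ) :=
  isC0_of_hasCompactSupport (Complex.continuous_ofReal.comp hf.cont)
    (hf.hasCompactSupport.comp_left (g := fun x : ℝ => (x : ℂ)) Complex.ofReal_zero)

theorem IsSmallBump.norm_le {f : ℝ → ℝ} {ε : ℝ} (hf : IsSmallBump f ε) (x : ℝ) :
    ‖(f x : ℂ)‖ ≤ 1 := by
  rw [Complex.norm_real, Real.norm_eq_abs, abs_of_nonneg (hf.nonneg x)]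
  exact hf.le_one x

/-- A measure ρ below both μ and Lebesgue measure has to vanish. Split the line at the level f =
1/2: the upper part has small Lebesgue measure by Markov's inequality for f, the lower part small
μ-measure by Markov's inequality for 1 - f. -/
theorem mutuallySingular_of_smallBump {μ : Measure ℝ} [IsFiniteMeasure μ]
    (h : ∀ ε > 0, ∃ f, IsSmallBump f ε ∧ μ.real Set.univ - ε < ∫ x, f x ∂μ) :
    μ.MutuallySingular volume := by
  refine Measure.mutuallySingular_of_disjoint ?_
  intro ρ hρμ hρv
  rw [le_bot_iff]
  change ρ = 0
  rw [← Measure.measure_univ_eq_zero]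
  refine le_antisymm (ENNReal.le_of_forall_pos_le_add fun ε hε _ => ?_) zero_le
  rw [zero_add]
  -- Markov at level 1/2 doubles ε/4, and there are two parts.
  obtain ⟨f, hf, hfμ⟩ := h (ε / 4) (by positivity)
  have hmeas : MeasurableSet {x | 1 / 2 ≤ f x} := measurableSet_le measurable_const hf.cont.measurable
  have h1 : volume {x | 1 / 2 ≤ f x} ≤ ENNReal.ofReal (ε / 2) := by
    have hint : Integrable f volume := hf.cont.integrable_of_hasCompactSupport hf.hasCompactSupport
    have h2 := mul_meas_ge_le_integral_of_nonneg (Eventually.of_forall hf.nonneg) hint (1 / 2)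
    have h3 : volume {x | 1 / 2 ≤ f x} ≠ ∞ := (hint.measure_ge_lt_top (by norm_num)).ne
    have h4 := hf.integral_lt
    rw [← ENNReal.ofReal_toReal h3]
    apply ENNReal.ofReal_le_ofReal
    rw [measureReal_def] at h2
    linarith
  have h5 : μ {x | 1 / 2 ≤ f x}ᶜ ≤ ENNReal.ofReal (ε / 2) := by
    have hint : Integrable f μ := Integrable.of_bound hf.cont.aestronglyMeasurable 1
      (Eventually.of_forall fun x => by simpa using hf.norm_le x)
    have h2 := mul_meas_ge_le_integral_of_nonneg (μ := μ) (f := fun x => 1 - f x)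
      (Eventually.of_forall fun x => sub_nonneg.2 (hf.le_one x)) ((integrable_const 1).sub hint)
      (1 / 2)
    rw [integral_sub (integrable_const 1) hint, integral_const, smul_eq_mul, mul_one] at h2
    have h6 : μ.real {x | 1 / 2 ≤ f x}ᶜ ≤ μ.real {x | 1 / 2 ≤ 1 - f x} := by
      refine measureReal_mono (fun x hx => ?_) (measure_ne_top _ _)
      simp only [Set.mem_compl_iff, Set.mem_ofPred_eq, not_le] at hx ⊢
      linarith
    rw [← ENNReal.ofReal_toReal (measure_ne_top μ _)]
    apply ENNReal.ofReal_le_ofReal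
    rw [measureReal_def] at h6
    linarith
  calc ρ Set.univ ≤ ρ {x | 1 / 2 ≤ f x} + ρ {x | 1 / 2 ≤ f x}ᶜ := by
        rw [← Set.union_compl_self {x | 1 / 2 ≤ f x}]; exact measure_union_le _ _
    _ ≤ ENNReal.ofReal (ε / 2) + ENNReal.ofReal (ε / 2) :=
        add_le_add ((hρv _).trans h1) ((hρμ _).trans h5)
    _ = ε := by
        rw [← ENNReal.ofReal_add (by positivity) (by positivity), add_halves]
        simp

/-- Singularity of all spectral measures can be tested on a dense set of vectors. -/
theorem mutuallySingular_specMeasure_of_dense {D : H →ₗ.[ℂ] H} (hD : IsSelfAdjoint D) {S : Set H}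
    (hS : Dense S) (h : ∀ ψ ∈ S, ∀ ε > 0, ∃ f, IsSmallBump f ε ∧
      ‖ψ‖ ^ 2 - ε < (inner ℂ ψ (bcfc D (fun x => (f x : ℂ)) ψ)).re) (χ : H) :
    (specMeasure hD χ).MutuallySingular volume := by
  refine mutuallySingular_of_smallBump fun ε hε => ?_
  rw [measureReal_specMeasure_univ]
  -- Replacing χ by ψ costs at most δ(2‖χ‖ + δ) twice, in the quadratic form and in the squared
  -- norm.
  obtain ⟨δ, hδ, hδ'⟩ : ∃ δ > 0, δ * (2 * (2 * ‖χ‖ + δ)) < ε / 2 := by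
    have : ContinuousAt (fun δ : ℝ => δ * (2 * (2 * ‖χ‖ + δ))) 0 := by fun_prop
    have h2 : Tendsto (fun δ : ℝ => δ * (2 * (2 * ‖χ‖ + δ))) (𝓝[>] 0) (𝓝 0) := by
      simpa using this.tendsto.mono_left (nhdsWithin_le_nhds (s := Set.Ioi 0))
    obtain ⟨δ, h3, h4⟩ := ((h2.eventually_lt_const (half_pos hε)).and self_mem_nhdsWithin).exists
    exact ⟨δ, h4, h3⟩
  obtain ⟨ψ, hψS, hψ⟩ := Metric.dense_iff.1 hS χ δ hδ
  rw [Metric.mem_ball, dist_eq_norm] at hψS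
  obtain ⟨f, hf, hfψ⟩ := h ψ hψ (ε / 2) (half_pos hε)
  refine ⟨f, ⟨hf.1, hf.2, hf.3, hf.4, hf.5.trans (by linarith)⟩, ?_⟩
  set T := bcfc D (fun x => (f x : ℂ))
  have hT : ∀ φ, ‖T φ‖ ≤ ‖φ‖ := fun φ => by
    simpa using norm_bcfc_apply_le hD hf.isC0.cont hf.norm_le φ
  have h1 : ∫ x, f x ∂(specMeasure hD χ) = (inner ℂ χ (T χ)).re := by
    rw [← integral_specMeasure_ofReal hD χ hf.isC0.isCb, Complex.ofReal_re]
  have h2 : ‖ψ‖ ≤ ‖χ‖ + δ := by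
    have := norm_le_norm_add_norm_sub' ψ χ
    linarith
  have h2' : ‖χ‖ ≤ ‖ψ‖ + δ := by
    have := norm_le_norm_add_norm_sub' χ ψ
    rw [norm_sub_rev] at this
    linarith
  have h3 : |(inner ℂ ψ (T ψ)).re - (inner ℂ χ (T χ)).re| ≤ δ * (2 * ‖χ‖ + δ) := by
    rw [← Complex.sub_re]
    refine (Complex.abs_re_le_norm _).trans ?_
    have : inner ℂ ψ (T ψ) - inner ℂ χ (T χ) = inner ℂ (ψ - χ) (T ψ) + inner ℂ χ (T (ψ - χ)) := by
      rw [map_sub, inner_sub_left, inner_sub_right]; ring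
    rw [this]
    calc _ ≤ ‖ψ - χ‖ * ‖T ψ‖ + ‖χ‖ * ‖T (ψ - χ)‖ :=
          (norm_add_le _ _).trans (add_le_add (norm_inner_le_norm _ _) (norm_inner_le_norm _ _))
      _ ≤ δ * (‖χ‖ + δ) + ‖χ‖ * δ := by
          gcongr
          · exact (hT ψ).trans h2
          · exact (hT _).trans hψS.le
      _ = _ := by ring
  have h4 : ‖χ‖ ^ 2 ≤ ‖ψ‖ ^ 2 + δ * (2 * ‖χ‖ + δ) := by
    nlinarith [norm_nonneg ψ, norm_nonneg χ]
  rw [h1]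
  have := (abs_le.1 h3).2
  linarith

/-! ### Spanning by singular continuous vectors and discrete eigenvectors -/

/-- A vector orthogonal to the span is orthogonal to every eigenvector, since all of them are
discrete ones. Its spectral measure is then atomless as well as singular, so the vector belongs to
the span and is orthogonal to itself. -/
theorem topologicalClosure_span_eq_top {D : H →ₗ.[ℂ] H} (hD : IsSelfAdjoint D)
    (hs : ∀ ψ, (specMeasure hD ψ).MutuallySingular volume)
    (hd : ∀ (E : ℝ) (u : H), u ≠ 0 → (u, (E : ℂ) • u) ∈ D.graph → (E : ℂ) ∈ discreteSpec D) :
    (Submodule.span ℂ (singContVectors D ∪ discreteEigenvectors D)).topologicalClosure = ⊤ := by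
  rw [Submodule.topologicalClosure_eq_top_iff, Submodule.eq_bot_iff]
  intro χ hχ
  rw [Submodule.mem_orthogonal'] at hχ
  have hat : ∀ E : ℝ, specMeasure hD χ {E} = 0 := by
    intro E
    obtain ⟨v, hv, hv'⟩ := exists_eigenvector_inner_eq hD χ E
    have h0 : inner ℂ χ v = 0 := by
      by_cases hv0 : v = 0
      · rw [hv0, inner_zero_right]
      · exact hχ v (Submodule.subset_span (Or.inr ⟨E, hd E v hv0 hv, hv⟩))
    rw [h0] at hv'
    refine (measureReal_eq_zero_iff (measure_ne_top _ _)).1 ?_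
    exact_mod_cast hv'.symm
  have h1 : χ ∈ singContVectors D :=
    ⟨_, isSpectralMeasure_specMeasure hD χ, hs χ, hat⟩
  exact inner_self_eq_zero.1 (hχ χ (Submodule.subset_span (Or.inl h1)))

/-! ### Bump functions of a self-adjoint operator -/

theorem norm_bcfc_le_of_le {D : H →ₗ.[ℂ] H} (hD : IsSelfAdjoint D) {f g : ℝ → ℂ} (hf : IsCb f)
    (hg : IsCb g) {c : ℝ} (hc : 0 ≤ c) (h : ∀ x, ‖f x‖ ≤ c * ‖g x‖) (ψ : H) :
    ‖bcfc D f ψ‖ ≤ c * ‖bcfc D g ψ‖ := by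
  have h1 := norm_bcfc_sq hD ψ hf
  have h2 := norm_bcfc_sq hD ψ hg
  refine abs_le_of_sq_le_sq' ?_ (by positivity) |>.2
  rw [mul_pow, h1, h2, ← integral_const_mul]
  have hi : ∀ {k : ℝ → ℂ}, IsCb k → Integrable (fun x => ‖k x‖ ^ 2) (specMeasure hD ψ) := by
    intro k hk
    obtain ⟨d, hd⟩ := hk.bdd
    refine Integrable.of_bound (hk.cont.norm.pow 2).aestronglyMeasurable (d ^ 2)
      (Eventually.of_forall fun x => ?_)
    rw [Real.norm_eq_abs, abs_of_nonneg (by positivity)]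
    gcongr
    exact hd x
  refine integral_mono (hi hf) ((hi hg).const_mul _) fun x => ?_
  simp only
  rw [← mul_pow]
  gcongr
  exact h x

theorem exists_eq_bcfc_of_mem_graph {D : H →ₗ.[ℂ] H} (hD : IsSelfAdjoint D) {a b : H}
    (h : (a, b) ∈ D.graph) :
    ∃ η, a = bcfc D resFun η ∧ b = bcfc D (fun x => (x : ℂ) * resFun x) η := by
  refine ⟨b + Complex.I • a, ?_, ?_⟩
  · rw [bcfc_resFun hD, res_apply hD h]
  · have := bcfc_mem_graph hD isC0_resFun.isCb isCb_mul_resFun (fun _ => rfl) (b + Complex.I • a)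
    rw [bcfc_resFun hD, res_apply hD h] at this
    exact graph_snd_eq h this

/-- The tent function of height one, centred at `x`, of half-width `ρ`. -/
noncomputable def tent (x ρ y : ℝ) : ℝ := max 0 (1 - |y - x| / ρ)

theorem continuous_tent (x ρ : ℝ) : Continuous (tent x ρ) := by unfold tent; fun_prop

theorem tent_nonneg (x ρ y : ℝ) : 0 ≤ tent x ρ y := le_max_left _ _

theorem tent_le_one (x : ℝ) {ρ : ℝ} (hρ : 0 < ρ) (y : ℝ) : tent x ρ y ≤ 1 :=
  max_le zero_le_one (by have : 0 ≤ |y - x| / ρ := by positivity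
                         linarith)

theorem tent_eq_zero {x ρ y : ℝ} (hρ : 0 < ρ) (h : ρ ≤ |y - x|) : tent x ρ y = 0 :=
  max_eq_left (by rw [sub_nonpos, one_le_div hρ]; exact h)

theorem hasCompactSupport_tent (x : ℝ) {ρ : ℝ} (hρ : 0 < ρ) : HasCompactSupport (tent x ρ) :=
  HasCompactSupport.intro (isCompact_closedBall x ρ) fun y hy =>
    tent_eq_zero hρ (by simpa [Real.dist_eq] using (not_le.1 hy).le)

theorem norm_tent_le (x : ℝ) {ρ : ℝ} (hρ : 0 < ρ) (y : ℝ) : ‖(tent x ρ y : ℂ)‖ ≤ 1 := by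
  rw [Complex.norm_real, Real.norm_eq_abs, abs_of_nonneg (tent_nonneg x ρ y)]
  exact tent_le_one x hρ y

theorem isCb_tent (x : ℝ) {ρ : ℝ} (hρ : 0 < ρ) : IsCb fun y => (tent x ρ y : ℂ) :=
  ⟨Complex.continuous_ofReal.comp (continuous_tent x ρ), 1, norm_tent_le x hρ⟩

theorem isCb_mul_of_hasCompactSupport {f : ℝ → ℂ} (hf : Continuous f) (hs : HasCompactSupport f)
    {k : ℝ → ℂ} (hk : Continuous k) : IsCb fun x => k x * f x :=
  (isC0_of_hasCompactSupport (hk.mul hf) hs.mul_left).isCb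

theorem isCb_mul_tent (x : ℝ) {ρ : ℝ} (hρ : 0 < ρ) {k : ℝ → ℂ} (hk : Continuous k) :
    IsCb fun y => k y * (tent x ρ y : ℂ) :=
  isCb_mul_of_hasCompactSupport (isCb_tent x hρ).cont
    ((hasCompactSupport_tent x hρ).comp_left (g := fun x : ℝ => (x : ℂ)) Complex.ofReal_zero) hk

/-- If the tent function of D vanished, then 1 - tent would act as the identity, and ρ(1 - tent(y))
≤ |y - x| would give ‖(D - x)a‖ ≥ ρ‖a‖, putting x in the resolvent set. -/
theorem bcfc_tent_ne_zero {D : H →ₗ.[ℂ] H} (hD : IsSelfAdjoint D) {x ρ : ℝ}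
    (hx : (x : ℂ) ∈ spec D) (hρ : 0 < ρ) : bcfc D (fun y => (tent x ρ y : ℂ)) ≠ 0 := by
  intro h0
  refine notMem_spec_of_real hD hρ (fun a b hab => ?_) hx
  obtain ⟨η, rfl, rfl⟩ := exists_eq_bcfc_of_mem_graph hD hab
  have hr := isC0_resFun.isCb
  have ht := isCb_tent x hρ
  have h1 : IsCb fun y => (ρ : ℂ) * ((1 - (tent x ρ y : ℂ)) * resFun y) :=
    (((isCb_const 1).sub ht).mul hr).const_mul _
  have h2 : IsCb fun y => (y : ℂ) * resFun y - (x : ℂ) * resFun y :=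
    isCb_mul_resFun.sub (hr.const_mul _)
  have h3 := norm_bcfc_le_of_le hD h1 h2 zero_le_one (fun y => by
    rw [← sub_mul, norm_mul, norm_mul, norm_mul, one_mul, ← mul_assoc, ← Complex.ofReal_sub,
      ← Complex.ofReal_one, ← Complex.ofReal_sub, Complex.norm_real, Complex.norm_real,
      Complex.norm_real, Real.norm_eq_abs, Real.norm_eq_abs, Real.norm_eq_abs,
      abs_of_pos hρ, abs_of_nonneg (sub_nonneg.2 (tent_le_one x hρ y))]
    gcongr
    have h4 : 1 - |y - x| / ρ ≤ tent x ρ y := le_max_right _ _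
    calc ρ * (1 - tent x ρ y) ≤ ρ * (|y - x| / ρ) := by gcongr; linarith
      _ = |y - x| := by field_simp) η
  rw [bcfc_const_mul hD (((isCb_const 1).sub ht).mul hr), bcfc_mul hD ((isCb_const 1).sub ht) hr,
    bcfc_sub hD (isCb_const 1) ht, h0, sub_zero, bcfc_one hD, one_mul, one_mul,
    bcfc_sub hD isCb_mul_resFun (hr.const_mul _), bcfc_const_mul hD hr] at h3
  simpa [norm_smul, abs_of_pos hρ] using h3

theorem norm_sum_sq_of_orthogonal {ι : Type*} (s : Finset ι) (v : ι → H)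
    (h : ∀ i ∈ s, ∀ j ∈ s, i ≠ j → inner ℂ (v i) (v j) = 0) :
    ‖∑ i ∈ s, v i‖ ^ 2 = ∑ i ∈ s, ‖v i‖ ^ 2 := by
  have h1 : ((‖∑ i ∈ s, v i‖ ^ 2 : ℝ) : ℂ) = ((∑ i ∈ s, ‖v i‖ ^ 2 : ℝ) : ℂ) := by
    have h2 := inner_self_eq_norm_sq_to_K (𝕜 := ℂ) (∑ i ∈ s, v i)
    rw [Complex.ofReal_pow]
    refine h2.symm.trans ?_
    rw [sum_inner, Complex.ofReal_sum]
    refine Finset.sum_congr rfl fun i hi => ?_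
    rw [inner_sum, Finset.sum_eq_single i (fun j hj hji => h i hi j hj hji.symm)
      (fun hh => absurd hi hh), Complex.ofReal_pow]
    exact inner_self_eq_norm_sq_to_K (𝕜 := ℂ) (v i)
  exact Complex.ofReal_injective h1

theorem exists_pos_le_of_finset {ι : Type*} (s : Finset ι) {f : ι → ℝ} (h : ∀ i ∈ s, 0 < f i) :
    ∃ ρ > 0, ∀ i ∈ s, ρ ≤ f i := by
  rcases s.eq_empty_or_nonempty with rfl | hs
  · exact ⟨1, one_pos, by simp⟩
  · obtain ⟨i, hi, hi'⟩ := s.exists_min_image f hs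
    exact ⟨f i, h i hi, hi'⟩

theorem inner_bcfc_eq_zero {D : H →ₗ.[ℂ] H} (hD : IsSelfAdjoint D) {f g : ℝ → ℂ} (hf : IsCb f)
    (hg : IsCb g) (h : ∀ x, f x = 0 ∨ g x = 0) (η ζ : H) :
    inner ℂ (bcfc D f η) (bcfc D g ζ) = 0 := by
  rw [inner_bcfc_bcfc hD hf hg]
  have : (fun x => conj (f x) * g x) = fun _ => 0 := by
    ext x
    rcases h x with h | h <;> simp [h]
  rw [this, bcfc_const hD]
  simp

/-! ### The essential spectrum -/

/-- The essential spectrum, by Weyl's criterion. -/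
def essSpec (D : H →ₗ.[ℂ] H) : Set ℝ :=
  {E | ∀ F : Submodule ℂ H, FiniteDimensional ℂ F → ∀ δ > 0, ∃ u b : H, (u, b) ∈ D.graph ∧
    ‖u‖ = 1 ∧ u ∈ Fᗮ ∧ ‖b - (E : ℂ) • u‖ ≤ δ}

theorem isClosed_essSpec (D : H →ₗ.[ℂ] H) : IsClosed (essSpec D) := by
  refine isClosed_of_closure_subset fun E hE F hF δ hδ => ?_
  obtain ⟨E', hE', hd⟩ := Metric.mem_closure_iff.1 hE (δ / 2) (half_pos hδ)
  obtain ⟨u, b, hub, hu, huF, hb⟩ := hE' F hF (δ / 2) (half_pos hδ)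
  refine ⟨u, b, hub, hu, huF, ?_⟩
  have h1 : b - (E : ℂ) • u = (b - (E' : ℂ) • u) - ((E : ℂ) - E') • u := by
    rw [sub_smul]; abel
  rw [h1]
  calc _ ≤ ‖b - (E' : ℂ) • u‖ + ‖((E : ℂ) - E') • u‖ := norm_sub_le _ _
    _ ≤ δ / 2 + δ / 2 := by
        refine add_le_add hb ?_
        rw [norm_smul, hu, mul_one, ← Complex.ofReal_sub, Complex.norm_real]
        exact hd.le
    _ = δ := add_halves δ

/-- Take F spanned by a finite δ-net of the image of the unit ball. For u orthogonal to F and w the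
unit vector along C u, ‖C u‖ = ⟨w, C u⟩ = ⟨C w, u⟩, and C w is within δ of a net point orthogonal to
u. -/
theorem exists_finiteDimensional_norm_le {C : H →L[ℂ] H} (hC : IsSelfAdjoint C)
    (hc : IsCompactOperator C) {δ : ℝ} (hδ : 0 < δ) :
    ∃ F : Submodule ℂ H, FiniteDimensional ℂ F ∧ ∀ u ∈ Fᗮ, ‖C u‖ ≤ δ * ‖u‖ := by
  have h1 := hc.isCompact_closure_image_closedBall (𝕜₁ := ℂ) (f := (C : H →ₗ[ℂ] H)) 1
  have h2 := h1.totallyBounded.subset subset_closure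
  obtain ⟨t, ht, hcov⟩ := Metric.totallyBounded_iff.1 h2 δ hδ
  refine ⟨Submodule.span ℂ t, FiniteDimensional.span_of_finite ℂ ht, fun u hu => ?_⟩
  by_cases h0 : C u = 0
  · rw [h0, norm_zero]; positivity
  have hn : 0 < ‖C u‖ := norm_pos_iff.2 h0
  set w := ((‖C u‖⁻¹ : ℝ) : ℂ) • C u
  have hw : ‖w‖ = 1 := by
    simp only [w, norm_smul, Complex.norm_real, norm_inv, norm_norm]
    exact inv_mul_cancel₀ hn.ne'
  have hw1 : C w ∈ ⋃ y ∈ t, Metric.ball y δ :=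
    hcov ⟨w, by simp [hw], rfl⟩
  simp only [Set.mem_iUnion, Metric.mem_ball, exists_prop] at hw1
  obtain ⟨y, hy, hyw⟩ := hw1
  have h3 : inner ℂ w (C u) = ‖C u‖ := by
    simp only [w, inner_smul_left, Complex.conj_ofReal]
    rw [inner_self_eq_norm_sq_to_K]
    push_cast
    change (‖C u‖ : ℂ)⁻¹ * (‖C u‖ : ℂ) ^ 2 = (‖C u‖ : ℂ)
    have : (‖C u‖ : ℂ) ≠ 0 := by exact_mod_cast hn.ne'
    field_simp
  have h4 : inner ℂ w (C u) = inner ℂ (C w) u :=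
    ((ContinuousLinearMap.isSelfAdjoint_iff_isSymmetric.1 hC) w u).symm
  have h5 : inner ℂ y u = 0 := (Submodule.mem_orthogonal _ _).1 hu y (Submodule.subset_span hy)
  have h6 : ‖(‖C u‖ : ℂ)‖ ≤ δ * ‖u‖ := by
    rw [← h3, h4, ← sub_zero (inner ℂ (C w) u), ← h5, ← inner_sub_left]
    refine (norm_inner_le_norm _ _).trans ?_
    gcongr
    rw [← dist_eq_norm]
    exact hyw.le
  simpa using h6

theorem essSpec_subset_perturb {D : H →ₗ.[ℂ] H} {C : H →L[ℂ] H} (hC : IsSelfAdjoint C)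
    (hc : IsCompactOperator C) : essSpec D ⊆ essSpec (perturb D C) := by
  intro E hE F hF δ hδ
  obtain ⟨F', hF', hF'C⟩ := exists_finiteDimensional_norm_le hC hc (half_pos hδ)
  obtain ⟨u, b, hub, hu, huF, hb⟩ := hE (F ⊔ F') inferInstance (δ / 2) (half_pos hδ)
  refine ⟨u, b + C u, mem_graph_perturb.2 (by simpa using hub), hu,
    Submodule.orthogonal_le le_sup_left huF, ?_⟩
  have h1 : b + C u - (E : ℂ) • u = (b - (E : ℂ) • u) + C u := by abel
  have h2 := hF'C u (Submodule.orthogonal_le le_sup_right huF)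
  rw [hu, mul_one] at h2
  rw [h1]
  exact (norm_add_le _ _).trans (by linarith)

theorem essSpec_perturb {D : H →ₗ.[ℂ] H} {C : H →L[ℂ] H} (hC : IsSelfAdjoint C)
    (hc : IsCompactOperator C) : essSpec (perturb D C) = essSpec D := by
  refine (Set.Subset.antisymm (essSpec_subset_perturb hC hc) ?_).symm
  have := essSpec_subset_perturb (D := perturb D C) hC.neg hc.neg
  rwa [perturb_perturb, add_neg_cancel, perturb_zero] at this

/-- Failure of Weyl's criterion gives a finite-dimensional F and δ > 0 with ‖(D - E)a‖ > δ‖a‖ for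
nonzero domain vectors a orthogonal to F. The eigenspace therefore injects into F. If E were not
isolated, more than dim F spectral points near E would supply orthogonal vectors localised near E,
and some combination of them would be orthogonal to F. -/
theorem mem_discreteSpec_of_notMem_essSpec {D : H →ₗ.[ℂ] H} (hD : IsSelfAdjoint D) {E : ℝ} {u : H}
    (hu : u ≠ 0) (hE : (u, (E : ℂ) • u) ∈ D.graph) (hess : E ∉ essSpec D) :
    (E : ℂ) ∈ discreteSpec D := by
  simp only [essSpec, Set.mem_ofPred_eq, not_forall, not_exists, not_and, not_le] at hess
  obtain ⟨F, hF, δ, hδ, hFδ⟩ := hess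
  have hlow : ∀ a b : H, (a, b) ∈ D.graph → a ∈ Fᗮ → a ≠ 0 → δ * ‖a‖ < ‖b - (E : ℂ) • a‖ := by
    intro a b hab haF ha
    have hn : 0 < ‖a‖ := norm_pos_iff.2 ha
    have h1 := hFδ _ _ (graph_smul ((‖a‖⁻¹ : ℝ) : ℂ) hab)
      (by rw [norm_smul, Complex.norm_real, norm_inv, norm_norm]; exact inv_mul_cancel₀ hn.ne')
      (Submodule.smul_mem _ _ haF)
    rw [smul_comm, ← smul_sub, norm_smul, Complex.norm_real, norm_inv, norm_norm,
      inv_mul_eq_div, lt_div_iff₀ hn] at h1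
    exact h1
  refine ⟨mem_spec_of_eigenvector hu hE, ?_, ?_, ?_⟩
  · by_contra hiso
    push Not at hiso
    have hinf : {x : ℝ | (x : ℂ) ∈ spec D ∧ |x - E| < δ / 2}.Infinite := by
      intro hfin
      have h1 : IsOpen ({x : ℝ | (x : ℂ) ∈ spec D ∧ |x - E| < δ / 2} \ {E})ᶜ :=
        (hfin.sdiff).isClosed.isOpen_compl
      obtain ⟨ε, hε, hball⟩ := Metric.isOpen_iff.1 h1 E (by simp)
      obtain ⟨z, hz, hzE, hne⟩ := hiso (min ε (δ / 2)) (lt_min hε (half_pos hδ))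
      have hzr : ((z.re : ℝ) : ℂ) = z :=
        Complex.ext rfl (im_eq_zero_of_mem_spec hD hz).symm
      have hd : |z.re - E| < min ε (δ / 2) := by
        have := Complex.abs_re_le_norm (z - E)
        simp only [Complex.sub_re, Complex.ofReal_re] at this
        linarith
      have h2 := hball (show z.re ∈ Metric.ball E ε by
        rw [Metric.mem_ball, Real.dist_eq]; exact hd.trans_le (min_le_left _ _))
      refine h2 ⟨⟨by rwa [hzr], hd.trans_le (min_le_right _ _)⟩, ?_⟩
      rintro rfl
      exact hne hzr.symm
    obtain ⟨t, hts, htc⟩ := hinf.exists_subset_card_eq (Module.finrank ℂ F + 1)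
    obtain ⟨ρ₀, hρ₀, hsep₀⟩ := exists_pos_le_of_finset t.offDiag
      (f := fun p => |p.1 - p.2|) fun p hp => by
        rw [Finset.mem_offDiag] at hp
        exact abs_pos.2 (sub_ne_zero.2 hp.2.2)
    -- Half the separation makes the tents disjoint; δ/2 keeps their supports within δ of E, the
    -- points themselves being within δ/2.
    set ρ := min (ρ₀ / 2) (δ / 2)
    have hρ : 0 < ρ := lt_min (half_pos hρ₀) (half_pos hδ)
    have hρ1 : ρ ≤ ρ₀ / 2 := min_le_left _ _
    have hρ2 : ρ ≤ δ / 2 := min_le_right _ _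
    have hw : ∀ x : t, ∃ w, bcfc D (fun y => (tent x ρ y : ℂ)) w ≠ 0 := by
      intro x
      have := bcfc_tent_ne_zero hD (hts x.2).1 hρ
      by_contra hh
      push Not at hh
      exact this (ContinuousLinearMap.ext hh)
    choose w hw using hw
    set v : t → H := fun x => bcfc D (fun y => (tent x ρ y : ℂ)) (w x)
    have hcb := fun x : t => isCb_mul_tent x hρ (k := fun y => (y : ℂ) - E) (by fun_prop)
    set r : t → H := fun x => bcfc D (fun y => ((y : ℂ) - E) * (tent x ρ y : ℂ)) (w x)
    have hvr : ∀ x, (v x, (E : ℂ) • v x + r x) ∈ D.graph := fun x =>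
      bcfc_sub_const_mul_mem_graph hD (isCb_tent x hρ)
        (isCb_mul_tent x hρ (k := fun y => (y : ℂ)) (by fun_prop)) (w x) E
    have hdisj : ∀ x y : t, x ≠ y → ∀ s, tent x ρ s = 0 ∨ tent y ρ s = 0 := by
      intro x y hxy s
      by_contra hh
      push Not at hh
      have h1 : |s - x| < ρ := by
        by_contra h; exact hh.1 (tent_eq_zero hρ (not_lt.1 h))
      have h2 : |s - y| < ρ := by
        by_contra h; exact hh.2 (tent_eq_zero hρ (not_lt.1 h))
      have h3 := hsep₀ (x, y) (by
        rw [Finset.mem_offDiag]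
        exact ⟨x.2, y.2, fun h => hxy (Subtype.ext h)⟩)
      simp only at h3
      have h4 := abs_sub_le (x : ℝ) s y
      rw [abs_sub_comm] at h1
      linarith
    have hvo : ∀ x y : t, x ≠ y → inner ℂ (v x) (v y) = 0 := fun x y hxy =>
      inner_bcfc_eq_zero hD (isCb_tent x hρ) (isCb_tent y hρ)
        (fun s => by simpa using hdisj x y hxy s) _ _
    have hro : ∀ x y : t, x ≠ y → inner ℂ (r x) (r y) = 0 := fun x y hxy =>
      inner_bcfc_eq_zero hD (hcb x) (hcb y) (fun s => by
        rcases hdisj x y hxy s with h | h <;> simp [h]) _ _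
    have hrv : ∀ x, ‖r x‖ ≤ δ * ‖v x‖ := fun x =>
      norm_bcfc_le_of_le hD (hcb x) (isCb_tent x hρ) hδ.le (fun s => by
        by_cases h : ρ ≤ |s - x|
        · simp [tent_eq_zero hρ h]
        · rw [norm_mul]
          gcongr
          rw [← Complex.ofReal_sub, Complex.norm_real, Real.norm_eq_abs]
          have h1 := (hts x.2).2
          have h2 := abs_sub_le s (x : ℝ) E
          push Not at h
          linarith) _
    -- There is one more coefficient than dim F, so some nonzero combination of the localised
    -- vectors has zero projection to F.
    let L : (t → ℂ) →ₗ[ℂ] F :=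
      ∑ x : t, (LinearMap.proj x).smulRight (F.orthogonalProjectionOnto (v x))
    have hL : LinearMap.ker L ≠ ⊥ := LinearMap.ker_ne_bot_of_finrank_lt (by simp [htc])
    obtain ⟨c, hc, hc0⟩ := Submodule.exists_mem_ne_zero_of_ne_bot hL
    have hcF : (∑ x : t, c x • v x) ∈ Fᗮ := by
      rw [← Submodule.orthogonalProjectionOnto_eq_zero_iff]
      have : L c = 0 := hc
      simpa [L] using this
    have hg := graph_sum Finset.univ fun (x : t) _ => graph_smul (c x) (hvr x)
    have hn1 : ‖∑ x : t, c x • v x‖ ^ 2 = ∑ x : t, ‖c x • v x‖ ^ 2 :=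
      norm_sum_sq_of_orthogonal _ _ fun x _ y _ hxy => by
        rw [inner_smul_left, inner_smul_right, hvo x y hxy]; simp
    have hn2 : ‖∑ x : t, c x • r x‖ ^ 2 = ∑ x : t, ‖c x • r x‖ ^ 2 :=
      norm_sum_sq_of_orthogonal _ _ fun x _ y _ hxy => by
        rw [inner_smul_left, inner_smul_right, hro x y hxy]; simp
    have hne : (∑ x : t, c x • v x) ≠ 0 := by
      intro h0
      rw [h0, norm_zero, zero_pow two_ne_zero] at hn1
      have h1 := (Finset.sum_eq_zero_iff_of_nonneg fun x _ => sq_nonneg _).1 hn1.symm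
      refine hc0 (funext fun x => ?_)
      have h2 := h1 x (Finset.mem_univ x)
      have h3 : c x • v x = 0 := by simpa using h2
      exact (smul_eq_zero.1 h3).resolve_right (hw x)
    have hlt := hlow _ _ hg hcF hne
    have h4 : ∑ x : t, c x • ((E : ℂ) • v x + r x) - (E : ℂ) • ∑ x : t, c x • v x =
        ∑ x : t, c x • r x := by
      simp only [smul_add, Finset.sum_add_distrib, Finset.smul_sum]
      rw [add_sub_right_comm]
      simp only [smul_comm (E : ℂ)]
      simp
    rw [h4] at hlt
    have h5 : ‖∑ x : t, c x • r x‖ ^ 2 ≤ (δ * ‖∑ x : t, c x • v x‖) ^ 2 := by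
      rw [hn2, mul_pow, hn1, Finset.mul_sum]
      refine Finset.sum_le_sum fun x _ => ?_
      rw [← mul_pow]
      gcongr
      rw [norm_smul, norm_smul]
      nlinarith [hrv x, norm_nonneg (c x)]
    exact absurd (abs_le_of_sq_le_sq' h5 (by positivity)).2 (not_le.2 hlt)
  · intro hbot
    have : u ∈ eigenspace D E := hE
    rw [hbot] at this
    exact hu (by simpa using this)
  · let f : eigenspace D E →ₗ[ℂ] F :=
      (F.orthogonalProjectionOnto : H →ₗ[ℂ] F).comp (eigenspace D E).subtype
    refine FiniteDimensional.of_injective f ?_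
    rw [← LinearMap.ker_eq_bot, Submodule.eq_bot_iff]
    intro a ha
    by_contra h0
    have h1 : (a : H) ∈ Fᗮ := by
      rw [← Submodule.orthogonalProjectionOnto_eq_zero_iff]
      exact ha
    have h2 := hlow a _ a.2 h1 (by simpa using h0)
    rw [sub_self, norm_zero] at h2
    exact absurd h2 (not_lt.2 (by positivity))

/-! ### Schatten norms of self-adjoint operators -/

theorem absPow_eq_cfc {p : ℝ} (hp : 0 < p) {C : H →L[ℂ] H} (hC : IsSelfAdjoint C) :
    absPow p C = cfc (fun x : ℝ => |x| ^ p) C := by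
  have h1 : ContinuousLinearMap.adjoint C * C = C ^ 2 := by
    rw [← ContinuousLinearMap.star_eq_adjoint, hC.star_eq, sq]
  have hc : Continuous fun x : ℝ => x ^ (p / 2) := Real.continuous_rpow_const (by positivity)
  rw [absPow, h1, ← cfc_comp_pow (fun x : ℝ => x ^ (p / 2)) 2 C hc.continuousOn hC]
  congr 1
  funext x
  rw [← sq_abs x, ← Real.rpow_natCast, ← Real.rpow_mul (abs_nonneg x)]
  congr 1
  push_cast
  ring

theorem re_inner_cfc_mono {C : H →L[ℂ] H} {f g : ℝ → ℝ} (hf : Continuous f)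
    (hg : Continuous g) (h : ∀ x, f x ≤ g x) (x : H) :
    (inner ℂ x (cfc f C x)).re ≤ (inner ℂ x (cfc g C x)).re := by
  have h1 : cfc f C ≤ cfc g C :=
    cfc_mono (fun x _ => h x) hf.continuousOn hg.continuousOn
  have h2 := (ContinuousLinearMap.le_def _ _).1 h1
  have h3 := h2.re_inner_nonneg_right x
  rw [sub_apply, inner_sub_right] at h3
  simpa using h3

/-- Bernoulli's inequality: the convex function |x| ^ p lies above its tangent at |x| = t. -/
theorem tangent_le_rpow_abs {p t : ℝ} (hp : 1 ≤ p) (ht : 0 < t) (x : ℝ) :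
    p * t ^ (p - 1) * |x| - (p - 1) * t ^ p ≤ |x| ^ p := by
  have h1 := one_add_mul_self_le_rpow_one_add (s := |x| / t - 1)
    (by have : 0 ≤ |x| / t := by positivity
        linarith) hp
  have h2 : (1 + (|x| / t - 1)) ^ p = |x| ^ p / t ^ p := by
    rw [show 1 + (|x| / t - 1) = |x| / t by ring, Real.div_rpow (abs_nonneg x) ht.le]
  rw [h2, le_div_iff₀ (by positivity)] at h1
  have h3 : t ^ p = t ^ (p - 1) * t := by
    rw [← Real.rpow_add_one ht.ne']; ring_nf
  calc _ = (1 + p * (|x| / t - 1)) * t ^ p := by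
        rw [h3]; field_simp; ring
    _ ≤ _ := h1

/-- Jensen's inequality for the spectral measure of C at a unit vector, in operator form: the
tangent at the mean a = ⟨x, C x⟩ is affine, so its functional calculus can be evaluated at x. The
case a = 0 is separate since the tangent bound requires t > 0. -/
theorem norm_inner_rpow_le {p : ℝ} (hp : 1 ≤ p) {C : H →L[ℂ] H} (hC : IsSelfAdjoint C)
    {x : H} (hx : ‖x‖ = 1) :
    ‖inner ℂ x (C x)‖ ^ p ≤ (inner ℂ x (absPow p C x)).re := by
  have hp0 : 0 < p := by linarith
  rw [absPow_eq_cfc hp0 hC]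
  have hcont : Continuous fun x : ℝ => |x| ^ p :=
    (Real.continuous_rpow_const hp0.le).comp continuous_abs
  have hsym := (ContinuousLinearMap.isSelfAdjoint_iff_isSymmetric.1 hC)
  have him : (inner ℂ x (C x)).im = 0 := by
    have := hsym.im_inner_self_apply x
    rw [← inner_conj_symm]
    simpa using this
  set a : ℝ := (inner ℂ x (C x)).re with ha
  have hin : inner ℂ x (C x) = (a : ℂ) := Complex.ext (by simp [ha]) (by simp [him])
  rw [hin, Complex.norm_real, Real.norm_eq_abs]
  rcases eq_or_ne a 0 with h0 | h0
  · rw [h0, abs_zero, Real.zero_rpow hp0.ne']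
    have := re_inner_cfc_mono (C := C) (f := fun _ => 0) continuous_const hcont
      (fun x => by positivity) x
    simpa using this
  have ht : 0 < |a| := abs_pos.2 h0
  set s : ℝ := a / |a| with hs
  have hs1 : |s| = 1 := by rw [hs, abs_div, abs_abs, div_self ht.ne']
  have key := re_inner_cfc_mono (C := C)
    (f := fun y => (p * |a| ^ (p - 1) * s) * y - (p - 1) * |a| ^ p) (by fun_prop) hcont
    (fun y => by
      refine le_trans ?_ (tangent_le_rpow_abs hp ht y)
      have : s * y ≤ |y| := by
        calc s * y ≤ |s * y| := le_abs_self _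
          _ = |y| := by rw [abs_mul, hs1, one_mul]
      have h2 : 0 ≤ p * |a| ^ (p - 1) := by positivity
      nlinarith) x
  rw [cfc_sub _ _ _ (by fun_prop) (by fun_prop), cfc_const_mul_id _ _ hC, cfc_const _ _ hC,
    sub_apply, inner_sub_right, Algebra.algebraMap_eq_smul_one] at key
  simp only [smul_apply, Complex.sub_re] at key
  have e1 : (inner ℂ x ((p * |a| ^ (p - 1) * s) • C x)).re = p * |a| ^ (p - 1) * s * a := by
    rw [← Complex.coe_smul, inner_smul_right, hin]
    simp [← Complex.ofReal_mul]
  have e2 : (inner ℂ x (((p - 1) * |a| ^ p) • (1 : H →L[ℂ] H) x)).re = (p - 1) * |a| ^ p := by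
    rw [← Complex.coe_smul, inner_smul_right, one_apply_eq_self,
      inner_self_eq_norm_sq_to_K, hx]
    simp
  rw [e1, e2] at key
  have hsa : s * a = |a| := by
    rw [hs, div_mul_eq_mul_div, div_eq_iff ht.ne', ← abs_mul_abs_self a]
  have h3 : |a| ^ p = |a| ^ (p - 1) * |a| := by
    rw [← Real.rpow_add_one ht.ne']; ring_nf
  calc |a| ^ p = p * |a| ^ (p - 1) * s * a - (p - 1) * |a| ^ p := by
        rw [mul_assoc _ s a, hsa, h3]; ring
    _ ≤ _ := key

/-- The eigenvalue belongs to the spectrum, so both sides make sense for every continuous function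
there; they agree on constants and the coordinate, and agreement passes to sums, products and
uniform limits. -/
theorem cfc_apply_eigenvector {C : H →L[ℂ] H} (hC : IsSelfAdjoint C) {f : ℝ → ℝ}
    (hf : Continuous f) {l : ℝ} {v : H} (hv : C v = (l : ℂ) • v) :
    cfc f C v = (f l : ℂ) • v := by
  rcases eq_or_ne v 0 with h0 | h0
  · simp [h0]
  have hl : l ∈ spectrum ℝ C := by
    rw [spectrum.mem_iff]
    rintro ⟨u, hu⟩
    have h1 : (algebraMap ℝ (H →L[ℂ] H) l - C) v = 0 := by
      rw [sub_apply, Algebra.algebraMap_eq_smul_one, smul_apply,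
        one_apply_eq_self, hv, Complex.coe_smul, sub_self]
    rw [← hu] at h1
    apply h0
    have : (((u⁻¹ : (H →L[ℂ] H)ˣ) : H →L[ℂ] H) * (u : H →L[ℂ] H)) v = 0 := by
      rw [mul_apply_eq_comp, h1, map_zero]
    simpa using this
  rw [cfc_apply f C hC hf.continuousOn]
  have key : ∀ g : C(spectrum ℝ C, ℝ), cfcHom hC g v = ((g ⟨l, hl⟩ : ℝ) : ℂ) • v := by
    intro g
    induction g using ContinuousMap.induction_on_of_compact with
    | const r =>
      have : ContinuousMap.const (spectrum ℝ C) r = algebraMap ℝ C(spectrum ℝ C, ℝ) r := rfl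
      rw [this, AlgHomClass.commutes, Algebra.algebraMap_eq_smul_one, smul_apply,
        one_apply_eq_self]
      simp
    | id => rw [cfcHom_id hC, hv]; rfl
    | star_id => rw [map_star, cfcHom_id hC, hC.star_eq, hv]; simp
    | add f g hf hg => rw [map_add, add_apply, hf, hg, ← add_smul]; simp
    | mul f g hf hg =>
      rw [map_mul, mul_apply_eq_comp, hg, map_smul, hf, smul_smul]; simp [mul_comm]
    | frequently f h =>
      refine h.mem_of_closed (isClosed_eq ?_ ?_)
      · have := cfcHom_continuous hC (R := ℝ)
        exact (ContinuousLinearMap.apply ℂ H v).continuous.comp this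
      · exact (Complex.continuous_ofReal.comp (continuous_eval_const _)).smul
          continuous_const
  rw [key]
  rfl

/-- The spectral theorem for compact self-adjoint operators says that the eigenspaces span a dense
subspace; bases of the separate eigenspaces are collected into one. -/
theorem exists_hilbertBasis_eigenvectors {C : H →L[ℂ] H} (hC : IsSelfAdjoint C)
    (hc : IsCompactOperator C) :
    ∃ (w : Set H) (b : HilbertBasis w ℂ H) (l : w → ℝ), ∀ i, C (b i) = (l i : ℂ) • b i := by
  have hsym := ContinuousLinearMap.isSelfAdjoint_iff_isSymmetric.1 hC
  have hbot := ContinuousLinearMap.orthogonalComplement_iSup_eigenspaces_eq_bot hc hsym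
  have hof := hsym.orthogonalFamily_eigenspaces
  have hcl : ∀ z : ℂ, IsClosed
      (Module.End.eigenspace ((C : H →L[ℂ] H) : Module.End ℂ H) z : Set H) := by
    intro z
    have : (Module.End.eigenspace ((C : H →L[ℂ] H) : Module.End ℂ H) z : Set H)
        = {x | C x = z • x} := by
      ext x
      simp
    rw [this]
    exact isClosed_eq C.continuous (continuous_id.const_smul z)
  have hcomp : ∀ z : ℂ, CompleteSpace
      (Module.End.eigenspace ((C : H →L[ℂ] H) : Module.End ℂ H) z) :=
    fun z => (hcl z).completeSpace_coe
  choose W B hB using fun z : ℂ => exists_hilbertBasis ℂ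
    (Module.End.eigenspace ((C : H →L[ℂ] H) : Module.End ℂ H) z)
  have hon := hof.orthonormal_sigma_orthonormal (fun z => (B z).orthonormal)
  have hev : ∀ x ∈ Set.range (fun a : Σ z, W z => (B a.1 a.2 : H)), ∃ r : ℝ, C x = (r : ℂ) • x := by
    rintro _ ⟨⟨z, j⟩, rfl⟩
    have hm : C (B z j : H) = z • (B z j : H) := Module.End.mem_eigenspace_iff.1 (B z j).2
    have hn : (B z j : H) ≠ 0 := by
      intro h
      exact (B z).orthonormal.ne_zero j (Subtype.ext h)
    have hz : conj z = z := hsym.conj_eigenvalue_eq_self (μ := z)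
      (Module.End.hasEigenvalue_of_hasEigenvector ⟨(B z j).2, hn⟩)
    exact ⟨z.re, by rw [hm, Complex.conj_eq_iff_re.1 hz]⟩
  choose! l hl using hev
  have hs : (Submodule.span ℂ (Set.range
      (Subtype.val : Set.range (fun a : Σ z, W z => (B a.1 a.2 : H)) → H)))ᗮ = ⊥ := by
    rw [Subtype.range_coe, eq_bot_iff, ← hbot]
    intro x hx
    rw [Submodule.mem_orthogonal] at *
    intro u hu
    have hle : (⨆ μ, Module.End.eigenspace ((C : H →L[ℂ] H) : Module.End ℂ H) μ) ≤ (ℂ ∙ x)ᗮ := by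
      refine iSup_le fun z y hy => ?_
      rw [Submodule.mem_orthogonal_singleton_iff_inner_left]
      have h1 := (B z).hasSum_repr ⟨y, hy⟩
      have h2 : HasSum (fun i => ((B z).repr ⟨y, hy⟩ i) • (B z i : H)) y := by
        have := h1.mapL (Submodule.subtypeL _)
        simpa using this
      have h3 : HasSum (fun i => inner ℂ x (((B z).repr ⟨y, hy⟩ i) • (B z i : H)))
          (inner ℂ x y) := h2.mapL (innerSL ℂ x)
      have h4 : (fun i => inner ℂ x (((B z).repr ⟨y, hy⟩ i) • (B z i : H))) = fun _ => 0 := by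
        funext i
        rw [inner_smul_right, ← inner_conj_symm,
          hx _ (Submodule.subset_span ⟨⟨z, i⟩, rfl⟩)]
        simp
      rw [h4] at h3
      rw [← inner_conj_symm, h3.unique hasSum_zero, map_zero]
    have := hle hu
    rwa [Submodule.mem_orthogonal_singleton_iff_inner_left] at this
  set v := fun a : Σ z, W z => (B a.1 a.2 : H) with hv
  have hon' : Orthonormal ℂ (Subtype.val : Set.range v → H) := hon.toSubtypeRange
  refine ⟨_, HilbertBasis.mkOfOrthogonalEqBot hon' hs, fun i => l i.1, fun i => ?_⟩
  rw [HilbertBasis.coe_mkOfOrthogonalEqBot]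
  exact hl i.1 i.2

/-! ### Traces and diagonal sums -/

theorem tsum_enorm_inner_sq {ι : Type*} (b : HilbertBasis ι ℂ H) (x : H) :
    ∑' i, ‖inner ℂ (b i) x‖ₑ ^ 2 = ‖x‖ₑ ^ 2 := by
  have h1 : HasSum (fun i => ‖inner ℂ (b i) x‖ ^ 2) (‖x‖ ^ 2) := by
    have := Complex.hasSum_re (b.hasSum_inner_mul_inner x x)
    have e : (inner ℂ x x).re = ‖x‖ ^ 2 := inner_self_eq_norm_sq (𝕜 := ℂ) x
    rw [e] at this
    convert this using 2 with i
    rw [← inner_conj_symm x (b i), ← Complex.normSq_eq_conj_mul_self, Complex.normSq_eq_norm_sq,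
      Complex.ofReal_re]
  have h2 : ∀ y : ℝ, 0 ≤ y → ENNReal.ofReal (y ^ 2) = ENNReal.ofReal y ^ 2 :=
    fun y hy => ENNReal.ofReal_pow hy 2
  simp_rw [← ofReal_norm, ← h2 _ (norm_nonneg _)]
  rw [← h1.tsum_eq, ENNReal.ofReal_tsum_of_nonneg (fun _ => by positivity) h1.summable]

/-- Expand each diagonal entry in the eigenbasis, exchange the nonnegative sums, and apply
Parseval's identity in the basis e. -/
theorem tsum_inner_eq_of_eigenbasis {ι κ : Type*} {T : H →L[ℂ] H} (hT : IsSelfAdjoint T)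
    (f : HilbertBasis ι ℂ H) {t : ι → ℝ} (ht : ∀ j, 0 ≤ t j)
    (hf : ∀ j, T (f j) = (t j : ℂ) • f j) (e : HilbertBasis κ ℂ H) :
    ∑' i, ENNReal.ofReal (inner ℂ (e i) (T (e i))).re = ∑' j, ENNReal.ofReal (t j) := by
  have hsym := ContinuousLinearMap.isSelfAdjoint_iff_isSymmetric.1 hT
  have h1 : ∀ x, ENNReal.ofReal (inner ℂ x (T x)).re
      = ∑' j, ENNReal.ofReal (t j) * ‖inner ℂ (f j) x‖ₑ ^ 2 := by
    intro x
    have := Complex.hasSum_re (f.hasSum_inner_mul_inner x (T x))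
    have e1 : ∀ j, (inner ℂ x (f j) * inner ℂ (f j) (T x)).re = t j * ‖inner ℂ (f j) x‖ ^ 2 := by
      intro j
      have : inner ℂ (f j) (T x) = inner ℂ (T (f j)) x := (hsym (f j) x).symm
      rw [this, hf, inner_smul_left, ← inner_conj_symm x (f j), Complex.conj_ofReal,
        mul_left_comm, ← Complex.normSq_eq_conj_mul_self, Complex.normSq_eq_norm_sq,
        ← Complex.ofReal_mul, Complex.ofReal_re]
    simp_rw [e1] at this
    rw [← this.tsum_eq, ENNReal.ofReal_tsum_of_nonneg
      (fun j => mul_nonneg (ht j) (by positivity)) this.summable]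
    refine tsum_congr fun j => ?_
    rw [ENNReal.ofReal_mul (ht j), ENNReal.ofReal_pow (norm_nonneg _), ofReal_norm]
  simp_rw [h1]
  rw [ENNReal.tsum_comm]
  refine tsum_congr fun j => ?_
  rw [ENNReal.tsum_mul_left]
  have : ∑' i, ‖inner ℂ (f j) (e i)‖ₑ ^ 2 = 1 := by
    have := tsum_enorm_inner_sq e (f j)
    simp_rw [← ofReal_norm, norm_inner_symm (f j)] at *
    rw [this, f.orthonormal.1 j]
    simp
  rw [this, mul_one]

/-- The supremum over all orthonormal bases of the `p`-th powers of the diagonal entries. -/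
noncomputable def diagSup (p : ℝ) (X : H →L[ℂ] H) : ℝ≥0∞ :=
  ⨆ (w : Set H) (e : HilbertBasis w ℂ H), ∑' i, ‖inner ℂ (e i) (X (e i))‖ₑ ^ p

theorem tsum_le_diagSup {p : ℝ} (X : H →L[ℂ] H) {w : Set H} (e : HilbertBasis w ℂ H) :
    ∑' i, ‖inner ℂ (e i) (X (e i))‖ₑ ^ p ≤ diagSup p X :=
  le_iSup₂ (f := fun (w : Set H) (e : HilbertBasis w ℂ H) =>
    ∑' i, ‖inner ℂ (e i) (X (e i))‖ₑ ^ p) w e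

theorem diagSup_le_posTrace {p : ℝ} (hp : 1 ≤ p) {C : H →L[ℂ] H} (hC : IsSelfAdjoint C) :
    diagSup p C ≤ posTrace (absPow p C) := by
  refine iSup₂_mono fun w e => ENNReal.tsum_le_tsum fun i => ?_
  rw [← ofReal_norm, ENNReal.ofReal_rpow_of_nonneg (norm_nonneg _) (by linarith)]
  exact ENNReal.ofReal_le_ofReal (norm_inner_rpow_le hp hC (e.orthonormal.1 i))

theorem posTrace_absPow_of_eigenbasis {p : ℝ} (hp : 0 < p) {C : H →L[ℂ] H}
    (hC : IsSelfAdjoint C) {w : Set H} (f : HilbertBasis w ℂ H) {l : w → ℝ}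
    (hf : ∀ j, C (f j) = (l j : ℂ) • f j) :
    posTrace (absPow p C) = ∑' j, ENNReal.ofReal (|l j| ^ p) := by
  have hcont : Continuous fun x : ℝ => |x| ^ p :=
    (Real.continuous_rpow_const hp.le).comp continuous_abs
  have h1 : ∀ (v : Set H) (e : HilbertBasis v ℂ H),
      ∑' i, ENNReal.ofReal (inner ℂ (e i) (absPow p C (e i))).re
        = ∑' j, ENNReal.ofReal (|l j| ^ p) := by
    intro v e
    rw [absPow_eq_cfc hp hC]
    exact tsum_inner_eq_of_eigenbasis (cfc_predicate _ C) f
      (fun j => by positivity) (fun j => cfc_apply_eigenvector hC hcont (hf j)) e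
  refine le_antisymm (iSup₂_le fun v e => (h1 v e).le) ?_
  rw [← h1 w f]
  exact le_iSup₂ (f := fun (w : Set H) (e : HilbertBasis w ℂ H) =>
    ∑' i, ENNReal.ofReal (inner ℂ (e i) (absPow p C (e i))).re) w f

/-- Jensen gives one inequality and the eigenbasis of C attains it. This variational form of the
Schatten norm is what makes the triangle inequality and lower semicontinuity accessible. -/
theorem posTrace_absPow_eq_diagSup {p : ℝ} (hp : 1 ≤ p) {C : H →L[ℂ] H}
    (hC : IsSelfAdjoint C) (hc : IsCompactOperator C) :
    posTrace (absPow p C) = diagSup p C := by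
  refine le_antisymm ?_ (diagSup_le_posTrace hp hC)
  obtain ⟨w, f, l, hf⟩ := exists_hilbertBasis_eigenvectors hC hc
  rw [posTrace_absPow_of_eigenbasis (by linarith) hC f hf]
  refine le_trans (ENNReal.tsum_le_tsum fun j => ?_) (tsum_le_diagSup C f)
  rw [hf, inner_smul_right, inner_self_eq_norm_sq_to_K, f.orthonormal.1 j, ← ofReal_norm,
    ENNReal.ofReal_rpow_of_nonneg (norm_nonneg _) (by linarith)]
  simp

theorem schattenNorm_eq_diagSup {p : ℝ} (hp : 1 ≤ p) {C : H →L[ℂ] H}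
    (hC : IsSelfAdjoint C) (hc : IsCompactOperator C) :
    schattenNorm p C = diagSup p C ^ (1 / p) := by
  rw [schattenNorm, posTrace_absPow_eq_diagSup hp hC hc]

/-! ### Compactness of Schatten class operators -/

theorem isCompactOperator_rankOne (a b : H) :
    IsCompactOperator (InnerProductSpace.rankOne ℂ a b : H →L[ℂ] H) := by
  rw [InnerProductSpace.rankOne_def']
  have h : IsCompactOperator (innerSL ℂ b : H →L[ℂ] ℂ) :=
    isCompactOperator_of_locallyCompactSpace_dom (innerSL ℂ b)
  exact h.clm_comp (ContinuousLinearMap.toSpanSingleton ℂ a)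

theorem isCompactOperator_sum {ι : Type*} (s : Finset ι) {F : ι → H →L[ℂ] H}
    (h : ∀ i ∈ s, IsCompactOperator (F i)) : IsCompactOperator (∑ i ∈ s, F i : H →L[ℂ] H) := by
  classical
  induction s using Finset.induction_on with
  | empty => simpa using! isCompactOperator_zero
  | insert i s hi ih =>
    rw [Finset.sum_insert hi]
    exact (h i (Finset.mem_insert_self i s)).add
      (ih fun j hj => h j (Finset.mem_insert_of_mem hj))

theorem isCompactOperator_of_forall_exists {B : H →L[ℂ] H}
    (h : ∀ ε > 0, ∃ F : H →L[ℂ] H, IsCompactOperator F ∧ ‖B - F‖ ≤ ε) : IsCompactOperator B := by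
  have hcl : IsClosed {f : H →L[ℂ] H | IsCompactOperator f} :=
    isClosed_setOfPred_isCompactOperator
  refine hcl.closure_subset (Metric.mem_closure_iff.2 fun ε hε => ?_)
  obtain ⟨F, hF, hF'⟩ := h (ε / 2) (by positivity)
  exact ⟨F, hF, by rw [dist_eq_norm]; linarith⟩

/-- Truncating the basis expansion gives finite-rank operators; by Cauchy-Schwarz and Bessel the
error in operator norm is at most the square root of a tail of the convergent sum. -/
theorem isCompactOperator_of_tsum_enorm_sq {ι : Type*} (e : HilbertBasis ι ℂ H) {B : H →L[ℂ] H}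
    (hB : ∑' i, ‖B (e i)‖ₑ ^ 2 ≠ ∞) : IsCompactOperator B := by
  have hs : Summable fun i => ‖B (e i)‖ ^ 2 := by
    have h1 : Summable fun i => (‖B (e i)‖₊ ^ 2) := by
      rw [← ENNReal.tsum_coe_ne_top_iff_summable]
      simpa [enorm_eq_nnnorm] using hB
    have h2 := NNReal.summable_coe.2 h1
    simpa using h2
  refine isCompactOperator_of_forall_exists fun ε hε => ?_
  obtain ⟨s, hsv⟩ := summable_iff_vanishing_norm.1 hs (ε ^ 2) (by positivity)
  refine ⟨∑ i ∈ s, InnerProductSpace.rankOne ℂ (B (e i)) (e i),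
    isCompactOperator_sum s fun i _ => isCompactOperator_rankOne _ _,
    ContinuousLinearMap.opNorm_le_bound _ hε.le fun x => ?_⟩
  have h1 : HasSum (fun i => inner ℂ (e i) x • B (e i)) (B x) := by
    have := (e.hasSum_repr x).mapL B
    simpa [HilbertBasis.repr_apply_apply] using this
  have h2 : Tendsto (fun t : Finset ι => ∑ i ∈ t, inner ℂ (e i) x • B (e i)
      - ∑ i ∈ s, inner ℂ (e i) x • B (e i)) atTop
      (𝓝 (B x - ∑ i ∈ s, inner ℂ (e i) x • B (e i))) :=
    Tendsto.sub_const h1 _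
  have h3 : (B - ∑ i ∈ s, InnerProductSpace.rankOne ℂ (B (e i)) (e i)) x
      = B x - ∑ i ∈ s, inner ℂ (e i) x • B (e i) := by
    simp
  rw [h3]
  refine le_of_tendsto h2.norm ?_
  filter_upwards [eventually_ge_atTop s] with t ht
  classical
  rw [← Finset.sum_sdiff ht, add_sub_cancel_right]
  have hd : Disjoint (t \ s) s := Finset.sdiff_disjoint
  have h4 := hsv _ hd
  rw [Real.norm_of_nonneg (Finset.sum_nonneg fun _ _ => by positivity)] at h4
  calc ‖∑ i ∈ t \ s, inner ℂ (e i) x • B (e i)‖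
      ≤ ∑ i ∈ t \ s, ‖inner ℂ (e i) x‖ * ‖B (e i)‖ :=
        (norm_sum_le _ _).trans (Finset.sum_le_sum fun i _ => (norm_smul _ _).le)
    _ ≤ √(∑ i ∈ t \ s, ‖inner ℂ (e i) x‖ ^ 2) * √(∑ i ∈ t \ s, ‖B (e i)‖ ^ 2) :=
        Real.sum_mul_le_sqrt_mul_sqrt _ _ _
    _ ≤ ‖x‖ * ε := by
        gcongr
        · exact Real.sqrt_le_iff.2 ⟨norm_nonneg _, e.orthonormal.sum_inner_products_le x⟩
        · exact Real.sqrt_le_iff.2 ⟨hε.le, h4.le⟩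
    _ = ε * ‖x‖ := mul_comm _ _

/-- A finite trace says that |C| ^ (p/2) is Hilbert-Schmidt, hence compact, and C is a norm limit of
bounded operators times |C| ^ (p/2). -/
theorem isCompactOperator_of_posTrace_ne_top {p : ℝ} (hp : 0 < p) {C : H →L[ℂ] H}
    (hC : IsSelfAdjoint C) (h : posTrace (absPow p C) ≠ ∞) : IsCompactOperator C := by
  obtain ⟨w, e, -⟩ := exists_hilbertBasis ℂ H
  set f : ℝ → ℝ := fun x => |x| ^ (p / 2) with hf
  have hfc : Continuous f :=
    (Real.continuous_rpow_const (by positivity)).comp continuous_abs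
  have hB : IsSelfAdjoint (cfc f C) := cfc_predicate f C
  have hBc : IsCompactOperator (cfc f C : H →L[ℂ] H) := by
    refine isCompactOperator_of_tsum_enorm_sq e (ne_top_of_le_ne_top h ?_)
    refine le_trans (le_of_eq (tsum_congr fun i => ?_))
      (le_iSup₂ (f := fun (w : Set H) (e : HilbertBasis w ℂ H) =>
        ∑' i, ENNReal.ofReal (inner ℂ (e i) (absPow p C (e i))).re) w e)
    have h1 : absPow p C = cfc f C * cfc f C := by
      rw [absPow_eq_cfc hp hC, ← cfc_mul f f C hfc.continuousOn hfc.continuousOn]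
      congr 1
      funext x
      rw [hf, ← Real.rpow_add_of_nonneg (abs_nonneg x) (by positivity) (by positivity)]
      ring_nf
    have h2 : inner ℂ (e i) (absPow p C (e i)) = inner ℂ (cfc f C (e i)) (cfc f C (e i)) := by
      rw [h1, mul_apply_eq_comp]
      exact ((ContinuousLinearMap.isSelfAdjoint_iff_isSymmetric.1 hB) _ _).symm
    rw [h2]
    have h3 : (inner ℂ (cfc f C (e i)) (cfc f C (e i))).re = ‖cfc f C (e i)‖ ^ 2 :=
      inner_self_eq_norm_sq (𝕜 := ℂ) _
    rw [h3, ENNReal.ofReal_pow (norm_nonneg _), ofReal_norm]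
  refine isCompactOperator_of_forall_exists fun ε hε => ?_
  -- This regularises x / |x| ^ (p/2) near 0: the product with |x| ^ (p/2) equals x for |x| ≥ ε and
  -- differs from it by at most ε otherwise.
  set k : ℝ → ℝ := fun x => x / (max |x| ε) ^ (p / 2) with hk
  have hm : ∀ x : ℝ, 0 < max |x| ε := fun x => lt_max_of_lt_right hε
  have hkc : Continuous k := by
    refine continuous_id.div ?_ fun x => (Real.rpow_pos_of_pos (hm x) _).ne'
    exact (Real.continuous_rpow_const (by positivity)).comp
      (continuous_abs.max continuous_const)
  refine ⟨cfc k C * cfc f C, hBc.clm_comp (cfc k C), ?_⟩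
  rw [← cfc_mul k f C hkc.continuousOn hfc.continuousOn]
  nth_rw 1 [← cfc_id' ℝ C hC]
  rw [← cfc_sub (fun x => x) (fun x => k x * f x) C continuous_id.continuousOn
    (hkc.mul hfc).continuousOn]
  refine norm_cfc_le hε.le fun x _ => ?_
  rw [hk, hf, Real.norm_eq_abs]
  have hmp : 0 < (max |x| ε) ^ (p / 2) := Real.rpow_pos_of_pos (hm x) _
  have e1 : x - x / (max |x| ε) ^ (p / 2) * |x| ^ (p / 2)
      = x * (1 - |x| ^ (p / 2) / (max |x| ε) ^ (p / 2)) := by ring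
  simp only
  rw [e1, abs_mul]
  have hr1 : |x| ^ (p / 2) / (max |x| ε) ^ (p / 2) ≤ 1 := by
    rw [div_le_one hmp]
    exact Real.rpow_le_rpow (abs_nonneg x) (le_max_left _ _) (by positivity)
  have hr0 : 0 ≤ |x| ^ (p / 2) / (max |x| ε) ^ (p / 2) := by positivity
  rcases le_or_gt ε |x| with h5 | h5
  · rw [max_eq_left h5, div_self (by rw [max_eq_left h5] at hmp; exact hmp.ne')]
    simpa using hε.le
  · rw [abs_of_nonneg (sub_nonneg.2 hr1)]
    calc _ ≤ |x| * 1 := mul_le_mul_of_nonneg_left (by linarith) (abs_nonneg x)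
      _ ≤ ε := by linarith

theorem posTrace_ne_top {p : ℝ} (hp : 0 < p) {C : H →L[ℂ] H} (h : schattenNorm p C < ∞) :
    posTrace (absPow p C) ≠ ∞ := by
  intro h'
  rw [schattenNorm, h', ENNReal.top_rpow_of_pos (by positivity)] at h
  exact lt_irrefl _ h

theorem isCompactOperator_of_schattenNorm {p : ℝ} (hp : 0 < p) {C : H →L[ℂ] H}
    (hC : IsSelfAdjoint C) (h : schattenNorm p C < ∞) : IsCompactOperator C :=
  isCompactOperator_of_posTrace_ne_top hp hC (posTrace_ne_top hp h)

/-! ### Norm properties of `diagSup` -/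

/-- Minkowski's inequality for the diagonal entries in each fixed basis. -/
theorem diagSup_add_le {p : ℝ} (hp : 1 ≤ p) (X Y : H →L[ℂ] H) :
    diagSup p (X + Y) ^ (1 / p) ≤ diagSup p X ^ (1 / p) + diagSup p Y ^ (1 / p) := by
  have hp0 : 0 < p := by linarith
  rw [one_div, ENNReal.rpow_inv_le_iff hp0]
  refine iSup₂_le fun w e => ?_
  rw [ENNReal.tsum_eq_iSup_sum]
  refine iSup_le fun s => ?_
  rw [← ENNReal.rpow_inv_le_iff hp0]
  calc (∑ i ∈ s, ‖inner ℂ (e i) ((X + Y) (e i))‖ₑ ^ p) ^ p⁻¹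
      ≤ (∑ i ∈ s, (‖inner ℂ (e i) (X (e i))‖ₑ + ‖inner ℂ (e i) (Y (e i))‖ₑ) ^ p) ^ (1 / p) := by
        rw [one_div]
        gcongr with i hi
        rw [add_apply, inner_add_right]
        exact enorm_add_le _ _
    _ ≤ _ := ENNReal.Lp_add_le s _ _ hp
    _ ≤ _ := by
        rw [one_div]
        gcongr
        · exact (ENNReal.sum_le_tsum s).trans (tsum_le_diagSup X e)
        · exact (ENNReal.sum_le_tsum s).trans (tsum_le_diagSup Y e)

theorem diagSup_neg {p : ℝ} (X : H →L[ℂ] H) : diagSup p (-X) = diagSup p X := by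
  simp [diagSup]

theorem diagSup_zero {p : ℝ} (hp : 0 < p) : diagSup p (0 : H →L[ℂ] H) = 0 := by
  simp [diagSup, hp]

theorem enorm_rpow_le_diagSup {p : ℝ} (hp : 0 < p) {C : H →L[ℂ] H} (hC : IsSelfAdjoint C) :
    ‖C‖ₑ ^ p ≤ diagSup p C := by
  rcases eq_or_ne (diagSup p C) ∞ with htop | htop
  · simp [htop]
  set T : ℝ := (diagSup p C ^ p⁻¹).toReal with hT
  have htop' : diagSup p C ^ p⁻¹ ≠ ∞ := ENNReal.rpow_ne_top_of_nonneg (by positivity) htop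
  have h1 : ∀ x : H, ‖x‖ = 1 → ‖inner ℂ x (C x)‖ ≤ T := by
    intro x hx
    -- Any unit vector extends to a basis, so its diagonal entry is bounded by the supremum; for
    -- self-adjoint C the quadratic form determines the norm.
    have hon : Orthonormal ℂ ((↑) : ({x} : Set H) → H) := by
      refine ⟨fun i => by rw [i.2]; exact hx, fun i j hij => ?_⟩
      exact absurd (Subtype.ext (i.2.trans j.2.symm)) hij
    obtain ⟨w, b, hw, hb⟩ := hon.exists_hilbertBasis_extension
    have h2 := (ENNReal.le_tsum (f := fun i => ‖inner ℂ (b i) (C (b i))‖ₑ ^ p)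
      ⟨x, hw rfl⟩).trans (tsum_le_diagSup C b)
    simp only [hb] at h2
    rw [← ENNReal.le_rpow_inv_iff hp] at h2
    rw [hT, ← toReal_enorm]
    exact ENNReal.toReal_mono htop' h2
  have h3 : ‖C‖ ≤ T := by
    rw [ContinuousLinearMap.norm_eq_iSup_rayleighQuotient C
      (ContinuousLinearMap.isSelfAdjoint_iff_isSymmetric.1 hC)]
    refine ciSup_le fun x => ?_
    rcases eq_or_ne x 0 with h0 | h0
    · simp [h0, hT]
    have hn : ‖x‖ ≠ 0 := norm_ne_zero_iff.2 h0
    have h4 := h1 ((‖x‖⁻¹ : ℂ) • x) (by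
      rw [norm_smul]; simp [hn])
    have h5 : C.rayleighQuotient x = C.rayleighQuotient ((‖x‖⁻¹ : ℂ) • x) :=
      (C.rayleigh_smul x (by simpa using h0)).symm
    rw [h5, ContinuousLinearMap.rayleighQuotient, ContinuousLinearMap.reApplyInnerSelf_apply]
    have h6 : ‖((‖x‖⁻¹ : ℂ) • x)‖ = 1 := by rw [norm_smul]; simp [hn]
    rw [h6, one_pow, div_one]
    refine (RCLike.abs_re_le_norm _).trans ?_
    rwa [norm_inner_symm]
  rw [← ENNReal.le_rpow_inv_iff hp]
  rw [← ofReal_norm, ← ENNReal.ofReal_toReal htop']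
  exact ENNReal.ofReal_le_ofReal h3

/-- Lower semicontinuity in operator norm, clear for finite partial sums. It upgrades operator norm
limits to Schatten limits in the completeness proof. -/
theorem diagSup_le_of_tendsto {p : ℝ} {X : ℕ → H →L[ℂ] H} {Y : H →L[ℂ] H}
    (h : Tendsto X atTop (𝓝 Y)) {T : ℝ≥0∞} (hT : ∀ᶠ n in atTop, diagSup p (X n) ≤ T) :
    diagSup p Y ≤ T := by
  refine iSup₂_le fun w e => ?_
  rw [ENNReal.tsum_eq_iSup_sum]
  refine iSup_le fun s => ?_
  have h1 : Tendsto (fun n => ∑ i ∈ s, ‖inner ℂ (e i) (X n (e i))‖ₑ ^ p) atTop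
      (𝓝 (∑ i ∈ s, ‖inner ℂ (e i) (Y (e i))‖ₑ ^ p)) := by
    refine tendsto_finsetSum s fun i _ => ?_
    have h2 : Tendsto (fun n => X n (e i)) atTop (𝓝 (Y (e i))) :=
      ((ContinuousLinearMap.apply ℂ H (e i)).continuous.tendsto Y).comp h
    have h3 : Tendsto (fun n => inner ℂ (e i) (X n (e i))) atTop (𝓝 (inner ℂ (e i) (Y (e i)))) :=
      tendsto_const_nhds.inner h2
    exact ((ENNReal.continuous_rpow_const (y := p)).tendsto _).comp h3.enorm
  refine le_of_tendsto h1 ?_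
  filter_upwards [hT] with n hn
  exact ((ENNReal.sum_le_tsum s).trans (tsum_le_diagSup _ e)).trans hn

/-- Each diagonal entry is at most c, so its p-th power is at most c ^ (p - 1) times the entry. For
p > 1 a bounded trace norm with small operator norm thus gives a small Schatten norm. -/
theorem diagSup_le_of_enorm_le {p : ℝ} (hp : 1 ≤ p) {X : H →L[ℂ] H} {c : ℝ≥0∞} (hc : ‖X‖ₑ ≤ c) :
    diagSup p X ≤ c ^ (p - 1) * diagSup 1 X := by
  refine iSup₂_le fun w e => ?_
  refine le_trans ?_ (mul_le_mul_right (tsum_le_diagSup X e) _)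
  rw [← ENNReal.tsum_mul_left]
  refine ENNReal.tsum_le_tsum fun i => ?_
  have h1 : ‖inner ℂ (e i) (X (e i))‖ₑ ≤ c := by
    refine le_trans ?_ hc
    rw [← ofReal_norm, ← ofReal_norm]
    refine ENNReal.ofReal_le_ofReal ?_
    calc _ ≤ ‖e i‖ * ‖X (e i)‖ := norm_inner_le_norm _ _
      _ ≤ ‖e i‖ * (‖X‖ * ‖e i‖) := by gcongr; exact X.le_opNorm _
      _ = ‖X‖ := by rw [e.orthonormal.1 i]; ring
  calc ‖inner ℂ (e i) (X (e i))‖ₑ ^ p = ‖inner ℂ (e i) (X (e i))‖ₑ ^ ((p - 1) + 1) := by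
        rw [sub_add_cancel]
    _ = ‖inner ℂ (e i) (X (e i))‖ₑ ^ (p - 1) * ‖inner ℂ (e i) (X (e i))‖ₑ ^ (1 : ℝ) :=
        ENNReal.rpow_add_of_nonneg _ _ (by linarith) (by norm_num)
    _ ≤ _ := by
      gcongr

theorem diagSup_one_add_le (X Y : H →L[ℂ] H) :
    diagSup 1 (X + Y) ≤ diagSup 1 X + diagSup 1 Y := by
  simpa using diagSup_add_le le_rfl X Y

theorem diagSup_one_sum_le {ι : Type*} (s : Finset ι) (X : ι → H →L[ℂ] H) :
    diagSup 1 (∑ i ∈ s, X i) ≤ ∑ i ∈ s, diagSup 1 (X i) := by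
  classical
  induction s using Finset.induction_on with
  | empty => simp [diagSup_zero]
  | insert i s hi ih =>
    rw [Finset.sum_insert hi, Finset.sum_insert hi]
    exact (diagSup_one_add_le _ _).trans (by gcongr)

theorem diagSup_one_smul (z : ℂ) (X : H →L[ℂ] H) :
    diagSup 1 (z • X) = ‖z‖ₑ * diagSup 1 X := by
  simp [diagSup, enorm_mul, ENNReal.tsum_mul_left, ENNReal.mul_iSup]

/-- Cauchy-Schwarz for the coefficients of a and b, then Parseval. -/
theorem diagSup_one_rankOne_le (a b : H) :
    diagSup 1 (InnerProductSpace.rankOne ℂ a b : H →L[ℂ] H) ≤ ‖a‖ₑ * ‖b‖ₑ := by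
  refine iSup₂_le fun w e => ?_
  rw [ENNReal.tsum_eq_iSup_sum]
  refine iSup_le fun s => ?_
  have h1 : ∀ x : H, (∑ i ∈ s, ‖inner ℂ (e i) x‖ₑ ^ (2 : ℝ)) ^ (1 / (2 : ℝ)) ≤ ‖x‖ₑ := by
    intro x
    rw [one_div, ENNReal.rpow_inv_le_iff (by norm_num)]
    refine (ENNReal.sum_le_tsum s).trans ?_
    have := tsum_enorm_inner_sq e x
    simp only [← ENNReal.rpow_natCast, Nat.cast_ofNat] at this
    exact this.le
  calc ∑ i ∈ s, ‖inner ℂ (e i) ((InnerProductSpace.rankOne ℂ a b : H →L[ℂ] H) (e i))‖ₑ ^ (1 : ℝ)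
      = ∑ i ∈ s, ‖inner ℂ (e i) a‖ₑ * ‖inner ℂ (e i) b‖ₑ := by
        refine Finset.sum_congr rfl fun i _ => ?_
        rw [ENNReal.rpow_one, InnerProductSpace.rankOne_apply, inner_smul_right, enorm_mul,
          mul_comm]
        congr 1
        rw [← ofReal_norm, ← ofReal_norm, norm_inner_symm]
    _ ≤ _ := ENNReal.inner_le_Lp_mul_Lq s _ _ Real.HolderConjugate.two_two
    _ ≤ _ := mul_le_mul' (h1 a) (h1 b)

/-! ### The Schatten metric and its completeness -/

section

namespace SASchatten

variable {p : ℝ}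

theorem isCompactOperator (hp : 1 ≤ p) (C : SASchatten H p) : IsCompactOperator C.1 :=
  isCompactOperator_of_schattenNorm (by linarith) C.2.1 C.2.2

theorem schattenNorm_sub (hp : 1 ≤ p) (C D : SASchatten H p) :
    schattenNorm p (C.1 - D.1) = diagSup p (C.1 - D.1) ^ (1 / p) :=
  schattenNorm_eq_diagSup hp (C.2.1.sub D.2.1)
    ((C.isCompactOperator hp).sub (D.isCompactOperator hp))

/-- The Schatten metric. -/
noncomputable abbrev pseudoEMetricSpace (hp : 1 ≤ p) : PseudoEMetricSpace (SASchatten H p) where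
  edist C D := schattenNorm p (C.1 - D.1)
  edist_self C := by
    have hp0 : 0 < p := by linarith
    change schattenNorm p (C.1 - C.1) = 0
    rw [schattenNorm_sub hp, sub_self, diagSup_zero hp0,
      ENNReal.zero_rpow_of_pos (by positivity)]
  edist_comm C D := by
    rw [schattenNorm_sub hp, schattenNorm_sub hp, ← diagSup_neg, neg_sub]
  edist_triangle C D E := by
    rw [schattenNorm_sub hp, schattenNorm_sub hp, schattenNorm_sub hp,
      ← sub_add_sub_cancel C.1 D.1 E.1]
    exact diagSup_add_le hp _ _

theorem toTopologicalSpace_eq (hp : 1 ≤ p) :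
    (pseudoEMetricSpace (H := H) hp).toUniformSpace.toTopologicalSpace = schattenTopology p := by
  let m := pseudoEMetricSpace (H := H) hp
  refine TopologicalSpace.ext ?_
  funext s
  refine propext ?_
  refine (EMetric.isOpen_iff (s := s)).trans ?_
  rfl

end SASchatten

theorem enorm_le_schattenNorm {p : ℝ} (hp : 1 ≤ p) {C : H →L[ℂ] H} (hC : IsSelfAdjoint C) :
    ‖C‖ₑ ≤ schattenNorm p C := by
  have hp0 : 0 < p := by linarith
  rw [schattenNorm, one_div, ENNReal.le_rpow_inv_iff hp0]
  exact (enorm_rpow_le_diagSup hp0 hC).trans (diagSup_le_posTrace hp hC)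

namespace SASchatten

variable {p : ℝ}

theorem continuous_val (hp : 1 ≤ p) :
    Continuous (fun C : SASchatten H p => (C.1 : H →L[ℂ] H)) := by
  rw [← toTopologicalSpace_eq hp]
  let m := pseudoEMetricSpace (H := H) hp
  have : LipschitzWith 1 (fun C : SASchatten H p => (C.1 : H →L[ℂ] H)) := by
    intro C D
    rw [edist_eq_enorm_sub, ENNReal.coe_one, one_mul]
    exact enorm_le_schattenNorm hp (C.2.1.sub D.2.1)
  exact this.continuous

theorem schattenNorm_add_le (hp : 1 ≤ p) {C D : H →L[ℂ] H} (hC : IsSelfAdjoint C)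
    (hC' : schattenNorm p C < ∞) (hD : IsSelfAdjoint D) (hD' : schattenNorm p D < ∞) :
    schattenNorm p (C + D) ≤ schattenNorm p C + schattenNorm p D := by
  have hp0 : 0 < p := by linarith
  have h1 := isCompactOperator_of_schattenNorm hp0 hC hC'
  have h2 := isCompactOperator_of_schattenNorm hp0 hD hD'
  rw [schattenNorm_eq_diagSup hp hC h1, schattenNorm_eq_diagSup hp hD h2,
    schattenNorm_eq_diagSup hp (hC.add hD) (h1.add h2)]
  exact diagSup_add_le hp _ _

/-- A Schatten-Cauchy sequence is Cauchy in operator norm, its limit is compact and self-adjoint,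
and lower semicontinuity of `diagSup` makes the convergence hold in the Schatten metric. Complete
metric spaces are Baire. -/
theorem baireSpace (hp : 1 ≤ p) : BaireSpace (SASchatten H p) := by
  have hp0 : 0 < p := by linarith
  rw [← toTopologicalSpace_eq hp]
  let m := pseudoEMetricSpace (H := H) hp
  have hcomp : CompleteSpace (SASchatten H p) := by
    have hB0 : ∀ n : ℕ, (0 : ℝ≥0∞) < ENNReal.ofReal ((1 / 2) ^ n) := fun n => by
      rw [ENNReal.ofReal_pos]; positivity
    refine EMetric.complete_of_convergent_controlled_sequences
      (fun n => ENNReal.ofReal ((1 / 2) ^ n)) hB0 fun u hu => ?_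
    have hcau : CauchySeq fun n => (u n).1 := by
      refine cauchySeq_of_le_tendsto_0 (fun n => (1 / 2 : ℝ) ^ n) (fun n k N hn hk => ?_)
        (tendsto_pow_atTop_nhds_zero_of_lt_one (by norm_num) (by norm_num))
      have h1 := (enorm_le_schattenNorm hp ((u n).2.1.sub (u k).2.1)).trans (hu N n k hn hk).le
      rw [← ofReal_norm, ENNReal.ofReal_le_ofReal_iff (by positivity)] at h1
      rwa [dist_eq_norm]
    obtain ⟨C, hC⟩ := cauchySeq_tendsto_of_complete hcau
    have hCc : IsCompactOperator C :=
      isCompactOperator_of_tendsto hC (Eventually.of_forall fun n => (u n).isCompactOperator hp)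
    have hCs : IsSelfAdjoint C := by
      have h1 : Tendsto (fun n => star (u n).1) atTop (𝓝 (star C)) := hC.star
      have h2 : (fun n => star (u n).1) = fun n => (u n).1 :=
        funext fun n => (u n).2.1.star_eq
      rw [h2] at h1
      exact tendsto_nhds_unique h1 hC
    have hle : ∀ n, diagSup p (C - (u n).1) ^ (1 / p) ≤ ENNReal.ofReal ((1 / 2) ^ n) := by
      intro n
      rw [one_div, ENNReal.rpow_inv_le_iff hp0]
      refine diagSup_le_of_tendsto (hC.sub_const (u n).1) ?_
      filter_upwards [eventually_ge_atTop n] with k hk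
      have h1 := (hu n k n hk le_rfl).le
      change schattenNorm p ((u k).1 - (u n).1) ≤ _ at h1
      rwa [schattenNorm_sub hp, one_div, ENNReal.rpow_inv_le_iff hp0] at h1
    have heq : ∀ n, schattenNorm p (C - (u n).1) ≤ ENNReal.ofReal ((1 / 2) ^ n) := fun n => by
      rw [schattenNorm_eq_diagSup hp (hCs.sub (u n).2.1)
        (hCc.sub ((u n).isCompactOperator hp))]
      exact hle n
    have hfin : schattenNorm p C < ∞ := by
      rw [← sub_add_cancel C (u 0).1]
      have h0 := (heq 0).trans_lt ENNReal.ofReal_lt_top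
      exact (schattenNorm_add_le hp (hCs.sub (u 0).2.1) h0 (u 0).2.1 (u 0).2.2).trans_lt
        (ENNReal.add_lt_top.2 ⟨h0, (u 0).2.2⟩)
    let C' : SASchatten H p := ⟨C, hCs, hfin⟩
    refine ⟨C', ?_⟩
    rw [tendsto_iff_edist_tendsto_0]
    have ht : Tendsto (fun n : ℕ => ENNReal.ofReal ((1 / 2) ^ n)) atTop (𝓝 0) := by
      have := ENNReal.tendsto_ofReal (tendsto_pow_atTop_nhds_zero_of_lt_one
        (r := (1 / 2 : ℝ)) (by norm_num) (by norm_num))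
      simpa using this
    refine tendsto_of_tendsto_of_tendsto_of_le_of_le tendsto_const_nhds ht
      (fun _ => zero_le) fun n => ?_
    rw [edist_comm]
    exact heq n
  have : (uniformity (SASchatten H p)).IsCountablyGenerated := inferInstance
  infer_instance

/-- The sum `C + F` with a self-adjoint `F` in the Schatten class. -/
noncomputable def addOp (hp : 1 ≤ p) (C : SASchatten H p) {F : H →L[ℂ] H} (hF : IsSelfAdjoint F)
    (hF' : schattenNorm p F < ∞) : SASchatten H p :=
  ⟨C.1 + F, C.2.1.add hF, (schattenNorm_add_le hp C.2.1 C.2.2 hF hF').trans_lt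
    (ENNReal.add_lt_top.2 ⟨C.2.2, hF'⟩)⟩

/-- A set is dense if near every `C` it has points `C + F` with `‖F‖_p` arbitrarily small. -/
theorem dense_of_forall_exists (hp : 1 ≤ p) {G : Set (SASchatten H p)}
    (h : ∀ C : SASchatten H p, ∀ ε : ℝ, 0 < ε → ∃ F : H →L[ℂ] H, ∃ hF : IsSelfAdjoint F,
      ∃ hF' : schattenNorm p F < ∞, schattenNorm p F < ENNReal.ofReal ε ∧
        C.addOp hp hF hF' ∈ G) : Dense G := by
  intro C
  rw [mem_closure_iff]
  intro U hU hCU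
  obtain ⟨ε, hε, hball⟩ := hU C hCU
  obtain ⟨ε', hε', hlt⟩ := ENNReal.lt_iff_exists_real_btwn.1 hε
  obtain ⟨F, hF, hF', hlt', hG⟩ := h C ε' (by
    rcases hε'.eq_or_lt with h0 | h0
    · rw [← h0] at hlt; simp at hlt
    · exact h0)
  refine ⟨_, hball _ ?_, hG⟩
  have : (C.addOp hp hF hF').1 - C.1 = F := add_sub_cancel_left _ _
  rw [this]
  exact hlt'.trans hlt.2

end SASchatten

/-- Finite-rank truncation in the trace norm. -/
theorem exists_sum_rankOne_approx {C : H →L[ℂ] H} (hC : IsSelfAdjoint C)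
    (h : schattenNorm 1 C < ∞) {ε : ℝ} (hε : 0 < ε) :
    ∃ (w : Set H) (s : Finset w) (f : w → H) (l : w → ℝ),
      diagSup 1 (C - ∑ i ∈ s, (l i : ℂ) • InnerProductSpace.rankOne ℂ (f i) (f i))
        ≤ ENNReal.ofReal ε := by
  classical
  have hc := isCompactOperator_of_schattenNorm one_pos hC h
  obtain ⟨w, f, l, hf⟩ := exists_hilbertBasis_eigenvectors hC hc
  have hfin := posTrace_ne_top one_pos h
  rw [posTrace_absPow_of_eigenbasis one_pos hC f hf] at hfin
  obtain ⟨s, hs⟩ := ((ENNReal.tendsto_tsum_compl_atTop_zero hfin).eventually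
    (eventually_le_nhds (ENNReal.ofReal_pos.2 hε))).exists
  refine ⟨w, s, f, l, ?_⟩
  set F : H →L[ℂ] H := ∑ i ∈ s, (l i : ℂ) • InnerProductSpace.rankOne ℂ (f i) (f i) with hF
  have hFs : IsSelfAdjoint F := by
    refine isSelfAdjoint_sum s fun i _ => ?_
    rw [IsSelfAdjoint, star_smul, ContinuousLinearMap.star_eq_adjoint,
      InnerProductSpace.adjoint_rankOne]
    simp
  -- The remainder is diagonal in the same basis with the entries in s deleted, so its trace norm is
  -- a tail of a convergent sum.
  have hFe : ∀ j, (C - F) (f j) = ((if j ∈ s then 0 else l j : ℝ) : ℂ) • f j := by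
    intro j
    rw [sub_apply, hf, hF, sum_apply]
    have : ∀ i ∈ s, ((l i : ℂ) • (InnerProductSpace.rankOne ℂ (f i) (f i) : H →L[ℂ] H)) (f j)
        = if i = j then (l j : ℂ) • f j else 0 := by
      intro i _
      rw [smul_apply, InnerProductSpace.rankOne_apply, orthonormal_iff_ite.1 f.orthonormal]
      split_ifs with hij
      · rw [hij, one_smul]
      · simp
    rw [Finset.sum_congr rfl this, Finset.sum_ite_eq']
    split_ifs <;> simp
  refine (diagSup_le_posTrace le_rfl (hC.sub hFs)).trans ?_
  rw [posTrace_absPow_of_eigenbasis one_pos (hC.sub hFs) f hFe]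
  refine le_trans (le_of_eq ?_) hs
  have h3 := tsum_subtype {x | x ∉ s} (fun j => ENNReal.ofReal (|l j| ^ (1 : ℝ)))
  refine Eq.trans ?_ h3.symm
  refine tsum_congr fun j => ?_
  by_cases hj : j ∈ s <;> simp [Set.indicator, hj]

end

/-! ### Finite-rank perturbations with prescribed eigenvectors -/

theorem norm_sum_inner_smul_le {ι : Type*} [Fintype ι] {v : ι → H} (hv : Orthonormal ℂ v) (x : H) :
    ‖∑ i, inner ℂ (v i) x • v i‖ ≤ ‖x‖ := by
  refine abs_le_of_sq_le_sq' ?_ (norm_nonneg x) |>.2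
  rw [norm_sum_sq_of_orthogonal]
  · refine le_trans (le_of_eq (Finset.sum_congr rfl fun i _ => ?_))
      (hv.sum_inner_products_le x (s := Finset.univ))
    rw [norm_smul, hv.1 i, mul_one]
  · intro i _ j _ hij
    rw [inner_smul_left, inner_smul_right, hv.2 hij]
    simp

/-- Given an orthonormal family `v` in the domain of `D` and reals `e`, with defects
`r i = (D - e i) v i`, there is a finite-rank perturbation of `D`, controlled by the defects,
with `v i` as eigenvectors. -/
theorem exists_perturb_eigenvectors {D : H →ₗ.[ℂ] H} (hD : IsSelfAdjoint D) {ι : Type*} [Fintype ι]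
    {v r : ι → H} {e : ι → ℝ} (hv : Orthonormal ℂ v)
    (hr : ∀ i, (v i, (e i : ℂ) • v i + r i) ∈ D.graph) :
    ∃ C : H →L[ℂ] H, IsSelfAdjoint C ∧ IsCompactOperator C ∧
      (∀ i, (v i, (e i : ℂ) • v i) ∈ (perturb D C).graph) ∧
      diagSup 1 C ≤ 3 * ∑ i, ‖r i‖ₑ ∧
      ∀ c : ℝ, 0 ≤ c → (∀ x, ‖∑ i, inner ℂ (v i) x • r i‖ ≤ c * ‖x‖) → ‖C‖ ≤ 3 * c := by
  classical
  set R : H →L[ℂ] H := ∑ i, InnerProductSpace.rankOne ℂ (r i) (v i) with hR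
  set P : H →L[ℂ] H := ∑ i, InnerProductSpace.rankOne ℂ (v i) (v i) with hP
  have hRx : ∀ x, R x = ∑ i, inner ℂ (v i) x • r i := fun x => by simp [hR, sum_apply]
  have hPx : ∀ x, P x = ∑ i, inner ℂ (v i) x • v i := fun x => by simp [hP, sum_apply]
  have hstar : star R = ∑ i, InnerProductSpace.rankOne ℂ (v i) (r i) := by
    rw [hR, star_sum]
    simp [ContinuousLinearMap.star_eq_adjoint]
  have hPR : P * R = ∑ i, InnerProductSpace.rankOne ℂ (P (r i)) (v i) := by
    ext x
    simp [hRx, sum_apply, mul_apply_eq_comp, map_sum]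
  have hPn : ∀ x, ‖P x‖ ≤ ‖x‖ := fun x => by rw [hPx]; exact norm_sum_inner_smul_le hv x
  -- Symmetry of D makes the matrix ⟨v i, r j⟩ Hermitian; the terms with e i and e j agree because v
  -- is orthonormal.
  have hrsym : ∀ i j, inner ℂ (v i) (r j) = inner ℂ (r i) (v j) := by
    intro i j
    have h1 := inner_graph_comm hD (hr i) (hr j)
    rw [inner_add_left, inner_add_right, inner_smul_left, inner_smul_right,
      Complex.conj_ofReal] at h1
    have h2 : (e i : ℂ) * inner ℂ (v i) (v j) = (e j : ℂ) * inner ℂ (v i) (v j) := by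
      rw [orthonormal_iff_ite.1 hv]
      split_ifs with hij
      · rw [hij]
      · simp
    rw [h2] at h1
    exact (add_left_cancel h1).symm
  have hsa : IsSelfAdjoint (P * R) := by
    rw [ContinuousLinearMap.isSelfAdjoint_iff_isSymmetric]
    intro x y
    change inner ℂ ((P * R) x) y = inner ℂ x ((P * R) y)
    simp only [mul_apply_eq_comp, hRx, map_sum, hPx, sum_inner, inner_sum, inner_smul_left,
      inner_smul_right, Finset.sum_mul]
    rw [Finset.sum_comm]
    refine Finset.sum_congr rfl fun i _ => Finset.sum_congr rfl fun j _ => ?_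
    rw [map_mul, inner_conj_symm, inner_conj_symm, hrsym i j]
    ring
  have hRv : ∀ j, R (v j) = r j := by
    intro j
    rw [hRx]
    simp [orthonormal_iff_ite.1 hv]
  have hcR : IsCompactOperator R := by
    rw [hR]
    exact isCompactOperator_sum _ fun i _ => isCompactOperator_rankOne _ _
  have hcR' : IsCompactOperator (star R : H →L[ℂ] H) := by
    rw [hstar]
    exact isCompactOperator_sum _ fun i _ => isCompactOperator_rankOne _ _
  have hb : ∀ a : ι → H, (∀ i, ‖a i‖ₑ ≤ ‖r i‖ₑ) →
      diagSup 1 (∑ i, InnerProductSpace.rankOne ℂ (a i) (v i) : H →L[ℂ] H) ≤ ∑ i, ‖r i‖ₑ := by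
    intro a ha
    refine (diagSup_one_sum_le _ _).trans (Finset.sum_le_sum fun i _ => ?_)
    refine (diagSup_one_rankOne_le _ _).trans ?_
    have : ‖v i‖ₑ = 1 := by rw [← ofReal_norm, hv.1 i]; simp
    rw [this, mul_one]
    exact ha i
  -- On v j the operator R gives r j, and P R v j = P r j = R* v j by the Hermitian symmetry, so the
  -- sum gives -r j as needed. The same symmetry makes P R self-adjoint.
  refine ⟨P * R - (R + star R), hsa.sub (IsSelfAdjoint.add_star_self R),
    (hcR.clm_comp P).sub (hcR.add hcR'), fun j => ?_, ?_, fun c hc hcx => ?_⟩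
  · rw [mem_graph_perturb]
    convert hr j using 2
    have h1 : P (r j) = (star R) (v j) := by
      rw [hPx, hstar]
      simp [sum_apply, hrsym]
    simp only [sub_apply, add_apply, mul_apply_eq_comp, hRv, h1]
    abel
  · rw [sub_eq_add_neg]
    refine (diagSup_one_add_le _ _).trans ?_
    rw [diagSup_neg]
    have e3 : 3 * ∑ i, ‖r i‖ₑ = ∑ i, ‖r i‖ₑ + (∑ i, ‖r i‖ₑ + ∑ i, ‖r i‖ₑ) := by ring
    rw [e3]
    gcongr
    · rw [hPR]
      refine hb _ fun i => ?_
      rw [← ofReal_norm, ← ofReal_norm]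
      exact ENNReal.ofReal_le_ofReal (hPn _)
    · refine (diagSup_one_add_le _ _).trans ?_
      gcongr
      · exact hb _ fun i => le_rfl
      · rw [hstar]
        refine (diagSup_one_sum_le _ _).trans (Finset.sum_le_sum fun i _ => ?_)
        refine (diagSup_one_rankOne_le _ _).trans ?_
        have : ‖v i‖ₑ = 1 := by rw [← ofReal_norm, hv.1 i]; simp
        rw [this, one_mul]
  · have hRc : ‖R‖ ≤ c := ContinuousLinearMap.opNorm_le_bound _ hc fun x => by
      rw [hRx]; exact hcx x
    have hP1 : ‖P‖ ≤ 1 := ContinuousLinearMap.opNorm_le_bound _ zero_le_one fun x => by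
      rw [one_mul]; exact hPn x
    calc ‖P * R - (R + star R)‖ ≤ ‖P * R‖ + (‖R‖ + ‖star R‖) :=
          (norm_sub_le _ _).trans (by gcongr; exact norm_add_le _ _)
      _ ≤ 1 * c + (c + c) := by
          have h1 : ‖P * R‖ ≤ 1 * c := (norm_mul_le _ _).trans (by gcongr)
          rw [norm_star]
          gcongr
      _ = 3 * c := by ring

/-- Write v = (D + i)⁻¹η. The eigenvalue equation says that (x - E) · `resFun` vanishes almost
everywhere for the spectral measure of η, and then so does (f - f(E)) · `resFun`. -/
theorem bcfc_apply_eigenvector {D : H →ₗ.[ℂ] H} (hD : IsSelfAdjoint D) {f : ℝ → ℂ} (hf : IsCb f)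
    {E : ℝ} {v : H} (hv : (v, (E : ℂ) • v) ∈ D.graph) : bcfc D f v = f E • v := by
  obtain ⟨η, h1, h2⟩ := exists_eq_bcfc_of_mem_graph hD hv
  have hr := isC0_resFun.isCb
  have hk : IsCb fun x : ℝ => (x : ℂ) * resFun x - (E : ℂ) * resFun x :=
    isCb_mul_resFun.sub (hr.const_mul _)
  have h3 : bcfc D (fun x : ℝ => (x : ℂ) * resFun x - (E : ℂ) * resFun x) η = 0 := by
    rw [bcfc_sub hD isCb_mul_resFun (hr.const_mul (E : ℂ)), sub_apply, bcfc_const_mul hD hr,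
      smul_apply, ← h2, ← h1, sub_self]
  have h4 := norm_bcfc_sq hD η hk
  rw [h3, norm_zero, zero_pow two_ne_zero, eq_comm, integral_eq_zero_iff_of_nonneg
    (fun x => by positivity) ((hk.mul hk.conj).integrable _ |>.norm.congr (by
      filter_upwards with x
      rw [norm_mul, RCLike.norm_conj, sq]))] at h4
  have h5 : bcfc D (fun x => (f x - f E) * resFun x) η = 0 := by
    have hg : IsCb fun x => (f x - f E) * resFun x := (hf.sub (isCb_const _)).mul hr
    rw [← norm_eq_zero, ← sq_eq_zero_iff, norm_bcfc_sq hD η hg]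
    refine integral_eq_zero_of_ae ?_
    filter_upwards [h4] with x hx
    simp only [Pi.zero_apply, sq_eq_zero_iff, norm_eq_zero, ← sub_mul, mul_eq_zero] at hx ⊢
    rcases hx with hx | hx
    · left
      rw [sub_eq_zero] at hx
      rw [Complex.ofReal_injective hx, sub_self]
    · exact Or.inr hx
  rw [bcfc_mul hD (hf.sub (isCb_const _)) hr, mul_apply_eq_comp, ← h1,
    bcfc_sub hD hf (isCb_const _), bcfc_const hD, sub_apply, sub_eq_zero] at h5
  simpa using h5

/-- On a finite-dimensional invariant subspace, `bcfc D f` is the identity as soon as `f = 1` on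
a suitable finite set. -/
theorem exists_finset_bcfc_eq_self {D : H →ₗ.[ℂ] H} (hD : IsSelfAdjoint D) {S : Submodule ℂ H}
    [FiniteDimensional ℂ S] (hS : ∀ s ∈ S, ∃ b ∈ S, (s, b) ∈ D.graph) :
    ∃ T : Finset ℝ, ∀ f : ℝ → ℝ, (IsC0 fun x => (f x : ℂ)) → (∀ x ∈ T, f x = 1) →
      ∀ s ∈ S, bcfc D (fun x => (f x : ℂ)) s = s := by
  classical
  choose! B hBS hB using hS
  let T : S →ₗ[ℂ] S :=
    { toFun := fun s => ⟨B s, hBS s s.2⟩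
      map_add' := fun s t => Subtype.ext (graph_snd_eq (hB _ (s + t).2)
        (graph_add (hB _ s.2) (hB _ t.2)))
      map_smul' := fun z s => Subtype.ext (graph_snd_eq (hB _ (z • s).2)
        (graph_smul z (hB _ s.2))) }
  have hT : T.IsSymmetric := fun s t => inner_graph_comm hD (hB _ s.2) (hB _ t.2)
  set n := Module.finrank ℂ S with hn
  set b := hT.eigenvectorBasis hn.symm with hb
  have hbe : ∀ i, ((b i : H), (hT.eigenvalues hn.symm i : ℂ) • (b i : H)) ∈ D.graph := by
    intro i
    have h1 := hT.apply_eigenvectorBasis hn.symm i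
    have h2 : B (b i : H) = (hT.eigenvalues hn.symm i : ℂ) • (b i : H) := congrArg Subtype.val h1
    rw [← h2]
    exact hB _ (b i).2
  refine ⟨Finset.univ.image (hT.eigenvalues hn.symm), fun f hf hf1 s hs => ?_⟩
  have hbf : ∀ i, bcfc D (fun x => (f x : ℂ)) (b i : H) = (b i : H) := by
    intro i
    rw [bcfc_apply_eigenvector hD hf.isCb (hbe i),
      hf1 _ (Finset.mem_image_of_mem _ (Finset.mem_univ i))]
    simp
  have h1 := b.sum_repr ⟨s, hs⟩
  have h2 : s = ∑ i, b.repr ⟨s, hs⟩ i • (b i : H) := by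
    have := congrArg Subtype.val h1
    simpa using this.symm
  rw [h2, map_sum]
  exact Finset.sum_congr rfl fun i _ => by rw [map_smul, hbf]

/-- Weyl-von Neumann step: cutting finitely many vectors `ξ i` spectrally into pieces located near
the points `x k`, one finds a small finite-rank perturbation of `D` that leaves the span of all
pieces invariant. -/
theorem exists_perturb_invariant {D : H →ₗ.[ℂ] H} (hD : IsSelfAdjoint D) {ι κ : Type*} [Fintype ι]
    [Fintype κ] (x : κ → ℝ) {h : ℝ} (hh : 0 ≤ h) (g : κ → ℝ → ℝ) (hg : ∀ k, Continuous (g k))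
    (hgs : ∀ k, HasCompactSupport (g k)) (hloc : ∀ k y, g k y ≠ 0 → |y - x k| ≤ h)
    (hdisj : ∀ k l, k ≠ l → ∀ y, g k y = 0 ∨ g l y = 0) (ξ : ι → H) :
    ∃ (C : H →L[ℂ] H) (S : Submodule ℂ H), IsSelfAdjoint C ∧ IsCompactOperator C ∧
      FiniteDimensional ℂ S ∧ (∀ s ∈ S, ∃ b ∈ S, (s, b) ∈ (perturb D C).graph) ∧
      (∀ k i, bcfc D (fun y => (g k y : ℂ)) (ξ i) ∈ S) ∧
      diagSup 1 C ≤ ENNReal.ofReal (3 * Fintype.card ι * (Fintype.card κ * h)) ∧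
      ‖C‖ ≤ 3 * h := by
  classical
  have hgc : ∀ k, Continuous fun y => (g k y : ℂ) := fun k =>
    Complex.continuous_ofReal.comp (hg k)
  have hgcs : ∀ k, HasCompactSupport fun y => (g k y : ℂ) := fun k =>
    (hgs k).comp_left (g := fun x : ℝ => (x : ℂ)) Complex.ofReal_zero
  have hgb : ∀ k, IsCb fun y => (g k y : ℂ) := fun k =>
    (isC0_of_hasCompactSupport (hgc k) (hgcs k)).isCb
  have hgx : ∀ k, IsCb fun y => ((y : ℂ) - x k) * (g k y : ℂ) := fun k =>
    isCb_mul_of_hasCompactSupport (hgc k) (hgcs k) (by fun_prop)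
  have hgy : ∀ k, IsCb fun y => (y : ℂ) * (g k y : ℂ) := fun k =>
    isCb_mul_of_hasCompactSupport (hgc k) (hgcs k) (by fun_prop)
  -- V k is spanned by the pieces near x k. Different V k are orthogonal as the functions g k have
  -- disjoint supports, and on V k the operator D differs from x k by at most h.
  set V : κ → Submodule ℂ H := fun k =>
    Submodule.span ℂ (Set.range fun i => bcfc D (fun y => (g k y : ℂ)) (ξ i)) with hV
  have hVfd : ∀ k, FiniteDimensional ℂ (V k) := fun k =>
    FiniteDimensional.span_of_finite ℂ (Set.finite_range _)
  have hVη : ∀ k, ∀ u ∈ V k, ∃ η, u = bcfc D (fun y => (g k y : ℂ)) η := by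
    intro k u hu
    have hle : V k ≤ LinearMap.range (bcfc D (fun y => (g k y : ℂ)) : H →ₗ[ℂ] H) := by
      rw [hV, Submodule.span_le]
      rintro _ ⟨i, rfl⟩
      exact ⟨ξ i, rfl⟩
    obtain ⟨η, hη⟩ := hle hu
    exact ⟨η, hη.symm⟩
  have hVρ : ∀ k, ∀ u ∈ V k, ∃ η, (u, (x k : ℂ) • u
      + bcfc D (fun y => ((y : ℂ) - x k) * (g k y : ℂ)) η) ∈ D.graph ∧
      ‖bcfc D (fun y => ((y : ℂ) - x k) * (g k y : ℂ)) η‖ ≤ h * ‖u‖ := by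
    intro k u hu
    obtain ⟨η, rfl⟩ := hVη k u hu
    refine ⟨η, bcfc_sub_const_mul_mem_graph hD (hgb k) (hgy k) η (x k),
      norm_bcfc_le_of_le hD (hgx k) (hgb k) hh (fun y => ?_) η⟩
    rw [norm_mul]
    rcases eq_or_ne (g k y) 0 with h0 | h0
    · simp [h0]
    · gcongr
      rw [← Complex.ofReal_sub, Complex.norm_real]
      exact hloc k y h0
  have hof : OrthogonalFamily ℂ (fun k => V k) fun k => (V k).subtypeₗᵢ := by
    refine OrthogonalFamily.of_pairwise fun k l hkl => ?_
    change V k ⟂ V l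
    rw [Submodule.isOrtho_iff_inner_eq]
    intro u hu w hw
    obtain ⟨η, rfl⟩ := hVη k u hu
    obtain ⟨ζ, rfl⟩ := hVη l w hw
    exact inner_bcfc_eq_zero hD (hgb k) (hgb l)
      (fun y => (hdisj k l hkl y).imp (fun h => by simp [h]) fun h => by simp [h]) η ζ
  set b := fun k => stdOrthonormalBasis ℂ (V k) with hb
  have hv := hof.orthonormal_sigma_orthonormal (fun k => (b k).orthonormal)
  set v : (Σ k, Fin (Module.finrank ℂ (V k))) → H := fun a => (b a.1 a.2 : H) with hvdef
  have hv' : Orthonormal ℂ v := hv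
  choose η hη hηn using fun a : Σ k, Fin (Module.finrank ℂ (V k)) =>
    hVρ a.1 (v a) (b a.1 a.2).2
  set r := fun a : Σ k, Fin (Module.finrank ℂ (V k)) =>
    bcfc D (fun y => ((y : ℂ) - x a.1) * (g a.1 y : ℂ)) (η a) with hr
  obtain ⟨C, hCs, hCc, hCe, hCd, hCn⟩ := exists_perturb_eigenvectors hD
    (e := fun a => x a.1) hv' hη
  have hrn : ∀ a, ‖r a‖ ≤ h := fun a => by
    have h1 : ‖v a‖ = 1 := hv'.1 a
    have := hηn a
    rwa [h1, mul_one] at this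
  refine ⟨C, Submodule.span ℂ (Set.range v), hCs, hCc,
    FiniteDimensional.span_of_finite ℂ (Set.finite_range _), ?_, ?_, ?_, hCn h hh fun z => ?_⟩
  · intro s hs
    obtain ⟨c, rfl⟩ := (Submodule.mem_span_range_iff_exists_fun ℂ).1 hs
    refine ⟨∑ a, c a • (x a.1 : ℂ) • v a, Submodule.sum_mem _ fun a _ =>
      Submodule.smul_mem _ _ (Submodule.smul_mem _ _ (Submodule.subset_span ⟨a, rfl⟩)),
      graph_sum _ fun a _ => graph_smul _ (hCe a)⟩
  · intro k i
    have hm : bcfc D (fun y => (g k y : ℂ)) (ξ i) ∈ V k := Submodule.subset_span ⟨i, rfl⟩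
    have h1 := congrArg Subtype.val ((b k).sum_repr ⟨_, hm⟩)
    simp only [Submodule.coe_sum, Submodule.coe_smul] at h1
    rw [← h1]
    exact Submodule.sum_mem _ fun j _ => Submodule.smul_mem _ _
      (Submodule.subset_span ⟨⟨k, j⟩, rfl⟩)
  · refine hCd.trans ?_
    have h1 : ∑ a, ‖r a‖ₑ ≤ ENNReal.ofReal (Fintype.card ι * (Fintype.card κ * h)) := by
      calc ∑ a, ‖r a‖ₑ ≤ ∑ _a : Σ k, Fin (Module.finrank ℂ (V k)), ENNReal.ofReal h :=
            Finset.sum_le_sum fun a _ => by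
              rw [← ofReal_norm]; exact ENNReal.ofReal_le_ofReal (hrn a)
        _ = ∑ k : κ, ∑ _j : Fin (Module.finrank ℂ (V k)), ENNReal.ofReal h :=
            Fintype.sum_sigma _
        _ ≤ ∑ _k : κ, (Fintype.card ι : ℝ≥0∞) * ENNReal.ofReal h := by
            refine Finset.sum_le_sum fun k _ => ?_
            rw [Finset.sum_const, Finset.card_univ, Fintype.card_fin, nsmul_eq_mul]
            gcongr
            exact finrank_range_le_card _
        _ = ENNReal.ofReal (Fintype.card ι * (Fintype.card κ * h)) := by
            rw [Finset.sum_const, Finset.card_univ, nsmul_eq_mul,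
              ENNReal.ofReal_mul (by positivity), ENNReal.ofReal_mul (by positivity),
              ENNReal.ofReal_natCast, ENNReal.ofReal_natCast]
            ring
    calc 3 * ∑ a, ‖r a‖ₑ ≤ 3 * ENNReal.ofReal (Fintype.card ι * (Fintype.card κ * h)) := by gcongr
      _ = _ := by
        rw [mul_assoc, ENNReal.ofReal_mul (p := 3) (by norm_num)]
        simp
  -- The defects belonging to different k are mutually orthogonal, so the operator norm stays of
  -- order h however many pieces there are; only the trace norm grows with their number.
  · set u : κ → H := fun k => ∑ j, inner ℂ (v ⟨k, j⟩) z • v ⟨k, j⟩ with hu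
    have huV : ∀ k, u k ∈ V k := fun k => Submodule.sum_mem _ fun j _ =>
      Submodule.smul_mem _ _ (b k j).2
    choose ζ hζ hζn using fun k => hVρ k (u k) (huV k)
    set ρ : κ → H := fun k => bcfc D (fun y => ((y : ℂ) - x k) * (g k y : ℂ)) (ζ k) with hρ
    have hsum : ∀ k, ∑ j, inner ℂ (v ⟨k, j⟩) z • r ⟨k, j⟩ = ρ k := by
      intro k
      have h1 : (u k, ∑ j, inner ℂ (v ⟨k, j⟩) z • ((x k : ℂ) • v ⟨k, j⟩ + r ⟨k, j⟩)) ∈ D.graph :=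
        graph_sum _ fun j _ => graph_smul _ (hη ⟨k, j⟩)
      have h2 := graph_snd_eq h1 (hζ k)
      simp only [smul_add, Finset.sum_add_distrib] at h2
      have h3 : (x k : ℂ) • u k = ∑ j, inner ℂ (v ⟨k, j⟩) z • (x k : ℂ) • v ⟨k, j⟩ := by
        rw [hu, Finset.smul_sum]
        exact Finset.sum_congr rfl fun j _ => smul_comm _ _ _
      rw [h3] at h2
      exact add_left_cancel h2
    refine (congrArg norm ((Fintype.sum_sigma _).trans
      (Finset.sum_congr rfl fun k _ => hsum k))).trans_le ?_
    have hρo : ∀ k ∈ Finset.univ, ∀ l ∈ Finset.univ, k ≠ l → inner ℂ (ρ k) (ρ l) = 0 :=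
      fun k _ l _ hkl => inner_bcfc_eq_zero hD (hgx k) (hgx l)
        (fun y => (hdisj k l hkl y).imp (fun h => by simp [h]) fun h => by simp [h]) _ _
    have huo : ∀ k ∈ Finset.univ, ∀ l ∈ Finset.univ, k ≠ l → inner ℂ (u k) (u l) = 0 :=
      fun k _ l _ hkl => hof hkl ⟨u k, huV k⟩ ⟨u l, huV l⟩
    have h4 : ‖∑ k, u k‖ ≤ ‖z‖ := by
      have := norm_sum_inner_smul_le hv' z
      rwa [Fintype.sum_sigma] at this
    refine le_trans (abs_le_of_sq_le_sq' ?_ (by positivity)).2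
      (mul_le_mul_of_nonneg_left h4 hh)
    rw [norm_sum_sq_of_orthogonal _ _ hρo, mul_pow, norm_sum_sq_of_orthogonal _ _ huo,
      Finset.mul_sum]
    refine Finset.sum_le_sum fun k _ => ?_
    rw [← mul_pow]
    exact pow_le_pow_left₀ (norm_nonneg _) (hζn k) 2

/-! ### Grids of bump functions -/

/-- A compact set, up to small measure, is covered by finitely many bumps of disjoint supports,
each living near one of the points `k * h`, whose number is controlled by the length of a
neighbourhood of the set. -/
theorem exists_grid_bumps (μ : Measure ℝ) [IsFiniteMeasure μ] {L : Set ℝ} (hL : IsCompact L)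
    {h : ℝ} (hh : 0 < h) {η : ℝ≥0∞} (hη : 0 < η) :
    ∃ (J : Finset ℤ) (g : J → ℝ → ℝ), ENNReal.ofReal (J.card * h) ≤ volume (Metric.cthickening h L) ∧
      (∀ k, Continuous (g k)) ∧ (∀ k, HasCompactSupport (g k)) ∧ (∀ k y, 0 ≤ g k y) ∧
      (∀ y, ∑ k, g k y ≤ 1) ∧ (∀ (k : J) y, g k y ≠ 0 → |y - (k.1 : ℝ) * h| ≤ 2 * h) ∧
      (∀ k l, k ≠ l → ∀ y, g k y = 0 ∨ g l y = 0) ∧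
      μ {y | ∑ k, g k y ≠ 1} ≤ μ Lᶜ + η := by
  classical
  set I : ℤ → Set ℝ := fun k => Set.Ico (k * h) (k * h + h) with hI
  have hImem : ∀ y, y ∈ I ⌊y / h⌋ := by
    intro y
    have h1 := Int.floor_le (y / h)
    have h2 := Int.lt_floor_add_one (y / h)
    rw [le_div_iff₀ hh] at h1
    rw [div_lt_iff₀ hh] at h2
    exact ⟨h1, by linarith⟩
  have hIfl : ∀ k y, y ∈ I k → ⌊y / h⌋ = k := by
    intro k y hy
    rw [Int.floor_eq_iff]
    constructor
    · rw [le_div_iff₀ hh]; exact hy.1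
    · rw [div_lt_iff₀ hh]; have := hy.2; linarith
  have hIdisj : ∀ k l, k ≠ l → Disjoint (I k) (I l) := fun k l hkl =>
    Set.disjoint_left.2 fun y hy hy' => hkl ((hIfl k y hy).symm.trans (hIfl l y hy'))
  obtain ⟨M, hM⟩ := hL.isBounded.exists_norm_le
  set J : Finset ℤ := (Finset.Icc ⌊-M / h⌋ ⌊M / h⌋).filter fun k => (I k ∩ L).Nonempty with hJ
  have hJmem : ∀ y ∈ L, ⌊y / h⌋ ∈ J := by
    intro y hy
    have h1 := abs_le.1 (hM y hy)
    rw [hJ, Finset.mem_filter, Finset.mem_Icc]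
    refine ⟨⟨Int.floor_mono ?_, Int.floor_mono ?_⟩, y, hImem y, hy⟩
    · exact div_le_div_of_nonneg_right h1.1 hh.le
    · exact div_le_div_of_nonneg_right h1.2 hh.le
  have hcard : ENNReal.ofReal (J.card * h) ≤ volume (Metric.cthickening h L) := by
    -- Cells that meet L have length h, so they lie in its closed h-neighbourhood; being disjoint,
    -- they are counted by its volume.
    have hsub : (⋃ k ∈ J, I k) ⊆ Metric.cthickening h L := by
      refine Set.iUnion₂_subset fun k hk y hy => ?_
      obtain ⟨z, hz, hzL⟩ := (Finset.mem_filter.1 hk).2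
      refine Metric.mem_cthickening_of_dist_le y z h L hzL ?_
      rw [Real.dist_eq, abs_le]
      have h1 := hy.1; have h2 := hy.2; have h3 := hz.1; have h4 := hz.2
      constructor <;> linarith
    refine le_trans (le_of_eq ?_) (measure_mono hsub)
    rw [measure_biUnion_finset (fun k _ l _ hkl => hIdisj k l hkl) fun k _ => measurableSet_Ico]
    simp only [hI, Real.volume_Ico, add_sub_cancel_left, Finset.sum_const, nsmul_eq_mul]
    rw [ENNReal.ofReal_mul (by positivity), ENNReal.ofReal_natCast]
  -- The error η is shared among the cells, with + 1 to avoid dividing by zero. In each cell a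
  -- compact K k carries μ up to its share, and disjoint compact sets have disjoint neighbourhoods.
  have hη' : η / (J.card + 1) ≠ 0 :=
    (ENNReal.div_pos hη.ne' (ENNReal.add_ne_top.2 ⟨ENNReal.natCast_ne_top _, ENNReal.one_ne_top⟩)).ne'
  choose K hKI hKc hKμ using fun k : ℤ =>
    (measurableSet_Ico.inter hL.measurableSet : MeasurableSet (I k ∩ L)).exists_isCompact_sdiff_lt
      (measure_ne_top μ _) hη'
  have hδ : ∀ kl : ℤ × ℤ, ∃ δ > 0, kl.1 ≠ kl.2 →
      Disjoint (Metric.thickening δ (K kl.1)) (Metric.thickening δ (K kl.2)) := by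
    intro kl
    by_cases hkl : kl.1 = kl.2
    · exact ⟨1, one_pos, fun h => absurd hkl h⟩
    · have hd : Disjoint (K kl.1) (K kl.2) :=
        (hIdisj _ _ hkl).mono ((hKI _).trans Set.inter_subset_left)
          ((hKI _).trans Set.inter_subset_left)
      obtain ⟨δ, hδ, hδ'⟩ := hd.exists_thickenings (hKc _) (hKc _).isClosed
      exact ⟨δ, hδ, fun _ => hδ'⟩
  choose δ' hδ' hδd using hδ
  obtain ⟨δ₁, hδ₁, hδ₁'⟩ := exists_pos_le_of_finset (J ×ˢ J) (f := δ') fun kl _ => hδ' kl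
  -- The bound by h keeps each bump within h of its cell, hence within 2h of k h.
  set δ := min δ₁ h with hδdef
  have hδ0 : 0 < δ := lt_min hδ₁ hh
  set g : J → ℝ → ℝ := fun k y => (thickenedIndicator hδ0 (K k) y : ℝ) with hg
  have hgsupp : ∀ k y, g k y ≠ 0 → y ∈ Metric.thickening δ (K k) := by
    intro k y hy
    by_contra hy'
    exact hy (by rw [hg]; simp [thickenedIndicator_zero hδ0 _ hy'])
  have hgloc : ∀ (k : J) y, g k y ≠ 0 → |y - (k.1 : ℝ) * h| ≤ 2 * h := by
    intro k y hy
    obtain ⟨z, hz, hyz⟩ := Metric.mem_thickening_iff.1 (hgsupp k y hy)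
    have h1 := (hKI k hz).1
    have h2 : |y - z| < h := by
      rw [← Real.dist_eq]; exact hyz.trans_le (min_le_right _ _)
    have h3 := abs_lt.1 h2
    have h4 := h1.1; have h5 := h1.2
    rw [abs_le]
    constructor <;> linarith
  have hgd : ∀ k l, k ≠ l → ∀ y, g k y = 0 ∨ g l y = 0 := by
    intro k l hkl y
    by_contra! hcon
    have hne : (k : ℤ) ≠ l := fun h => hkl (Subtype.ext h)
    have hle : δ ≤ δ' (k, l) := (min_le_left _ _).trans
      (hδ₁' (k, l) (Finset.mem_product.2 ⟨k.2, l.2⟩))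
    exact Set.disjoint_left.1 (hδd (k, l) hne)
      (Metric.thickening_mono hle _ (hgsupp k y hcon.1))
      (Metric.thickening_mono hle _ (hgsupp l y hcon.2))
  have hg1 : ∀ k y, g k y ≤ 1 := fun k y => by
    have := thickenedIndicator_le_one hδ0 (K k) y
    exact_mod_cast this
  have hsingle : ∀ k y, g k y ≠ 0 → ∑ l, g l y = g k y := by
    intro k y hy
    refine Finset.sum_eq_single k (fun l _ hl => ?_) fun h => absurd (Finset.mem_univ k) h
    exact (hgd l k hl y).resolve_right hy
  refine ⟨J, g, hcard, fun k => ?_, fun k => ?_, fun k y => NNReal.coe_nonneg _, fun y => ?_, hgloc,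
    hgd, ?_⟩
  · exact NNReal.continuous_coe.comp (thickenedIndicator hδ0 (K k)).continuous
  · refine HasCompactSupport.intro (isCompact_closedBall ((k.1 : ℝ) * h) (2 * h)) fun y hy => ?_
    by_contra h0
    exact hy (by rw [Metric.mem_closedBall, Real.dist_eq]; exact hgloc k y h0)
  · by_cases hy : ∃ k, g k y ≠ 0
    · obtain ⟨k, hk⟩ := hy
      rw [hsingle k y hk]
      exact hg1 k y
    · push Not at hy
      simp [hy]
  · have hsub : {y | ∑ k, g k y ≠ 1} ⊆ Lᶜ ∪ ⋃ k ∈ J, (I k ∩ L) \ K k := by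
      intro y hy
      by_cases hyL : y ∈ L
      · right
        refine Set.mem_iUnion₂.2 ⟨⌊y / h⌋, hJmem y hyL, ⟨hImem y, hyL⟩, fun hyK => hy ?_⟩
        have h1 : g ⟨_, hJmem y hyL⟩ y = 1 := by
          rw [hg]; simp [thickenedIndicator_one hδ0 _ hyK]
        rw [hsingle ⟨_, hJmem y hyL⟩ y (by rw [h1]; exact one_ne_zero), h1]
      · exact Or.inl hyL
    refine (measure_mono hsub).trans ((measure_union_le _ _).trans ?_)
    gcongr
    refine (measure_biUnion_finset_le _ _).trans ?_
    calc ∑ k ∈ J, μ ((I k ∩ L) \ K k) ≤ ∑ _k ∈ J, η / (J.card + 1) :=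
          Finset.sum_le_sum fun k _ => (hKμ k).le
      _ = J.card * (η / (J.card + 1)) := by rw [Finset.sum_const, nsmul_eq_mul]
      _ ≤ (J.card + 1) * (η / (J.card + 1)) := by gcongr; exact le_self_add
      _ ≤ η := ENNReal.mul_div_le

/-! ### Small bumps and invariant subspaces -/

theorem exists_isSmallBump_eq_one (T : Finset ℝ) {ε : ℝ} (hε : 0 < ε) :
    ∃ f, IsSmallBump f ε ∧ ∀ x ∈ T, f x = 1 := by
  have hTc : IsCompact (T : Set ℝ) := T.finite_toSet.isCompact
  have h0 : volume (T : Set ℝ) = 0 := T.finite_toSet.measure_zero _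
  have ht := tendsto_measure_cthickening_of_isCompact (μ := (volume : Measure ℝ)) hTc
  rw [h0] at ht
  have h1 : ∀ᶠ r in 𝓝[>] (0 : ℝ), volume (Metric.cthickening r (T : Set ℝ)) < ENNReal.ofReal ε :=
    (ht.mono_left nhdsWithin_le_nhds).eventually_lt_const (ENNReal.ofReal_pos.2 hε)
  obtain ⟨δ, hδv, hδ⟩ := (h1.and self_mem_nhdsWithin).exists
  have hδ0 : 0 < δ := hδ
  set f : ℝ → ℝ := fun y => (thickenedIndicator hδ0 (T : Set ℝ) y : ℝ) with hf
  have hfs : ∀ y, y ∉ Metric.cthickening δ (T : Set ℝ) → f y = 0 := fun y hy => by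
    rw [hf]
    simp [thickenedIndicator_zero hδ0 _ fun h => hy (Metric.thickening_subset_cthickening _ _ h)]
  have hf1 : ∀ y, f y ≤ 1 := fun y => by
    have := thickenedIndicator_le_one hδ0 (T : Set ℝ) y
    exact_mod_cast this
  have hf0 : ∀ y, 0 ≤ f y := fun y => NNReal.coe_nonneg _
  have hcont : Continuous f :=
    NNReal.continuous_coe.comp (thickenedIndicator hδ0 (T : Set ℝ)).continuous
  have hcs : HasCompactSupport f := HasCompactSupport.intro (hTc.cthickening) hfs
  refine ⟨f, ⟨hcont, hcs, hf0, hf1, ?_⟩, fun x hx => ?_⟩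
  · have hm : MeasurableSet (Metric.cthickening δ (T : Set ℝ)) :=
      Metric.isClosed_cthickening.measurableSet
    have hlt : volume (Metric.cthickening δ (T : Set ℝ)) < ∞ := hδv.trans ENNReal.ofReal_lt_top
    calc ∫ x, f x ≤ ∫ x, (Metric.cthickening δ (T : Set ℝ)).indicator (fun _ => (1 : ℝ)) x := by
          refine integral_mono (hcont.integrable_of_hasCompactSupport hcs)
            ((integrable_indicator_iff hm).2 (integrableOn_const hlt.ne)) fun y => ?_
          by_cases hy : y ∈ Metric.cthickening δ (T : Set ℝ)
          · simpa [hy] using hf1 y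
          · simp [hy, hfs y hy]
      _ = volume.real (Metric.cthickening δ (T : Set ℝ)) := integral_indicator_one hm
      _ < ε := (ENNReal.toReal_lt_of_lt_ofReal hδv)
  · rw [hf]; simp [thickenedIndicator_one hδ0 _ (Finset.mem_coe.2 hx)]

/-- D has finitely many eigenvalues on S, and a finite set carries a bump of small integral equal to
1 on it. Such a bump fixes φ, so only ψ - φ contributes an error. -/
theorem exists_isSmallBump_inner_ge {D : H →ₗ.[ℂ] H} (hD : IsSelfAdjoint D) {S : Submodule ℂ H}
    [FiniteDimensional ℂ S] (hS : ∀ s ∈ S, ∃ b ∈ S, (s, b) ∈ D.graph) {ψ φ : H} (hφ : φ ∈ S)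
    {η ε : ℝ} (hη : ‖ψ - φ‖ ≤ η) (hε : 0 < ε) :
    ∃ f, IsSmallBump f ε ∧
      ‖ψ‖ ^ 2 - 2 * ‖ψ‖ * η ≤ (inner ℂ ψ (bcfc D (fun x => (f x : ℂ)) ψ)).re := by
  obtain ⟨T, hT⟩ := exists_finset_bcfc_eq_self hD hS
  obtain ⟨f, hf, hf1⟩ := exists_isSmallBump_eq_one T hε
  refine ⟨f, hf, ?_⟩
  have h1 : bcfc D (fun x => (f x : ℂ)) ψ
      = ψ - ((ψ - φ) - bcfc D (fun x => (f x : ℂ)) (ψ - φ)) := by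
    rw [map_sub, hT f hf.isC0 hf1 φ hφ]
    abel
  have h2 : ‖bcfc D (fun x => (f x : ℂ)) (ψ - φ)‖ ≤ ‖ψ - φ‖ := by
    simpa using norm_bcfc_apply_le hD hf.isC0.cont hf.norm_le (ψ - φ)
  have h3 : (inner ℂ ψ ψ).re = ‖ψ‖ ^ 2 := inner_self_eq_norm_sq (𝕜 := ℂ) ψ
  rw [h1, inner_sub_right, Complex.sub_re, h3]
  have h4 : (inner ℂ ψ ((ψ - φ) - bcfc D (fun x => (f x : ℂ)) (ψ - φ))).re
      ≤ ‖ψ‖ * (η + η) := by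
    refine (Complex.re_le_norm _).trans ((norm_inner_le_norm _ _).trans ?_)
    gcongr
    exact (norm_sub_le _ _).trans (add_le_add hη (h2.trans hη))
  linarith

/-- Weyl-von Neumann: a perturbation of `D` leaving invariant a finite-dimensional subspace near
the vectors `ξ i`, with trace norm controlled by the size of a compact set carrying most of the
spectral measures, and operator norm as small as we please. -/
theorem exists_perturb_invariant_near {D : H →ₗ.[ℂ] H} (hD : IsSelfAdjoint D) {ι : Type*}
    [Fintype ι] (ξ : ι → H) {L : Set ℝ} (hL : IsCompact L) {η h : ℝ} (hη : 0 < η) (hh : 0 < h)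
    (hμ : (∑ i, specMeasure hD (ξ i)) Lᶜ < ENNReal.ofReal (η ^ 2)) :
    ∃ (C : H →L[ℂ] H) (S : Submodule ℂ H), IsSelfAdjoint C ∧ IsCompactOperator C ∧
      FiniteDimensional ℂ S ∧ (∀ s ∈ S, ∃ b ∈ S, (s, b) ∈ (perturb D C).graph) ∧
      (∀ i, ∃ φ ∈ S, ‖ξ i - φ‖ ≤ η) ∧
      diagSup 1 C ≤ (6 * Fintype.card ι : ℕ) * volume (Metric.cthickening h L) ∧
      ‖C‖ ≤ 6 * h := by
  classical
  have hfin : IsFiniteMeasure (∑ i, specMeasure hD (ξ i)) := inferInstance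
  -- The slack η² - μ(Lᶜ) is the error allowed to the grid, so the bumps sum to 1 off a set of
  -- measure at most η².
  obtain ⟨J, g, hcard, hgc, hgs, hg0, hg1, hgl, hgd, hgμ⟩ :=
    exists_grid_bumps (∑ i, specMeasure hD (ξ i)) hL hh (tsub_pos_of_lt hμ)
  rw [add_tsub_cancel_of_le hμ.le] at hgμ
  -- Bumps reach to distance 2h from their grid points; this doubles the constant 3 to 6.
  obtain ⟨C, S, hCs, hCc, hS, hSinv, hSm, hCd, hCn⟩ := exists_perturb_invariant hD
    (fun k : J => (k.1 : ℝ) * h) (by positivity : 0 ≤ 2 * h) g hgc hgs hgl hgd ξ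
  refine ⟨C, S, hCs, hCc, hS, hSinv, fun i => ?_, ?_, by linarith⟩
  · refine ⟨∑ k, bcfc D (fun y => (g k y : ℂ)) (ξ i), Submodule.sum_mem _ fun k _ => hSm k i, ?_⟩
    have hgb : ∀ k ∈ Finset.univ, IsCb fun y => (g k y : ℂ) := fun k _ =>
      (isC0_of_hasCompactSupport (Complex.continuous_ofReal.comp (hgc k))
        ((hgs k).comp_left (g := fun x : ℝ => (x : ℂ)) Complex.ofReal_zero)).isCb
    have hsb : IsCb fun y => ∑ k, (g k y : ℂ) := IsCb.sum _ hgb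
    have h1 : ξ i - ∑ k, bcfc D (fun y => (g k y : ℂ)) (ξ i)
        = bcfc D (fun y => 1 - ∑ k, (g k y : ℂ)) (ξ i) := by
      rw [bcfc_sub hD (isCb_const 1) hsb, bcfc_one hD, bcfc_sum hD _ hgb, sub_apply, sum_apply]
      rfl
    rw [h1]
    refine (abs_le_of_sq_le_sq' ?_ hη.le).2
    have hm : MeasurableSet {y | ∑ k, g k y ≠ 1} :=
      (isOpen_ne_fun (continuous_finsetSum _ fun k _ => hgc k) continuous_const).measurableSet
    rw [norm_bcfc_sq hD _ ((isCb_const 1).sub hsb)]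
    calc ∫ y, ‖1 - ∑ k, (g k y : ℂ)‖ ^ 2 ∂specMeasure hD (ξ i)
        ≤ ∫ y, {y | ∑ k, g k y ≠ 1}.indicator (fun _ => (1 : ℝ)) y ∂specMeasure hD (ξ i) := by
          refine integral_mono_of_nonneg (Eventually.of_forall fun y => by positivity)
            ((integrable_indicator_iff hm).2 (integrableOn_const (measure_ne_top _ _)))
            (Eventually.of_forall fun y => ?_)
          have e1 : (1 : ℂ) - ∑ k, (g k y : ℂ) = ((1 - ∑ k, g k y : ℝ) : ℂ) := by push_cast; rfl
          have e2 : 0 ≤ ∑ k, g k y := Finset.sum_nonneg fun k _ => hg0 k y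
          simp only [e1, Complex.norm_real, Real.norm_eq_abs, sq_abs]
          by_cases hy : ∑ k, g k y = 1
          · rw [hy, sub_self, zero_pow two_ne_zero]
            exact Set.indicator_nonneg (fun _ _ => zero_le_one) _
          · rw [Set.indicator_of_mem (by exact hy)]
            have := hg1 y
            nlinarith
      _ = (specMeasure hD (ξ i)).real {y | ∑ k, g k y ≠ 1} := integral_indicator_one hm
      _ ≤ η ^ 2 := by
          refine ENNReal.toReal_le_of_le_ofReal (by positivity) (le_trans ?_ hgμ)
          rw [Measure.coe_finsetSum, Finset.sum_apply]
          exact Finset.single_le_sum (f := fun i => specMeasure hD (ξ i) {y | ∑ k, g k y ≠ 1})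
            (fun _ _ => zero_le) (Finset.mem_univ i)
  · refine hCd.trans ?_
    rw [Fintype.card_coe]
    calc ENNReal.ofReal (3 * (Fintype.card ι) * (J.card * (2 * h)))
        = ENNReal.ofReal ((6 * Fintype.card ι : ℕ) * (J.card * h)) := by
          congr 1; push_cast; ring
      _ = (6 * Fintype.card ι : ℕ) * ENNReal.ofReal (J.card * h) := by
          rw [ENNReal.ofReal_mul (by positivity), ENNReal.ofReal_natCast]
      _ ≤ _ := by gcongr

/-! ### Perturbations without absolutely continuous spectrum -/

/-- The perturbations for which the spectral measure of `A + C` at `ψ` is, up to `ε`, carried by a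
set of Lebesgue measure at most `ε`. -/
def nearlySingular (A : H →ₗ.[ℂ] H) (p : ℝ) (ψ : H) (ε : ℝ) : Set (SASchatten H p) :=
  {C | ∃ f, IsSmallBump f ε ∧
    ‖ψ‖ ^ 2 - ε < (inner ℂ ψ (bcfc (perturb A C.1) (fun x => (f x : ℂ)) ψ)).re}

/-- For a fixed bump the defining inequality is open in C, because the bump vanishes at infinity and
`continuousAt_c0fc` applies. -/
theorem isOpen_nearlySingular {A : H →ₗ.[ℂ] H} (hA : IsSelfAdjoint A) {p : ℝ} (hp : 1 ≤ p) (ψ : H)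
    (ε : ℝ) : IsOpen (nearlySingular A p ψ ε) := by
  have : nearlySingular A p ψ ε = ⋃ f ∈ {f | IsSmallBump f ε}, {C : SASchatten H p |
      ‖ψ‖ ^ 2 - ε < (inner ℂ ψ (bcfc (perturb A C.1) (fun x => (f x : ℂ)) ψ)).re} := by
    ext C
    simp [nearlySingular]
  rw [this]
  refine isOpen_biUnion fun f hf => isOpen_lt continuous_const ?_
  have h1 : Continuous fun C : SASchatten H p => bcfc (perturb A C.1) (fun x => (f x : ℂ)) := by
    rw [continuous_iff_continuousAt]
    intro C₀
    have h2 : (fun C : SASchatten H p => bcfc (perturb A C.1) (fun x => (f x : ℂ)))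
        = fun C : SASchatten H p => c0fc (perturb A C.1) (fun x => (f x : ℂ)) := by
      funext C
      exact bcfc_eq_c0fc (isSelfAdjoint_perturb hA C.2.1) hf.isC0
    rw [h2]
    exact continuousAt_c0fc hA hf.isC0 (fun C => C.2.1)
      (SASchatten.continuous_val hp).continuousAt
  have h2 : Continuous fun C : SASchatten H p => bcfc (perturb A C.1) (fun x => (f x : ℂ)) ψ :=
    (ContinuousLinearMap.apply ℂ H ψ).continuous.comp h1
  exact Complex.continuous_re.comp (continuous_const.inner h2)

theorem schattenNorm_le_of_diagSup {p : ℝ} (hp : 1 ≤ p) {C : H →L[ℂ] H} (hC : IsSelfAdjoint C)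
    (hc : IsCompactOperator C) {c T : ℝ} (hc0 : 0 ≤ c) (hn : ‖C‖ ≤ c)
    (hd : diagSup 1 C ≤ ENNReal.ofReal T) :
    schattenNorm p C ≤ ENNReal.ofReal ((c ^ (p - 1) * T) ^ (1 / p)) := by
  have hp0 : 0 < p := by linarith
  rw [schattenNorm_eq_diagSup hp hC hc]
  have h1 : ‖C‖ₑ ≤ ENNReal.ofReal c := by
    rw [← ofReal_norm]; exact ENNReal.ofReal_le_ofReal hn
  have h2 : diagSup p C ≤ ENNReal.ofReal (c ^ (p - 1) * T) := by
    refine (diagSup_le_of_enorm_le hp h1).trans ?_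
    rw [ENNReal.ofReal_mul (by positivity), ENNReal.ofReal_rpow_of_nonneg hc0 (by linarith)]
    gcongr
  refine (ENNReal.rpow_le_rpow h2 (by positivity)).trans ?_
  rcases le_total 0 (c ^ (p - 1) * T) with h3 | h3
  · rw [ENNReal.ofReal_rpow_of_nonneg h3 (by positivity)]
  · rw [ENNReal.ofReal_of_nonpos h3, ENNReal.zero_rpow_of_pos (by positivity)]
    exact zero_le

theorem exists_pos_mul_lt_real (a : ℝ) {b : ℝ} (hb : 0 < b) : ∃ η > 0, η ≤ 1 ∧ a * η < b := by
  have h : ContinuousAt (fun η : ℝ => a * η) 0 := by fun_prop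
  have h1 : ∀ᶠ η in 𝓝[>] (0 : ℝ), a * η < b :=
    (h.eventually_lt_const (by simpa using hb)).filter_mono nhdsWithin_le_nhds
  have h2 : ∀ᶠ η in 𝓝[>] (0 : ℝ), η ≤ 1 :=
    (eventually_le_nhds (zero_lt_one' ℝ)).filter_mono nhdsWithin_le_nhds
  obtain ⟨η, h3, h4, h5⟩ := (h1.and (h2.and self_mem_nhdsWithin)).exists
  exact ⟨η, h5, h4, h3⟩

/-- The Weyl-von Neumann step is used with L a long interval [-M, M]. For h ≤ 1 the trace norm stays
below a constant depending on M, while the operator norm is at most 6h. -/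
theorem dense_nearlySingular {A : H →ₗ.[ℂ] H} (hA : IsSelfAdjoint A) {p : ℝ} (hp : 1 < p) (ψ : H)
    {ε : ℝ} (hε : 0 < ε) : Dense (nearlySingular A p ψ ε) := by
  have hp0 : 0 < p := by linarith
  refine SASchatten.dense_of_forall_exists hp.le fun C δ hδ => ?_
  have hD := isSelfAdjoint_perturb hA C.2.1
  obtain ⟨η, hη, -, hηε⟩ := exists_pos_mul_lt_real (2 * ‖ψ‖) hε
  obtain ⟨M, hM⟩ : ∃ M : ℕ, specMeasure hD ψ (Set.Icc (-M : ℝ) M)ᶜ < ENNReal.ofReal (η ^ 2) := by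
    have h1 : Tendsto (fun n : ℕ => specMeasure hD ψ (Set.Icc (-n : ℝ) n)ᶜ) atTop
        (𝓝 (specMeasure hD ψ (⋂ n : ℕ, (Set.Icc (-n : ℝ) n)ᶜ))) := by
      refine tendsto_measure_iInter_atTop
        (fun n => measurableSet_Icc.compl.nullMeasurableSet) (fun n m hnm => ?_)
        ⟨0, measure_ne_top _ _⟩
      rw [Set.compl_subset_compl]
      have : (n : ℝ) ≤ m := by exact_mod_cast hnm
      exact Set.Icc_subset_Icc (by linarith) this
    have h2 : (⋂ n : ℕ, (Set.Icc (-n : ℝ) n)ᶜ) = ∅ := by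
      rw [← Set.compl_iUnion, Set.compl_empty_iff, Set.eq_univ_iff_forall]
      intro x
      obtain ⟨n, hn⟩ := exists_nat_ge |x|
      exact Set.mem_iUnion.2 ⟨n, abs_le.1 hn⟩
    rw [h2, measure_empty] at h1
    exact (h1.eventually_lt_const (ENNReal.ofReal_pos.2 (by positivity))).exists
  -- Since p - 1 > 0 the power of 6h tends to 0 with h; this is where p = 1 fails.
  obtain ⟨h, hh, hh1, hlt⟩ : ∃ h : ℝ, 0 < h ∧ h ≤ 1 ∧
      (((6 * h) ^ (p - 1) * (6 * (2 * M + 2))) ^ (1 / p)) < δ := by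
    have hc : ContinuousAt
        (fun h : ℝ => (((6 * h) ^ (p - 1) * (6 * (2 * (M : ℝ) + 2))) ^ (1 / p))) 0 := by
      have h1 : Continuous fun h : ℝ => (6 * h) ^ (p - 1) :=
        (Real.continuous_rpow_const (by linarith)).comp (by fun_prop)
      exact ((Real.continuous_rpow_const (by positivity)).comp
        (h1.mul continuous_const)).continuousAt
    have h0 : (fun h : ℝ => (((6 * h) ^ (p - 1) * (6 * (2 * (M : ℝ) + 2))) ^ (1 / p))) 0 < δ := by
      simp only [mul_zero]
      rw [Real.zero_rpow (by linarith), zero_mul, Real.zero_rpow (by positivity)]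
      exact hδ
    have h1 := (hc.eventually_lt_const h0).filter_mono
      (nhdsWithin_le_nhds : 𝓝[>] (0 : ℝ) ≤ 𝓝 0)
    have h2 : ∀ᶠ η in 𝓝[>] (0 : ℝ), η ≤ 1 :=
      (eventually_le_nhds (zero_lt_one' ℝ)).filter_mono nhdsWithin_le_nhds
    obtain ⟨h, h3, h4, h5⟩ := (h1.and (h2.and self_mem_nhdsWithin)).exists
    exact ⟨h, h5, h4, h3⟩
  obtain ⟨F, S, hFs, hFc, hS, hSinv, hSm, hFd, hFn⟩ :=
    exists_perturb_invariant_near hD (fun _ : Unit => ψ) (isCompact_Icc (a := (-M : ℝ)) (b := M))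
      hη hh (by simpa using hM)
  have hvol : volume (Metric.cthickening h (Set.Icc (-M : ℝ) M)) ≤ ENNReal.ofReal (2 * M + 2) := by
    have hsub : Metric.cthickening h (Set.Icc (-M : ℝ) M) ⊆ Set.Icc (-M - 1 : ℝ) (M + 1) := by
      intro y hy
      rw [isCompact_Icc.cthickening_eq_biUnion_closedBall hh.le] at hy
      obtain ⟨z, hz, hyz⟩ := Set.mem_iUnion₂.1 hy
      rw [Metric.mem_closedBall, Real.dist_eq, abs_le] at hyz
      constructor <;> linarith [hz.1, hz.2, hyz.1, hyz.2]
    refine (measure_mono hsub).trans (le_of_eq ?_)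
    rw [Real.volume_Icc]
    congr 1
    ring
  have hFd' : diagSup 1 F ≤ ENNReal.ofReal (6 * (2 * M + 2)) := by
    refine hFd.trans ?_
    rw [ENNReal.ofReal_mul (by norm_num)]
    simp only [Fintype.card_unit]
    gcongr
    norm_num
  have hnorm := schattenNorm_le_of_diagSup hp.le hFs hFc (by positivity) hFn hFd'
  have hlt' : schattenNorm p F < ENNReal.ofReal δ :=
    hnorm.trans_lt ((ENNReal.ofReal_lt_ofReal_iff hδ).2 hlt)
  refine ⟨F, hFs, hlt'.trans ENNReal.ofReal_lt_top, hlt', ?_⟩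
  obtain ⟨φ, hφS, hφ⟩ := hSm ()
  have hDF := isSelfAdjoint_perturb hD hFs
  obtain ⟨f, hf, hfψ⟩ := exists_isSmallBump_inner_ge hDF hSinv hφS hφ hε
  refine ⟨f, hf, ?_⟩
  rw [perturb_perturb] at hfψ
  refine lt_of_lt_of_le ?_ hfψ
  linarith

theorem diagSup_one_rankOne_sub_le (a b : H) :
    diagSup 1 (InnerProductSpace.rankOne ℂ a a - InnerProductSpace.rankOne ℂ b b : H →L[ℂ] H)
      ≤ ENNReal.ofReal (‖b - a‖ * (‖a‖ + ‖b‖)) := by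
  have h1 : (InnerProductSpace.rankOne ℂ a a - InnerProductSpace.rankOne ℂ b b : H →L[ℂ] H)
      = InnerProductSpace.rankOne ℂ (a - b) a + InnerProductSpace.rankOne ℂ b (a - b) := by
    simp
  rw [h1]
  refine (diagSup_one_add_le _ _).trans ?_
  rw [mul_add, ENNReal.ofReal_add (by positivity) (by positivity)]
  gcongr
  · refine (diagSup_one_rankOne_le _ _).trans (le_of_eq ?_)
    rw [ENNReal.ofReal_mul (by positivity), norm_sub_rev, ofReal_norm, ofReal_norm]
  · refine (diagSup_one_rankOne_le _ _).trans (le_of_eq ?_)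
    rw [ENNReal.ofReal_mul (by positivity), norm_sub_rev, ofReal_norm, ofReal_norm, mul_comm]

/-- The hypothesis concerns A, not A + C, so C is rebuilt on top of a perturbation of A. Its
finite-rank approximation has finitely many eigenvectors; together with ψ they are moved into a
subspace S invariant under A + F, with F small in trace norm because their spectral measures almost
live on a null compact set. With G the approximation rebuilt on the moved vectors, F + G is close to
C and S is invariant under A + F + G. -/
theorem dense_nearlySingular_one {A : H →ₗ.[ℂ] H} (hA : IsSelfAdjoint A)
    (hs : ∀ ψ, (specMeasure hA ψ).MutuallySingular volume) (ψ : H) {ε : ℝ} (hε : 0 < ε) :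
    Dense (nearlySingular A 1 ψ ε) := by
  classical
  refine SASchatten.dense_of_forall_exists le_rfl fun C δ hδ => ?_
  obtain ⟨w, s, f, l, hCf⟩ := exists_sum_rankOne_approx C.2.1 C.2.2 (by positivity : 0 < δ / 4)
  set ξ : Option s → H := fun o => o.elim ψ fun i => f i.1 with hξ
  -- The factor 2‖f i‖ + 1 bounds the sum of the norms of f i and of its replacement, as η ≤ 1.
  set B : ℝ := ∑ i ∈ s, |l i| * (2 * ‖f i‖ + 1) with hB
  have hB0 : 0 ≤ B := Finset.sum_nonneg fun i _ => by positivity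
  obtain ⟨η₁, hη₁, hη₁1, hη₁ε⟩ := exists_pos_mul_lt_real (2 * ‖ψ‖) hε
  obtain ⟨η₂, hη₂, -, hη₂B⟩ := exists_pos_mul_lt_real B (by positivity : 0 < δ / 4)
  set η := min η₁ η₂ with hη
  have hη0 : 0 < η := lt_min hη₁ hη₂
  set μ : Measure ℝ := ∑ i, specMeasure hA (ξ i) with hμ
  have hμs : μ.MutuallySingular volume := by
    rw [hμ, ← Measure.sum_fintype, Measure.MutuallySingular.sum_left]
    exact fun i => hs _
  obtain ⟨Z, hZm, hZμ, hZv⟩ := hμs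
  have hμfin : IsFiniteMeasure μ := inferInstance
  obtain ⟨L, hLZ, hLc, hLμ⟩ := hZm.compl.exists_isCompact_sdiff_lt (measure_ne_top μ _)
    (ENNReal.ofReal_pos.2 (by positivity : 0 < η ^ 2)).ne'
  have hLμ' : μ Lᶜ < ENNReal.ofReal (η ^ 2) := by
    have hsub : Lᶜ ⊆ Z ∪ (Zᶜ \ L) := by
      intro y hy
      by_cases hyZ : y ∈ Z
      · exact Or.inl hyZ
      · exact Or.inr ⟨hyZ, hy⟩
    refine ((measure_mono hsub).trans (measure_union_le _ _)).trans_lt ?_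
    rwa [hZμ, zero_add]
  have hLv : volume L = 0 := measure_mono_null hLZ hZv
  obtain ⟨h, hh, hhv⟩ : ∃ h : ℝ, 0 < h ∧
      ((6 * Fintype.card (Option s) : ℕ) : ℝ≥0∞) * volume (Metric.cthickening h L)
        < ENNReal.ofReal (δ / 4) := by
    have ht := tendsto_measure_cthickening_of_isCompact (μ := (volume : Measure ℝ)) hLc
    rw [hLv] at ht
    have ht' := ENNReal.Tendsto.const_mul (a := ((6 * Fintype.card (Option s) : ℕ) : ℝ≥0∞)) ht
      (Or.inr (ENNReal.natCast_ne_top _))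
    rw [mul_zero] at ht'
    have h1 := (ht'.eventually_lt_const
      (ENNReal.ofReal_pos.2 (by positivity : 0 < δ / 4))).filter_mono
      (nhdsWithin_le_nhds : 𝓝[>] (0 : ℝ) ≤ 𝓝 0)
    obtain ⟨h, h3, h4⟩ := (h1.and self_mem_nhdsWithin).exists
    exact ⟨h, h4, h3⟩
  obtain ⟨F, S, hFs, hFc, hS, hSinv, hSm, hFd, -⟩ :=
    exists_perturb_invariant_near hA ξ hLc hη0 hh hLμ'
  choose φ hφS hφ using hSm
  set G : H →L[ℂ] H := ∑ i : s, (l i : ℂ) •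
    InnerProductSpace.rankOne ℂ (φ (some i)) (φ (some i)) with hG
  have hGs : IsSelfAdjoint G := by
    refine isSelfAdjoint_sum _ fun i _ => ?_
    rw [IsSelfAdjoint, star_smul, ContinuousLinearMap.star_eq_adjoint,
      InnerProductSpace.adjoint_rankOne]
    simp
  have hGc : IsCompactOperator G := isCompactOperator_sum _ fun i _ =>
    (isCompactOperator_rankOne _ _).smul (l i : ℂ)
  have hGS : ∀ x, G x ∈ S := fun x => by
    rw [hG, sum_apply]
    refine Submodule.sum_mem _ fun i _ => ?_
    rw [smul_apply, InnerProductSpace.rankOne_apply]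
    exact Submodule.smul_mem _ _ (Submodule.smul_mem _ _ (hφS _))
  -- The perturbation to be added to C, which replaces C by F + G.
  have hKs : IsSelfAdjoint (F + G - C.1) := (hFs.add hGs).sub C.2.1
  have hKc : IsCompactOperator (F + G - C.1 : H →L[ℂ] H) :=
    (hFc.add hGc).sub (C.isCompactOperator le_rfl)
  have hGC : diagSup 1 (G - ∑ i ∈ s, (l i : ℂ) • InnerProductSpace.rankOne ℂ (f i) (f i))
      ≤ ENNReal.ofReal (δ / 4) := by
    rw [← Finset.sum_coe_sort s, hG, ← Finset.sum_sub_distrib]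
    refine (diagSup_one_sum_le _ _).trans ?_
    have h1 : ∀ i : s, diagSup 1 ((l i : ℂ) •
        InnerProductSpace.rankOne ℂ (φ (some i)) (φ (some i)) -
        (l i : ℂ) • InnerProductSpace.rankOne ℂ (f i) (f i) : H →L[ℂ] H)
        ≤ ENNReal.ofReal (|l i| * (2 * ‖f i‖ + 1) * η) := by
      intro i
      rw [← smul_sub, diagSup_one_smul, mul_assoc, ENNReal.ofReal_mul (abs_nonneg _)]
      have e1 : ‖(l i : ℂ)‖ₑ = ENNReal.ofReal |l i| := by
        rw [← ofReal_norm, Complex.norm_real, Real.norm_eq_abs]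
      rw [e1]
      gcongr
      refine (diagSup_one_rankOne_sub_le _ _).trans (ENNReal.ofReal_le_ofReal ?_)
      have h2 : ‖f i - φ (some i)‖ ≤ η := hφ (some i)
      have h3 : ‖φ (some i)‖ ≤ ‖f i‖ + 1 := by
        have := norm_sub_norm_le (φ (some i)) (f i)
        rw [norm_sub_rev] at this
        have h4 : η ≤ 1 := (min_le_left _ _).trans hη₁1
        linarith
      rw [mul_comm (2 * ‖f i‖ + 1)]
      exact mul_le_mul h2 (by linarith) (by positivity) hη0.le
    refine (Finset.sum_le_sum fun i _ => h1 i).trans ?_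
    rw [← ENNReal.ofReal_sum_of_nonneg fun i _ => by positivity, ← Finset.sum_mul,
      Finset.sum_coe_sort s (fun i => |l i| * (2 * ‖f i‖ + 1))]
    refine ENNReal.ofReal_le_ofReal ?_
    calc B * η ≤ B * η₂ := by gcongr; exact min_le_right _ _
      _ ≤ δ / 4 := hη₂B.le
  have hnorm : schattenNorm 1 (F + G - C.1) < ENNReal.ofReal δ := by
    rw [schattenNorm_eq_diagSup le_rfl hKs hKc]
    simp only [div_one, ENNReal.rpow_one]
    set E : H →L[ℂ] H := ∑ i ∈ s, (l i : ℂ) • InnerProductSpace.rankOne ℂ (f i) (f i) with hE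
    have e1 : F + G - C.1 = F + ((G - E) + -(C.1 - E)) := by abel
    rw [e1]
    calc _ ≤ ENNReal.ofReal (δ / 4) + (ENNReal.ofReal (δ / 4) + ENNReal.ofReal (δ / 4)) := by
          refine (diagSup_one_add_le _ _).trans ?_
          gcongr
          · exact hFd.trans hhv.le
          · refine (diagSup_one_add_le _ _).trans ?_
            rw [diagSup_neg]
            gcongr
      _ = ENNReal.ofReal (δ / 4 + (δ / 4 + δ / 4)) := by
          rw [ENNReal.ofReal_add, ENNReal.ofReal_add] <;> positivity
      _ < ENNReal.ofReal δ := (ENNReal.ofReal_lt_ofReal_iff hδ).2 (by linarith)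
  refine ⟨F + G - C.1, hKs, hnorm.trans ENNReal.ofReal_lt_top, hnorm, ?_⟩
  have hDF := isSelfAdjoint_perturb (isSelfAdjoint_perturb hA hFs) hGs
  have hSinv' : ∀ x ∈ S, ∃ b ∈ S, (x, b) ∈ (perturb (perturb A F) G).graph := by
    intro x hx
    obtain ⟨b, hb, hxb⟩ := hSinv x hx
    exact ⟨b + G x, S.add_mem hb (hGS x), mem_graph_perturb.2 (by simpa using hxb)⟩
  obtain ⟨k, hk, hkψ⟩ := exists_isSmallBump_inner_ge hDF hSinv' (hφS none) (hφ none) hε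
  have hadd : (C.addOp le_rfl hKs (hnorm.trans ENNReal.ofReal_lt_top)).1 = F + G :=
    add_sub_cancel C.1 (F + G)
  refine ⟨k, hk, ?_⟩
  rw [hadd, ← perturb_perturb]
  refine lt_of_lt_of_le ?_ hkψ
  have h1 : 2 * ‖ψ‖ * η ≤ 2 * ‖ψ‖ * η₁ := by gcongr; exact min_le_left _ _
  have h2 : ‖ξ none‖ = ‖ψ‖ := rfl
  rw [h2]
  linarith

/-! ### Perturbations without eigenvalues in the essential spectrum -/

/-- Weak limits along an ultrafilter in the unit ball of a Hilbert space. -/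
theorem exists_weak_limit {ι : Type*} (U : Ultrafilter ι) {u : ι → H}
    (hu : ∀ᶠ k in (U : Filter ι), ‖u k‖ ≤ 1) :
    ∃ u₀ : H, ‖u₀‖ ≤ 1 ∧
      ∀ η, Tendsto (fun k => inner ℂ η (u k)) U (𝓝 (inner ℂ η u₀)) := by
  set F : ι → WeakDual ℂ H := fun k =>
    StrongDual.toWeakDual (InnerProductSpace.toDual ℂ H (u k)) with hF
  have hc := WeakDual.isCompact_closedBall (𝕜 := ℂ) (E := H) 0 1
  have hm : ↑(U.map F) ≤ 𝓟 (WeakDual.toStrongDual ⁻¹' Metric.closedBall (0 : StrongDual ℂ H) 1) := by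
    rw [le_principal_iff]
    change ∀ᶠ k in (U : Filter ι), _
    filter_upwards [hu] with k hk
    change WeakDual.toStrongDual (F k) ∈ Metric.closedBall (0 : StrongDual ℂ H) 1
    rw [mem_closedBall_zero_iff]
    change ‖InnerProductSpace.toDual ℂ H (u k)‖ ≤ 1
    rwa [LinearIsometryEquiv.norm_map]
  obtain ⟨x, hx, hxl⟩ := hc.ultrafilter_le_nhds _ hm
  have hxl' : Tendsto F U (𝓝 x) := hxl
  refine ⟨(InnerProductSpace.toDual ℂ H).symm (WeakDual.toStrongDual x), ?_, fun η => ?_⟩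
  · rw [LinearIsometryEquiv.norm_map]
    exact mem_closedBall_zero_iff.1 hx
  · have h1 : Tendsto (fun k => (F k) η) U (𝓝 (x η)) :=
      ((WeakDual.eval_continuous η).tendsto x).comp hxl'
    have h2 : Tendsto (fun k => inner ℂ (u k) η) U
        (𝓝 (inner ℂ ((InnerProductSpace.toDual ℂ H).symm (WeakDual.toStrongDual x)) η)) := by
      rw [InnerProductSpace.toDual_symm_apply]
      exact h1
    have h3 := (Complex.continuous_conj.tendsto _).comp h2
    simpa only [Function.comp_def, inner_conj_symm] using h3

/-- Eigenvectors of small perturbations of `D` converge weakly to eigenvectors of `D`. -/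
theorem exists_limit_eigenvector {D : H →ₗ.[ℂ] H} (hD : IsSelfAdjoint D) {ι : Type*}
    (U : Ultrafilter ι) {K : Set ℝ} (hK : IsCompact K) {C : ι → H →L[ℂ] H}
    (hC : Tendsto C U (𝓝 0)) {E : ι → ℝ} {u : ι → H}
    (h : ∀ᶠ k in (U : Filter ι), E k ∈ K ∧ ‖u k‖ ≤ 1 ∧
      (u k, (E k : ℂ) • u k) ∈ (perturb D (C k)).graph) :
    ∃ E₀ ∈ K, ∃ u₀ : H, ‖u₀‖ ≤ 1 ∧ (u₀, (E₀ : ℂ) • u₀) ∈ D.graph ∧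
      ∀ η, Tendsto (fun k => inner ℂ η (u k)) U (𝓝 (inner ℂ η u₀)) := by
  obtain ⟨u₀, hu₀, hlim⟩ := exists_weak_limit U (h.mono fun k hk => hk.2.1)
  have hm : ↑(U.map E) ≤ 𝓟 K := by
    rw [le_principal_iff]
    exact h.mono fun k hk => hk.1
  obtain ⟨E₀, hE₀, hEl⟩ := hK.ultrafilter_le_nhds _ hm
  have hEl' : Tendsto E U (𝓝 E₀) := hEl
  refine ⟨E₀, hE₀, u₀, hu₀, (mem_graph_iff_inner hD).2 fun a b hab => ?_, hlim⟩
  -- Pairing with a domain vector a, the eigenvalue equation reads ⟨b, u k⟩ = E k ⟨a, u k⟩ - ⟨a, C k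
  -- (u k)⟩, and every term passes to a weak limit.
  have hCu : Tendsto (fun k => inner ℂ a (C k (u k))) U (𝓝 0) := by
    refine squeeze_zero_norm' (a := fun k => ‖a‖ * ‖C k‖) ?_ ?_
    · filter_upwards [h] with k hk
      refine (norm_inner_le_norm _ _).trans ?_
      gcongr
      calc ‖C k (u k)‖ ≤ ‖C k‖ * ‖u k‖ := (C k).le_opNorm _
        _ ≤ ‖C k‖ * 1 := by gcongr; exact hk.2.1
        _ = ‖C k‖ := mul_one _
    · simpa using (hC.norm).const_mul ‖a‖
  have h1 : Tendsto (fun k => (E k : ℂ) * inner ℂ a (u k) - inner ℂ a (C k (u k))) U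
      (𝓝 ((E₀ : ℂ) * inner ℂ a u₀ - 0)) :=
    (((Complex.continuous_ofReal.tendsto _).comp hEl').mul (hlim a)).sub hCu
  have h2 : (fun k => (E k : ℂ) * inner ℂ a (u k) - inner ℂ a (C k (u k)))
      =ᶠ[(U : Filter ι)] fun k => inner ℂ b (u k) := by
    filter_upwards [h] with k hk
    have := inner_graph_comm hD hab (mem_graph_perturb.1 hk.2.2)
    rw [this, inner_sub_right, inner_smul_right]
  have h3 := tendsto_nhds_unique (h1.congr' h2) (hlim b)
  rw [← h3, sub_zero, inner_smul_right]

/-- Orthonormal approximate eigenvectors at given points of the essential spectrum, orthogonal to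
a given finite-dimensional subspace. -/
theorem exists_orthonormal_approx_eigenvectors {D : H →ₗ.[ℂ] H} {τ : Type*} (s : Finset τ)
    {e : τ → ℝ} (he : ∀ i ∈ s, e i ∈ essSpec D) (F : Submodule ℂ H) [FiniteDimensional ℂ F] {ρ : ℝ}
    (hρ : 0 < ρ) :
    ∃ u : τ → H, (∀ i ∈ s, ‖u i‖ = 1 ∧ u i ∈ Fᗮ ∧
        ∃ d, ‖d‖ ≤ ρ ∧ (u i, (e i : ℂ) • u i + d) ∈ D.graph) ∧
      ∀ i ∈ s, ∀ j ∈ s, i ≠ j → inner ℂ (u i) (u j) = 0 := by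
  classical
  induction s using Finset.induction_on with
  | empty => exact ⟨fun _ => 0, by simp, by simp⟩
  | insert a s ha ih =>
    obtain ⟨u, hu, huo⟩ := ih fun i hi => he i (Finset.mem_insert_of_mem hi)
    have hfd : FiniteDimensional ℂ (Submodule.span ℂ (u '' (s : Set τ))) :=
      FiniteDimensional.span_of_finite ℂ (s.finite_toSet.image u)
    obtain ⟨w, b, hwb, hw, hwF, hwn⟩ := he a (Finset.mem_insert_self a s)
      (F ⊔ Submodule.span ℂ (u '' (s : Set τ))) inferInstance ρ hρ
    have hwu : ∀ i ∈ s, inner ℂ (u i) w = 0 := fun i hi =>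
      (Submodule.mem_orthogonal _ _).1 hwF _
        (Submodule.mem_sup_right (Submodule.subset_span ⟨i, hi, rfl⟩))
    have hwu' : ∀ i ∈ s, inner ℂ w (u i) = 0 := fun i hi => by
      rw [← inner_conj_symm, hwu i hi, map_zero]
    have hne : ∀ i ∈ s, i ≠ a := fun i hi h => ha (h ▸ hi)
    refine ⟨Function.update u a w, fun i hi => ?_, fun i hi j hj hij => ?_⟩
    · rcases Finset.mem_insert.1 hi with rfl | hi
      · rw [Function.update_self]
        exact ⟨hw, Submodule.orthogonal_le le_sup_left hwF, _, hwn, by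
          rwa [add_sub_cancel]⟩
      · rw [Function.update_of_ne (hne i hi)]
        exact hu i hi
    · rcases eq_or_ne i a with rfl | hia
      · have hj' := (Finset.mem_insert.1 hj).resolve_left fun h => hij h.symm
        rw [Function.update_self, Function.update_of_ne (hne j hj')]
        exact hwu' j hj'
      · rcases Finset.mem_insert.1 hj with rfl | hj
        · have hi' := (Finset.mem_insert.1 hi).resolve_left hij
          rw [Function.update_self, Function.update_of_ne (hne i hi')]
          exact hwu i hi'
        · have hi' := (Finset.mem_insert.1 hi).resolve_left hia
          rw [Function.update_of_ne hia, Function.update_of_ne (hne j hj)]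
          exact huo i hi' j hj hij

/-- A unitary matrix whose first row has entries of equal modulus. -/
theorem exists_flat_unitary (N : ℕ) : ∃ q : Fin (N + 1) → Fin (N + 1) → ℂ,
    (∀ j, ‖q 0 j‖ = 1 / √(N + 1)) ∧ (∀ l j, ‖q l j‖ ≤ 1) ∧
    (∀ j k, ∑ l, conj (q l j) * q l k = if j = k then 1 else 0) ∧
    ∀ l m, ∑ j, conj (q l j) * q m j = if l = m then 1 else 0 := by
  have hN : (0 : ℝ) < √(N + 1) := Real.sqrt_pos.2 (by positivity)
  set v : EuclideanSpace ℂ (Fin (N + 1)) := WithLp.toLp 2 fun _ => ((1 / √(N + 1) : ℝ) : ℂ) with hv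
  have hv1 : ‖v‖ = 1 := by
    rw [EuclideanSpace.norm_eq, Real.sqrt_eq_one]
    have : ∀ i, ‖v i‖ ^ 2 = 1 / (N + 1 : ℝ) := fun i => by
      rw [hv]
      simp only [Complex.norm_real, Real.norm_eq_abs, sq_abs, div_pow, one_pow]
      rw [Real.sq_sqrt (by positivity)]
    simp only [this, Finset.sum_const, Finset.card_univ, Fintype.card_fin, nsmul_eq_mul]
    push_cast
    field_simp
  have hon : Orthonormal ℂ (({0} : Set (Fin (N + 1))).domRestrict fun _ => v) := by
    refine ⟨fun i => hv1, fun i j hij => absurd (Subtype.ext (i.2.trans j.2.symm)) hij⟩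
  obtain ⟨b, hb⟩ := hon.exists_orthonormalBasis_extension_of_card_eq (by simp)
  have hb0 : b 0 = v := hb 0 rfl
  refine ⟨fun l j => b l j, fun j => ?_, fun l j => ?_, fun j k => ?_, fun l m => ?_⟩
  · change ‖b 0 j‖ = _
    rw [hb0, hv]
    simp only [Complex.norm_real, Real.norm_eq_abs]
    exact abs_of_pos (by positivity)
  · exact (PiLp.norm_apply_le (b l) j).trans (b.orthonormal.1 l).le
  · have := b.sum_inner_mul_inner (EuclideanSpace.single k (1 : ℂ)) (EuclideanSpace.single j (1 : ℂ))
    simp only [EuclideanSpace.inner_single_left, EuclideanSpace.inner_single_right, map_one,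
      one_mul] at this
    simp only [mul_comm (conj _)]
    rw [this]
    simp
  · have := orthonormal_iff_ite.1 b.orthonormal l m
    rw [PiLp.inner_apply] at this
    rw [← this]
    refine Finset.sum_congr rfl fun j _ => ?_
    rw [RCLike.inner_apply, mul_comm]

/-- Finitely many unit eigenvectors `a E`, with eigenvalues `E` in the essential spectrum, can be
spread by a small perturbation so that every eigenvector of the perturbed operator has small
overlap with them. -/
theorem exists_perturb_spread {D : H →ₗ.[ℂ] H} (hD : IsSelfAdjoint D) (s : Finset ℝ)
    (hs : ∀ E ∈ s, E ∈ essSpec D) {a : ℝ → H}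
    (ha : ∀ E ∈ s, ‖a E‖ = 1 ∧ (a E, (E : ℂ) • a E) ∈ D.graph) (N : ℕ) {τ : ℝ} (hτ : 0 < τ) :
    ∃ F : H →L[ℂ] H, IsSelfAdjoint F ∧ IsCompactOperator F ∧ diagSup 1 F ≤ ENNReal.ofReal τ ∧
      ∀ E ∈ s, ∀ (E' : ℝ) (u : H), (u, (E' : ℂ) • u) ∈ (perturb D F).graph →
        ‖inner ℂ (a E) u‖ ≤ 1 / √(N + 1) * ‖u‖ := by
  classical
  obtain ⟨q, hq0, hq1, hqc, hqr⟩ := exists_flat_unitary N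
  set B : ℝ := 3 * (Fintype.card (s × Fin (N + 1)) * (2 * (N + 1))) with hB
  obtain ⟨ρ, hρ, -, hρB⟩ := exists_pos_mul_lt_real B hτ
  have hfd : FiniteDimensional ℂ (Submodule.span ℂ (a '' (s : Set ℝ))) :=
    FiniteDimensional.span_of_finite ℂ (s.finite_toSet.image a)
  obtain ⟨w, hw, hwo⟩ := exists_orthonormal_approx_eigenvectors (D := D)
    (Finset.univ : Finset (s × Fin N)) (e := fun p => (p.1 : ℝ)) (fun p _ => hs _ p.1.2)
    (Submodule.span ℂ (a '' (s : Set ℝ))) hρ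
  -- Index 0 is the given eigenvector, with zero defect; the other N vectors are approximate
  -- eigenvectors near the same E.
  set U : s → Fin (N + 1) → H := fun E => Fin.cons (a E) fun l => w (E, l) with hU
  have hUd : ∀ (E : s) l, ∃ d, ‖d‖ ≤ ρ ∧ (U E l, ((E : ℝ) : ℂ) • U E l + d) ∈ D.graph := by
    intro E l
    induction l using Fin.cases with
    | zero => exact ⟨0, by simpa using hρ.le, by simpa [hU] using (ha E E.2).2⟩
    | succ l => exact (hw (E, l) (Finset.mem_univ _)).2.2
  have haw : ∀ (E : s) p, inner ℂ (a E) (w p) = 0 := fun E p =>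
    (Submodule.mem_orthogonal _ _).1 (hw p (Finset.mem_univ _)).2.1 _
      (Submodule.subset_span ⟨E, E.2, rfl⟩)
  have hwa : ∀ (E : s) p, inner ℂ (w p) (a E) = 0 := fun E p => by
    rw [← inner_conj_symm, haw, map_zero]
  have hUo : ∀ (E E' : s) l m, inner ℂ (U E l) (U E' m) = if E = E' ∧ l = m then (1 : ℂ) else 0 := by
    intro E E' l m
    split_ifs with h
    · obtain ⟨rfl, rfl⟩ := h
      have h1 : ‖U E l‖ = 1 := by
        induction l using Fin.cases with
        | zero => exact (ha E E.2).1
        | succ l => exact (hw (E, l) (Finset.mem_univ _)).1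
      rw [inner_self_eq_norm_sq_to_K, h1]
      simp
    · induction l using Fin.cases with
      | zero =>
        induction m using Fin.cases with
        | zero =>
          exact inner_eq_zero_of_eigenvectors hD (fun h' => h ⟨Subtype.ext h', rfl⟩)
            (ha E E.2).2 (ha E' E'.2).2
        | succ m => exact haw E _
      | succ l =>
        induction m using Fin.cases with
        | zero => exact hwa E' _
        | succ m =>
          refine hwo (E, l) (Finset.mem_univ _) (E', m) (Finset.mem_univ _) fun h' => h ?_
          rw [Prod.mk.injEq] at h'
          exact ⟨h'.1, congrArg _ h'.2⟩
  choose d hdn hdg using hUd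
  set v : s × Fin (N + 1) → H := fun p => ∑ l, q l p.2 • U p.1 l with hv
  have hvo : Orthonormal ℂ v := by
    rw [orthonormal_iff_ite]
    rintro ⟨E, j⟩ ⟨E', k⟩
    simp only [hv, sum_inner, inner_sum, inner_smul_left, inner_smul_right, hUo]
    by_cases hE : E = E'
    · subst hE
      simp only [true_and, mul_ite, mul_one, mul_zero, Finset.sum_ite_eq',
        Finset.mem_univ, if_true, Prod.mk.injEq]
      rw [← hqc j k]
      exact Finset.sum_congr rfl fun l _ => mul_comm _ _
    · simp [hE]
  -- The subtracted term shifts the eigenvalue of the j-th rotated vector to E + ρ j, so that for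
  -- fixed E the eigenvalues are distinct.
  set r : s × Fin (N + 1) → H := fun p =>
    ∑ l, q l p.2 • d p.1 l - ((ρ * (p.2 : ℕ) : ℝ) : ℂ) • v p with hr
  have hrn : ∀ p, ‖r p‖ ≤ 2 * (N + 1) * ρ := by
    intro p
    have h1 : ‖∑ l, q l p.2 • d p.1 l‖ ≤ (N + 1) * ρ := by
      refine (norm_sum_le _ _).trans ?_
      calc ∑ l, ‖q l p.2 • d p.1 l‖ ≤ ∑ _l : Fin (N + 1), 1 * ρ := by
            refine Finset.sum_le_sum fun l _ => ?_
            rw [norm_smul]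
            exact mul_le_mul (hq1 _ _) (hdn _ _) (norm_nonneg _) zero_le_one
        _ = (N + 1) * ρ := by simp
    have h2 : ‖((ρ * (p.2 : ℕ) : ℝ) : ℂ) • v p‖ ≤ (N + 1) * ρ := by
      rw [norm_smul, hvo.1 p, mul_one, Complex.norm_real, Real.norm_eq_abs,
        abs_of_nonneg (by positivity), mul_comm]
      gcongr
      have : (p.2 : ℕ) ≤ N + 1 := p.2.2.le
      exact_mod_cast this
    have := norm_sub_le (∑ l, q l p.2 • d p.1 l) (((ρ * (p.2 : ℕ) : ℝ) : ℂ) • v p)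
    linarith
  have hvr : ∀ p : s × Fin (N + 1),
      (v p, ((((p.1 : ℝ) + ρ * (p.2 : ℕ) : ℝ)) : ℂ) • v p + r p) ∈ D.graph := by
    intro p
    have h1 : (v p, ∑ l, q l p.2 • (((p.1 : ℝ) : ℂ) • U p.1 l + d p.1 l)) ∈ D.graph :=
      graph_sum _ fun l _ => graph_smul _ (hdg p.1 l)
    convert h1 using 2
    simp only [smul_add, Finset.sum_add_distrib, hr]
    have h2 : ∑ l, q l p.2 • ((p.1 : ℝ) : ℂ) • U p.1 l = ((p.1 : ℝ) : ℂ) • v p := by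
      rw [hv, Finset.smul_sum]
      exact Finset.sum_congr rfl fun l _ => smul_comm _ _ _
    rw [h2, Complex.ofReal_add, add_smul]
    abel
  obtain ⟨F, hFs, hFc, hFe, hFd, -⟩ := exists_perturb_eigenvectors hD hvo hvr
  refine ⟨F, hFs, hFc, hFd.trans ?_, fun E hE E' u hu => ?_⟩
  · calc 3 * ∑ p, ‖r p‖ₑ ≤ 3 * ∑ _p : s × Fin (N + 1), ENNReal.ofReal (2 * (N + 1) * ρ) := by
          gcongr with p
          rw [← ofReal_norm]
          exact ENNReal.ofReal_le_ofReal (hrn p)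
      _ = ENNReal.ofReal (B * ρ) := by
          rw [Finset.sum_const, Finset.card_univ, nsmul_eq_mul, hB,
            show 3 * (Fintype.card (s × Fin (N + 1)) * (2 * ((N : ℝ) + 1))) * ρ
              = 3 * (Fintype.card (s × Fin (N + 1)) * (2 * (N + 1) * ρ)) by ring,
            ENNReal.ofReal_mul (p := 3) (by norm_num),
            ENNReal.ofReal_mul (p := (Fintype.card (s × Fin (N + 1)) : ℝ)) (by positivity),
            ENNReal.ofReal_natCast]
          simp
      _ ≤ ENNReal.ofReal τ := ENNReal.ofReal_le_ofReal hρB.le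
  · have hexp : a E = ∑ j, conj (q 0 j) • v (⟨E, hE⟩, j) := by
      have h1 : ∑ j, conj (q 0 j) • v (⟨E, hE⟩, j)
          = ∑ l, (∑ j, conj (q 0 j) * q l j) • U ⟨E, hE⟩ l := by
        simp only [hv, Finset.smul_sum, Finset.sum_smul, smul_smul]
        exact Finset.sum_comm
      rw [h1]
      simp only [hqr, ite_smul, one_smul, zero_smul, Finset.sum_ite_eq, Finset.mem_univ, if_true]
      rfl
    have hDF := isSelfAdjoint_perturb hD hFs
    -- An eigenvector at E' sees at most one of the N + 1 rotated vectors, and that one enters a E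
    -- with a coefficient of modulus 1/√(N+1).
    have hzero : ∀ j : Fin (N + 1), E + ρ * (j : ℕ) ≠ E' → inner ℂ (v (⟨E, hE⟩, j)) u = 0 :=
      fun j hj => inner_eq_zero_of_eigenvectors hDF hj (hFe (⟨E, hE⟩, j)) hu
    rw [hexp, sum_inner]
    simp only [inner_smul_left, Complex.conj_conj]
    by_cases hj : ∃ j : Fin (N + 1), E + ρ * (j : ℕ) = E'
    · obtain ⟨j, hj⟩ := hj
      rw [Finset.sum_eq_single j (fun k _ hk => ?_) fun h => absurd (Finset.mem_univ j) h]
      · rw [norm_mul, hq0]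
        gcongr
        refine (norm_inner_le_norm _ _).trans (le_of_eq ?_)
        rw [hvo.1, one_mul]
      · rw [hzero k fun h => hk ?_, mul_zero]
        rw [← hj] at h
        have h2 := mul_left_cancel₀ hρ.ne' (add_left_cancel h)
        exact Fin.ext (by exact_mod_cast h2)
    · push Not at hj
      simp only [hzero _ (hj _), mul_zero, Finset.sum_const_zero, norm_zero]
      positivity

/-- The perturbations for which `A + C` has an eigenvalue of the essential spectrum in `[-M, M]`
whose eigenspace overlaps `ψ` noticeably. -/
def hasEssEigenvalue (A : H →ₗ.[ℂ] H) (p : ℝ) (ψ : H) (M c : ℝ) : Set (SASchatten H p) :=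
  {C | ∃ E ∈ essSpec A ∩ Set.Icc (-M) M, ∃ u : H, ‖u‖ ≤ 1 ∧
    (u, (E : ℂ) • u) ∈ (perturb A C.1).graph ∧ c ≤ ‖inner ℂ ψ u‖}

/-- The energies stay in a compact set and the eigenvectors in the weakly compact unit ball, while
overlap with the fixed ψ is weakly continuous. The definition asks for ‖u‖ ≤ 1 because weak limits
can lose norm. -/
theorem isClosed_hasEssEigenvalue {A : H →ₗ.[ℂ] H} (hA : IsSelfAdjoint A) {p : ℝ} (hp : 1 ≤ p)
    (ψ : H) (M c : ℝ) : IsClosed (hasEssEigenvalue A p ψ M c) := by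
  rw [isClosed_iff_ultrafilter]
  intro C U hUC hU
  have hall : ∀ C' ∈ hasEssEigenvalue A p ψ M c, ∃ (E : ℝ) (u : H), E ∈ essSpec A ∩ Set.Icc (-M) M ∧
      ‖u‖ ≤ 1 ∧ (u, (E : ℂ) • u) ∈ (perturb A C'.1).graph ∧ c ≤ ‖inner ℂ ψ u‖ := by
    rintro C' ⟨E, hE, u, h⟩
    exact ⟨E, u, hE, h⟩
  choose! E u hE hu hg hc using hall
  have hT : Tendsto (fun C' : SASchatten H p => C'.1 - C.1) U (𝓝 0) := by
    have h1 := ((SASchatten.continuous_val (H := H) hp).tendsto C).mono_left hUC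
    simpa using h1.sub_const C.1
  obtain ⟨E₀, hE₀, u₀, hu₀, hg₀, hlim⟩ := exists_limit_eigenvector
    (isSelfAdjoint_perturb hA C.2.1) U (isCompact_Icc.inter_left (isClosed_essSpec A)) hT
    (E := E) (u := u) (by
      filter_upwards [hU] with C' hC'
      refine ⟨hE C' hC', hu C' hC', ?_⟩
      rw [perturb_perturb, add_sub_cancel]
      exact hg C' hC')
  exact ⟨E₀, hE₀, u₀, hu₀, hg₀, ge_of_tendsto (hlim ψ).norm (by
    filter_upwards [hU] with C' hC' using hc C' hC')⟩

theorem schattenNorm_le_diagSup_one {p : ℝ} (hp : 1 ≤ p) {C : H →L[ℂ] H} (hC : IsSelfAdjoint C)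
    (hc : IsCompactOperator C) : schattenNorm p C ≤ diagSup 1 C := by
  have hp0 : 0 < p := by linarith
  have h1 : ‖C‖ₑ ≤ diagSup 1 C := by simpa using enorm_rpow_le_diagSup one_pos hC
  rw [schattenNorm_eq_diagSup hp hC hc, one_div, ENNReal.rpow_inv_le_iff hp0]
  refine (diagSup_le_of_enorm_le hp h1).trans (le_of_eq ?_)
  calc diagSup 1 C ^ (p - 1) * diagSup 1 C = diagSup 1 C ^ (p - 1) * diagSup 1 C ^ (1 : ℝ) := by
        rw [ENNReal.rpow_one]
    _ = diagSup 1 C ^ (p - 1 + 1) :=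
        (ENNReal.rpow_add_of_nonneg _ _ (by linarith) zero_le_one).symm
    _ = diagSup 1 C ^ p := by rw [sub_add_cancel]

theorem isClosed_eigenspace {D : H →ₗ.[ℂ] H} (hD : IsSelfAdjoint D) (z : ℂ) :
    IsClosed (eigenspace D z : Set H) := by
  have h : (eigenspace D z : Set H) = (fun u => (u, z • u)) ⁻¹' (D.graph : Set (H × H)) := rfl
  rw [h]
  exact (isClosed_graph hD).preimage (by fun_prop)

/-- The eigenvalues whose eigenspaces overlap `ψ` noticeably are finite in number. -/
theorem finite_setOf_overlap {D : H →ₗ.[ℂ] H} (hD : IsSelfAdjoint D) (ψ : H) {c : ℝ} (hc : 0 < c) :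
    {E : ℝ | ∃ u : H, ‖u‖ ≤ 1 ∧ (u, (E : ℂ) • u) ∈ D.graph ∧ c ≤ ‖inner ℂ ψ u‖}.Finite := by
  by_contra hinf
  -- Eigenvectors at different eigenvalues are orthogonal, so by Bessel at most ‖ψ‖²/c² of them can
  -- overlap ψ by c.
  obtain ⟨n, hn⟩ := exists_nat_gt (‖ψ‖ ^ 2 / c ^ 2)
  obtain ⟨t, ht, htn⟩ := Set.Infinite.exists_subset_card_eq hinf n
  have ht' : ∀ E ∈ t, ∃ u : H, ‖u‖ ≤ 1 ∧ (u, (E : ℂ) • u) ∈ D.graph ∧ c ≤ ‖inner ℂ ψ u‖ :=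
    fun E hE => ht hE
  choose! u hu hg hcu using ht'
  have hne : ∀ E ∈ t, ‖u E‖ ≠ 0 := fun E hE h0 => by
    have := hcu E hE
    rw [norm_eq_zero.1 h0, inner_zero_right, norm_zero] at this
    linarith
  set v : t → H := fun E => ((‖u E‖⁻¹ : ℝ) : ℂ) • u E with hv
  have hvo : Orthonormal ℂ v := by
    refine ⟨fun E => ?_, fun E E' hEE => ?_⟩
    · rw [hv, norm_smul, Complex.norm_real, norm_inv, norm_norm, inv_mul_cancel₀ (hne E E.2)]
    · change inner ℂ (((‖u E‖⁻¹ : ℝ) : ℂ) • u E) (((‖u E'‖⁻¹ : ℝ) : ℂ) • u E') = 0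
      rw [inner_smul_left, inner_smul_right,
        inner_eq_zero_of_eigenvectors hD (fun h => hEE (Subtype.ext h)) (hg E E.2) (hg E' E'.2)]
      simp
  have h1 := hvo.sum_inner_products_le ψ (s := Finset.univ)
  have h2 : ∀ E : t, c ^ 2 ≤ ‖inner ℂ (v E) ψ‖ ^ 2 := fun E => by
    have h3 : c ≤ ‖inner ℂ (v E) ψ‖ := by
      rw [hv, inner_smul_left, norm_mul, norm_inner_symm, RCLike.norm_conj, Complex.norm_real,
        norm_inv, norm_norm]
      refine (hcu E E.2).trans ?_
      refine le_mul_of_one_le_left (norm_nonneg _) ?_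
      exact (one_le_inv₀ (lt_of_le_of_ne (norm_nonneg _) (hne E E.2).symm)).2 (hu E E.2)
    gcongr
  have h3 : (n : ℝ) * c ^ 2 ≤ ‖ψ‖ ^ 2 := by
    calc (n : ℝ) * c ^ 2 = ∑ _E : t, c ^ 2 := by simp [htn]
      _ ≤ _ := Finset.sum_le_sum fun E _ => h2 E
      _ ≤ _ := h1
  rw [div_lt_iff₀ (by positivity)] at hn
  linarith

/-- Only finitely many eigenvalues of A + C offend, and they are spread by perturbations F tending
to 0. If an offending eigenvector survived for every F, a weak limit would be an offending
eigenvector of A + C itself, yet still satisfy the small overlap bound that spreading imposes. -/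
theorem dense_compl_hasEssEigenvalue {A : H →ₗ.[ℂ] H} (hA : IsSelfAdjoint A) {p : ℝ} (hp : 1 ≤ p)
    (ψ : H) (M : ℝ) {c : ℝ} (hc : 0 < c) : Dense (hasEssEigenvalue A p ψ M c)ᶜ := by
  refine SASchatten.dense_of_forall_exists hp fun C δ hδ => ?_
  by_contra! hcon
  have hD := isSelfAdjoint_perturb hA C.2.1
  have hess : essSpec (perturb A C.1) = essSpec A :=
    essSpec_perturb C.2.1 (C.isCompactOperator hp)
  have hfin := (finite_setOf_overlap hD ψ hc).subset
    (Set.inter_subset_right (s := essSpec A ∩ Set.Icc (-M) M))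
  set s : Finset ℝ := hfin.toFinset with hs
  have hsmem : ∀ E, E ∈ s ↔ E ∈ essSpec A ∩ Set.Icc (-M) M ∧
      ∃ u : H, ‖u‖ ≤ 1 ∧ (u, (E : ℂ) • u) ∈ (perturb A C.1).graph ∧ c ≤ ‖inner ℂ ψ u‖ :=
    fun E => hfin.mem_toFinset
  -- Take a E to be the normalised projection of ψ to the eigenspace: all overlap of ψ with that
  -- eigenspace passes through this one vector, whatever the multiplicity.
  have ha : ∀ E ∈ s, ∃ a : H, ‖a‖ = 1 ∧ (a, (E : ℂ) • a) ∈ (perturb A C.1).graph ∧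
      ∀ u : H, (u, (E : ℂ) • u) ∈ (perturb A C.1).graph →
        ‖inner ℂ ψ u‖ ≤ ‖ψ‖ * ‖inner ℂ a u‖ := by
    intro E hE
    obtain ⟨-, u, -, hug, huc⟩ := (hsmem E).1 hE
    have hcs : CompleteSpace (eigenspace (perturb A C.1) E) :=
      (isClosed_eigenspace hD E).completeSpace_coe
    set V := eigenspace (perturb A C.1) E with hV
    set w : H := V.starProjection ψ with hw
    have hin : ∀ u : H, (u, (E : ℂ) • u) ∈ (perturb A C.1).graph → inner ℂ ψ u = inner ℂ w u := by
      intro u hu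
      have h1 : inner ℂ (ψ - w) u = 0 :=
        (Submodule.mem_orthogonal' _ _).1 (V.sub_starProjection_mem_orthogonal ψ) u hu
      rwa [inner_sub_left, sub_eq_zero] at h1
    have hw0 : ‖w‖ ≠ 0 := fun h0 => by
      rw [hin u hug, norm_eq_zero.1 h0, inner_zero_left, norm_zero] at huc
      linarith
    have hwV : (w, (E : ℂ) • w) ∈ (perturb A C.1).graph := V.starProjection_apply_mem ψ
    refine ⟨((‖w‖⁻¹ : ℝ) : ℂ) • w, ?_, ?_, fun u hu => ?_⟩
    · rw [norm_smul, Complex.norm_real, norm_inv, norm_norm, inv_mul_cancel₀ hw0]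
    · rw [smul_comm]
      exact graph_smul _ hwV
    · rw [hin u hu, inner_smul_left, norm_mul, RCLike.norm_conj, Complex.norm_real, norm_inv,
        norm_norm, ← mul_assoc]
      refine le_mul_of_one_le_left (norm_nonneg _) ?_
      rw [← div_eq_mul_inv, one_le_div (lt_of_le_of_ne (norm_nonneg _) hw0.symm)]
      exact V.norm_starProjection_apply_le ψ
  choose! a ha1 hag hau using ha
  -- N is fixed before F tends to 0, so that the same bound 1/√(N+1) holds in the limit.
  obtain ⟨N, hN⟩ : ∃ N : ℕ, ‖ψ‖ * (1 / √(N + 1)) < c := by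
    obtain ⟨N, hN⟩ := exists_nat_gt ((‖ψ‖ / c) ^ 2)
    refine ⟨N, ?_⟩
    rw [mul_one_div, div_lt_iff₀ (Real.sqrt_pos.2 (by positivity)), ← div_lt_iff₀' hc]
    exact Real.lt_sqrt_of_sq_lt (by linarith)
  have hex : ∀ m : ℕ, ∃ (F : H →L[ℂ] H) (E : ℝ) (u : H), ‖F‖ₑ ≤ ENNReal.ofReal (1 / (m + 1)) ∧
      (∀ E ∈ s, ∀ (E' : ℝ) (u : H), (u, (E' : ℂ) • u) ∈ (perturb (perturb A C.1) F).graph →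
        ‖inner ℂ (a E) u‖ ≤ 1 / √(N + 1) * ‖u‖) ∧
      E ∈ essSpec A ∩ Set.Icc (-M) M ∧ ‖u‖ ≤ 1 ∧
      (u, (E : ℂ) • u) ∈ (perturb (perturb A C.1) F).graph ∧ c ≤ ‖inner ℂ ψ u‖ := by
    intro m
    obtain ⟨F, hFs, hFc, hFd, hF⟩ := exists_perturb_spread hD s
      (fun E hE => by rw [hess]; exact ((hsmem E).1 hE).1.1) (fun E hE => ⟨ha1 E hE, hag E hE⟩) N
      (τ := min (1 / (m + 1)) (δ / 2)) (lt_min (by positivity) (by positivity))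
    have h1 : schattenNorm p F < ENNReal.ofReal δ := by
      refine ((schattenNorm_le_diagSup_one hp hFs hFc).trans hFd).trans_lt ?_
      refine (ENNReal.ofReal_lt_ofReal_iff hδ).2 ((min_le_right _ _).trans_lt ?_)
      linarith
    have h2 := hcon F hFs (h1.trans ENNReal.ofReal_lt_top) h1
    rw [Set.mem_compl_iff, not_not] at h2
    obtain ⟨E, hE, u, hu, hg, huc⟩ := h2
    have h3 : ‖F‖ₑ ≤ diagSup 1 F := by simpa using enorm_rpow_le_diagSup one_pos hFs
    refine ⟨F, E, u, (h3.trans hFd).trans (ENNReal.ofReal_le_ofReal (min_le_left _ _)), hF, hE, hu,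
      ?_, huc⟩
    rw [perturb_perturb]
    exact hg
  choose F E u hFn hF hE hu hg huc using hex
  have hF0 : Tendsto F atTop (𝓝 0) := by
    refine squeeze_zero_norm (fun m => ?_) tendsto_one_div_add_atTop_nhds_zero_nat
    have := hFn m
    rwa [← ofReal_norm, ENNReal.ofReal_le_ofReal_iff (by positivity)] at this
  obtain ⟨E₀, hE₀, u₀, hu₀, hg₀, hlim⟩ := exists_limit_eigenvector hD (hyperfilter ℕ)
    (isCompact_Icc.inter_left (isClosed_essSpec A)) (hF0.mono_left Nat.hyperfilter_le_atTop)
    (E := E) (u := u) (Eventually.of_forall fun m => ⟨hE m, hu m, hg m⟩)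
  have hcu₀ : c ≤ ‖inner ℂ ψ u₀‖ := ge_of_tendsto (hlim ψ).norm (Eventually.of_forall huc)
  have hE₀s : E₀ ∈ s := (hsmem E₀).2 ⟨hE₀, u₀, hu₀, hg₀, hcu₀⟩
  have hle : ‖inner ℂ (a E₀) u₀‖ ≤ 1 / √(N + 1) := by
    refine le_of_tendsto (hlim (a E₀)).norm (Eventually.of_forall fun m => ?_)
    refine (hF m E₀ hE₀s (E m) (u m) (hg m)).trans ?_
    exact mul_le_of_le_one_right (by positivity) (hu m)
  have := hau E₀ hE₀s u₀ hg₀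
  have h5 : ‖ψ‖ * ‖inner ℂ (a E₀) u₀‖ ≤ ‖ψ‖ * (1 / √(N + 1)) := by gcongr
  linarith

/-! ### The Baire category argument -/

theorem IsSmallBump.mono {f : ℝ → ℝ} {ε ε' : ℝ} (hf : IsSmallBump f ε) (h : ε ≤ ε') :
    IsSmallBump f ε' :=
  ⟨hf.cont, hf.hasCompactSupport, hf.nonneg, hf.le_one, hf.integral_lt.trans_le h⟩

theorem nearlySingular_mono (A : H →ₗ.[ℂ] H) (p : ℝ) (ψ : H) {ε ε' : ℝ} (h : ε ≤ ε') :
    nearlySingular A p ψ ε ⊆ nearlySingular A p ψ ε' :=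
  fun _ ⟨f, hf, hlt⟩ => ⟨f, hf.mono h, lt_of_le_of_lt (by linarith) hlt⟩

/-- Baire's theorem, applied to `nearlySingular` and to the complements of `hasEssEigenvalue`. -/
theorem genericSingCont_of_dense_nearlySingular [TopologicalSpace.SeparableSpace H]
    {A : H →ₗ.[ℂ] H} (hA : IsSelfAdjoint A) {p : ℝ} (hp : 1 ≤ p)
    (hd : ∀ (ψ : H) (ε : ℝ), 0 < ε → Dense (nearlySingular A p ψ ε)) : GenericSingCont A p := by
  have := SASchatten.baireSpace (H := H) hp
  obtain ⟨S, hSc, hS⟩ := TopologicalSpace.exists_countable_dense H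
  have := hSc.to_subtype
  set V : S × ℕ → Set (SASchatten H p) := fun q =>
    nearlySingular A p q.1 (1 / (q.2 + 1)) with hV
  set W : S × ℕ → Set (SASchatten H p) := fun q =>
    (hasEssEigenvalue A p q.1 q.2 (1 / (q.2 + 1)))ᶜ with hW
  have hVo : ∀ q, IsOpen (V q) := fun q => isOpen_nearlySingular hA hp _ _
  have hWo : ∀ q, IsOpen (W q) := fun q => (isClosed_hasEssEigenvalue hA hp _ _ _).isOpen_compl
  have hVd : ∀ q, Dense (V q) := fun q => hd _ _ (by positivity)
  have hWd : ∀ q, Dense (W q) := fun q => dense_compl_hasEssEigenvalue hA hp _ _ (by positivity)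
  have hVG : IsGδ (⋂ q, V q) := IsGδ.iInter_of_isOpen hVo
  have hWG : IsGδ (⋂ q, W q) := IsGδ.iInter_of_isOpen hWo
  refine ⟨(⋂ q, V q) ∩ ⋂ q, W q, hVG.inter hWG,
    (dense_iInter_of_isOpen hVo hVd).inter_of_Gδ hVG hWG (dense_iInter_of_isOpen hWo hWd), ?_⟩
  rintro C ⟨hCV, hCW⟩
  rw [Set.mem_iInter] at hCV hCW
  have hD := isSelfAdjoint_perturb hA C.2.1
  refine topologicalClosure_span_eq_top hD
    (mutuallySingular_specMeasure_of_dense hD hS fun ψ hψ ε hε => ?_) fun E u hu hE => ?_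
  · obtain ⟨n, hn⟩ := exists_nat_one_div_lt hε
    exact nearlySingular_mono A p ψ hn.le (hCV (⟨ψ, hψ⟩, n))
  · refine mem_discreteSpec_of_notMem_essSpec hD hu hE fun hess => ?_
    rw [essSpec_perturb C.2.1 (C.isCompactOperator hp)] at hess
    have hu0 : 0 < ‖u‖ := norm_pos_iff.2 hu
    set v : H := ((‖u‖⁻¹ : ℝ) : ℂ) • u with hv
    have hv1 : ‖v‖ = 1 := by
      rw [hv, norm_smul, Complex.norm_real, norm_inv, norm_norm, inv_mul_cancel₀ hu0.ne']
    have hvE : (v, (E : ℂ) • v) ∈ (perturb A C.1).graph :=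
      (eigenspace (perturb A C.1) (E : ℂ)).smul_mem _ hE
    obtain ⟨ψ, hψ, hψv⟩ : ∃ ψ ∈ S, inner ℂ ψ v ≠ 0 := by
      by_contra! hcon
      have h0 : v = 0 := hS.eq_zero_of_inner_right (𝕜 := ℂ) hcon
      rw [h0, norm_zero] at hv1
      exact zero_ne_one hv1
    obtain ⟨n₁, hn₁⟩ := exists_nat_ge |E|
    obtain ⟨n₂, hn₂⟩ := exists_nat_one_div_lt (norm_pos_iff.2 hψv)
    -- One index serves both as energy bound, hence at least |E|, and as overlap threshold 1/(n+1),
    -- hence large enough to fall below the actual overlap.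
    refine hCW (⟨ψ, hψ⟩, max n₁ n₂) ⟨E, ⟨hess, abs_le.1 (hn₁.trans ?_)⟩, v, hv1.le, hvE, ?_⟩
    · exact_mod_cast le_max_left n₁ n₂
    · refine le_trans ?_ hn₂.le
      refine one_div_le_one_div_of_le (by positivity) ?_
      gcongr
      exact le_max_right n₁ n₂

end SingCont

theorem theorem4 {H : Type*} [NormedAddCommGroup H] [InnerProductSpace ℂ H] [CompleteSpace H]
    [TopologicalSpace.SeparableSpace H] (A : H →ₗ.[ℂ] H) (hA : IsSelfAdjoint A) :
    SingCont.GenericSingCont A 2 ∧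
    (∀ p : ℝ, 1 < p → SingCont.GenericSingCont A p) ∧
    (SingCont.NoACSpectrum A → SingCont.GenericSingCont A 1) := by
  have h : ∀ p : ℝ, 1 < p → SingCont.GenericSingCont A p := fun p hp =>
    SingCont.genericSingCont_of_dense_nearlySingular hA hp.le fun ψ _ hε =>
      SingCont.dense_nearlySingular hA hp ψ hε
  exact ⟨h 2 one_lt_two, h, fun hac =>
    SingCont.genericSingCont_of_dense_nearlySingular hA le_rfl fun ψ _ hε =>
      SingCont.dense_nearlySingular_one hA
        (SingCont.mutuallySingular_specMeasure_of_noACSpectrum hA hac) ψ hε⟩
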